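/- Let $p>3$ be a prime. For $n\ge 0$ put $$g_n=\sum_{k=0}^n\binom nk^2\binom{2k}k,\qquad h_n=\sum_{k=0}^n\binom nk^2C_k,\qquad H_n^{(2)}=\sum_{0<k\le n}\frac1{k^2},$$ where $C_k=\frac1{k+1}\binom{2k}k$ is the $k$-th Catalan number. Let $B_n(x)$ denote the $n$-th Bernoulli polynomial and $\left(\frac p3\right)$ the Legendre symbol. Call a rational number $p$-integral if $p$ does not divide its denominator in lowest terms; for $p$-integral rationals $x,y$ and $m\ge1$, write $x\equiv y\pmod{p^m}$ if $(x-y)/p^m$ is $p$-integral. Then all numbers in the congruences below are $p$-integral, and $$\frac1{p^2}\sum_{k=1}^{p-1}g_k\equiv\sum_{k=1}^{p-1}g_kH_k^{(2)}\equiv\frac58\left(\frac p3\right)B_{p-2}\left(\frac13\right)\pmod p,$$ $$\frac1{p^2}\sum_{k=1}^{p-1}h_k\equiv\sum_{k=1}^{p-1}h_kH_k^{(2)}\equiv\frac34\left(\frac p3\right)B_{p-2}\left(\frac13\right)\pmod p.$$ Consequently, $$\sum_{k=1}^{p-1}g_k\equiv\frac58\,p^2\left(\frac p3\right)B_{p-2}\left(\frac13\right)\pmod{p^3},\qquad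 \sum_{k=1}^{p-1}h_k\equiv\frac34\,p^2\left(\frac p3\right)B_{p-2}\left(\frac13\right)\pmod{p^3}.$$ -/

import Mathlib

/-- `g n = ∑_{k=0}^n C(n,k)² C(2k,k)`. -/
def gSeq (n : ℕ) : ℕ :=
  ∑ k ∈ Finset.range (n + 1), n.choose k ^ 2 * (2 * k).choose k

/-- `h n = ∑_{k=0}^n C(n,k)² C_k`, where `C_k` is the `k`-th Catalan number. -/
def hSeq (n : ℕ) : ℕ :=
  ∑ k ∈ Finset.range (n + 1), n.choose k ^ 2 * catalan k

/-- The harmonic number of second order, `H_n^{(2)} = ∑_{0 < k ≤ n} 1 / k²`. -/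
def harmonicTwo (n : ℕ) : ℚ :=
  ∑ k ∈ Finset.Icc 1 n, 1 / (k : ℚ) ^ 2

/-- A rational number is `p`-integral if `p` does not divide its denominator (in lowest terms). -/
def IsPIntegral (p : ℕ) (x : ℚ) : Prop :=
  ¬ p ∣ x.den

/-- Congruence `x ≡ y (mod p ^ m)` of `p`-integral rational numbers: `x` and `y` are both
`p`-integral, and `x - y` is `p ^ m` times a `p`-integral rational number. -/
def RatModEq (p m : ℕ) (x y : ℚ) : Prop :=
  IsPIntegral p x ∧ IsPIntegral p y ∧ ∃ c : ℚ, IsPIntegral p c ∧ x - y = (p : ℚ) ^ m * c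

/-- The rational number `(p/3) B_{p-2}(1/3)`, where `(·/3)` is the Legendre symbol and
`B_n(x)` is the `n`-th Bernoulli polynomial. -/
noncomputable def legendreBernoulli (p : ℕ) : ℚ :=
  (legendreSym 3 (p : ℤ) : ℚ) * (Polynomial.bernoulli (p - 2)).eval (1 / 3 : ℚ)

/-! Weight the sequences by P_n = ∏_{j≤n}(1 - p²/j²), which is 1 - p²H_n^{(2)} modulo p⁴. Since P_n
= (-1)^n C(p-1,n) C(p+n,p), finite differences evaluate ∑_{n<p} P_n C(n,k)² in closed form: times
C(2k,k) it is p P_k²/(2k+1) (`sum_sineProd_mul_choose_sq`). Hence ∑ P_n g_n = ∑ p P_k²/(2k+1), and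
h_n gets an extra factor 1/(k+1). Only the terms whose denominator contains p survive modulo p³, by
congruences of Wolstenholme type, and both sums are 1. Comparing with P_n ≡ 1 - p²H_n^{(2)} gives ∑
g_n ≡ p² ∑ g_n H_n^{(2)} modulo p³, and the same for h (`sum_pCong_of_sum_sineProd_mul`).

It remains to find ∑ g_n H_n^{(2)} and ∑ h_n H_n^{(2)} modulo p. Linearising C(k,j)² and summing
against H_k^{(2)} leaves harmonic numbers with weights that telescope in j, so with n = (p-1)/2 the
first sum is -∑_{j≤n} S_j/(2j+1), where S_j = (3/2)∑_{i≤j} C(2i,i)/i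
(`sum_legendreWeight_mul_harmonic`, `choose_mul_chooseSqSum_pCong`). Abel summation, C(2i,i) ≡
(-4)^i C(n,i) refined modulo p², and the evaluation of (1+√-3)^p + (1-√-3)^p turn this into N =
∑((-3)^m - 1)H_{2m-1}/m. For h one also needs Y = ∑ C(2i,i)H_i/i.

Both N and Y are values of the finite dilogarithm L₂(x,y) = ∑_{0<k<p} x^k y^{p-k}/k² at a root ζ of
ζ(1-ζ) = 1, a primitive sixth root of unity in an algebraic closure of 𝔽_p. Polynomial identities
for L₂ are proved by differentiating, which reduces them to L₁, essentially ((x+y)^p - x^p - y^p)/p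
(`eq_zero_of_derivative_eq_zero`). With F = L₂(ζ,1-ζ), one gets Y = 2F, and the duplication formula
gives N = -(5/2)F. Filtering by cube roots of unity gives 3F = ∑_{l≤p/3} 1/l², and Faulhaber's
formula with the reflection of Bernoulli polynomials shows 6F = (p/3)B_{p-2}(1/3)
(`two_mul_sum_third_inv_sq`). Then -(3/2)N and -3N - (3/2)Y are the two constants claimed. -/

/-! ### The ring of p-integral rationals and its reduction modulo p. -/

/-- The subring of `p`-integral rational numbers. -/
noncomputable def pIntegers (p : ℕ) [Fact p.Prime] : Subring ℚ := (Rat.padicValuation p).integer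

theorem mem_pIntegers_iff {p : ℕ} [Fact p.Prime] {x : ℚ} :
    x ∈ pIntegers p ↔ IsPIntegral p x := by
  rw [IsPIntegral, ← Rat.padicValuation_le_one_iff]
  exact Valuation.mem_integer_iff _ _

/-- Congruence of rational numbers modulo `p ^ m` times the `p`-integral rational numbers. -/
def PCong (p : ℕ) [Fact p.Prime] (m : ℕ) (x y : ℚ) : Prop :=
  ∃ c ∈ pIntegers p, x - y = (p : ℚ) ^ m * c

section
variable {p : ℕ} [Fact p.Prime]

theorem natCast_mem_pIntegers (k : ℕ) : (k : ℚ) ∈ pIntegers p := natCast_mem _ k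

theorem den_cast_ne_zero {K : Type*} [Field K] [CharP K p] {x : ℚ} (hx : x ∈ pIntegers p) :
    (x.den : K) ≠ 0 := by
  rw [Ne, CharP.cast_eq_zero_iff K p]
  exact mem_pIntegers_iff.1 hx

theorem inv_natCast_mem_pIntegers {k : ℕ} (hk : ¬ p ∣ k) : (k : ℚ)⁻¹ ∈ pIntegers p := by
  rw [mem_pIntegers_iff, IsPIntegral, Rat.inv_natCast_den]
  split_ifs
  · exact (Fact.out : p.Prime).one_lt.ne' ∘ Nat.dvd_one.1
  · exact hk

theorem inv_mem_pIntegers_of_lt {k : ℕ} (hk : 0 < k) (hkp : k < p) : (k : ℚ)⁻¹ ∈ pIntegers p :=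
  inv_natCast_mem_pIntegers (Nat.not_dvd_of_pos_of_lt hk hkp)

/-- The cast from ℚ to a field of characteristic p is not a ring homomorphism; it respects the
operations where denominators stay invertible, hence the membership hypotheses. -/
theorem ratCast_add {K : Type*} [Field K] [CharP K p] {x y : ℚ} (hx : x ∈ pIntegers p)
    (hy : y ∈ pIntegers p) : ((x + y : ℚ) : K) = x + y :=
  Rat.cast_add_of_ne_zero (den_cast_ne_zero hx) (den_cast_ne_zero hy)

theorem ratCast_sub {K : Type*} [Field K] [CharP K p] {x y : ℚ} (hx : x ∈ pIntegers p)
    (hy : y ∈ pIntegers p) : ((x - y : ℚ) : K) = x - y :=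
  Rat.cast_sub_of_ne_zero (den_cast_ne_zero hx) (den_cast_ne_zero hy)

theorem ratCast_mul {K : Type*} [Field K] [CharP K p] {x y : ℚ} (hx : x ∈ pIntegers p)
    (hy : y ∈ pIntegers p) : ((x * y : ℚ) : K) = x * y :=
  Rat.cast_mul_of_ne_zero (den_cast_ne_zero hx) (den_cast_ne_zero hy)

theorem ratCast_pow {K : Type*} [Field K] [CharP K p] {x : ℚ} (hx : x ∈ pIntegers p) (n : ℕ) :
    ((x ^ n : ℚ) : K) = (x : K) ^ n := by
  induction n with
  | zero => simp
  | succ n ih => rw [pow_succ, ratCast_mul (pow_mem hx n) hx, ih, pow_succ]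

theorem ratCast_sum {K : Type*} [Field K] [CharP K p] {ι : Type*} {s : Finset ι} {f : ι → ℚ}
    (hf : ∀ i ∈ s, f i ∈ pIntegers p) : ((∑ i ∈ s, f i : ℚ) : K) = ∑ i ∈ s, (f i : K) := by
  classical
  induction s using Finset.induction_on with
  | empty => simp
  | insert a s ha ih =>
    rw [Finset.sum_insert ha, Finset.sum_insert ha,
      ratCast_add (hf a (Finset.mem_insert_self a s))
        (sum_mem fun i hi => hf i (Finset.mem_insert_of_mem hi)),
      ih fun i hi => hf i (Finset.mem_insert_of_mem hi)]

omit [Fact p.Prime] in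
theorem ratCast_inv_natCast {K : Type*} [Field K] [CharP K p] {k : ℕ} (hk : ¬ p ∣ k) :
    (((k : ℚ)⁻¹ : ℚ) : K) = (k : K)⁻¹ := by
  have : (((k : ℚ).num : ℤ) : K) ≠ 0 := by
    simpa [CharP.cast_eq_zero_iff K p] using hk
  rw [Rat.cast_inv_of_ne_zero this, Rat.cast_natCast]

theorem ratCast_eq_zero_iff {K : Type*} [Field K] [CharP K p] {x : ℚ} (hx : x ∈ pIntegers p) :
    (x : K) = 0 ↔ ∃ c ∈ pIntegers p, x = p * c := by
  constructor
  · intro h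
    rw [Rat.cast_def, div_eq_zero_iff, or_iff_left (den_cast_ne_zero hx),
      CharP.intCast_eq_zero_iff K p] at h
    obtain ⟨c, hc⟩ := h
    refine ⟨c * (x.den : ℚ)⁻¹, mul_mem (intCast_mem _ c)
      (inv_natCast_mem_pIntegers (mem_pIntegers_iff.1 hx)), ?_⟩
    rw [← mul_assoc]
    have : (p : ℚ) * c = x.num := by rw [hc]; push_cast; ring
    rw [this, ← div_eq_mul_inv, Rat.num_div_den]
  · rintro ⟨c, hc, rfl⟩
    rw [ratCast_mul (natCast_mem_pIntegers p) hc, Rat.cast_natCast, CharP.cast_eq_zero, zero_mul]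

/-- Congruences modulo p can thus be checked in any field of characteristic p, in particular in one
containing sixth roots of unity. -/
theorem pCong_one_iff (K : Type*) [Field K] [CharP K p] {x y : ℚ} (hx : x ∈ pIntegers p)
    (hy : y ∈ pIntegers p) : PCong p 1 x y ↔ (x : K) = y := by
  rw [← sub_eq_zero, ← ratCast_sub hx hy, ratCast_eq_zero_iff (sub_mem hx hy), PCong, pow_one]

theorem ratModEq_iff {m : ℕ} {x y : ℚ} :
    RatModEq p m x y ↔ x ∈ pIntegers p ∧ y ∈ pIntegers p ∧ PCong p m x y := by
  simp only [RatModEq, PCong, mem_pIntegers_iff]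

namespace PCong
variable {m k : ℕ} {x y z w : ℚ}

theorem refl (x : ℚ) : PCong p m x x := ⟨0, zero_mem _, by simp⟩

theorem symm (h : PCong p m x y) : PCong p m y x := by
  obtain ⟨c, hc, h⟩ := h
  exact ⟨-c, neg_mem hc, by linear_combination -h⟩

theorem trans (h : PCong p m x y) (h' : PCong p m y z) : PCong p m x z := by
  obtain ⟨c, hc, h⟩ := h
  obtain ⟨d, hd, h'⟩ := h'
  exact ⟨c + d, add_mem hc hd, by linear_combination h + h'⟩

theorem add (h : PCong p m x y) (h' : PCong p m z w) : PCong p m (x + z) (y + w) := by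
  obtain ⟨c, hc, h⟩ := h
  obtain ⟨d, hd, h'⟩ := h'
  exact ⟨c + d, add_mem hc hd, by linear_combination h + h'⟩

theorem sub (h : PCong p m x y) (h' : PCong p m z w) : PCong p m (x - z) (y - w) := by
  obtain ⟨c, hc, h⟩ := h
  obtain ⟨d, hd, h'⟩ := h'
  exact ⟨c - d, sub_mem hc hd, by linear_combination h - h'⟩

theorem mul_left (hz : z ∈ pIntegers p) (h : PCong p m x y) : PCong p m (z * x) (z * y) := by
  obtain ⟨c, hc, h⟩ := h
  exact ⟨z * c, mul_mem hz hc, by linear_combination z * h⟩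

theorem mul_right (hz : z ∈ pIntegers p) (h : PCong p m x y) : PCong p m (x * z) (y * z) := by
  rw [mul_comm x, mul_comm y]
  exact h.mul_left hz

theorem pow_mul (h : PCong p m x y) : PCong p (k + m) ((p : ℚ) ^ k * x) ((p : ℚ) ^ k * y) := by
  obtain ⟨c, hc, h⟩ := h
  exact ⟨c, hc, by rw [pow_add]; linear_combination (p : ℚ) ^ k * h⟩

theorem of_pow_mul (h : PCong p (k + m) ((p : ℚ) ^ k * x) ((p : ℚ) ^ k * y)) :
    PCong p m x y := by
  obtain ⟨c, hc, h⟩ := h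
  have hp : (p : ℚ) ^ k ≠ 0 := pow_ne_zero _ (Nat.cast_ne_zero.2 (Fact.out : p.Prime).ne_zero)
  exact ⟨c, hc, mul_left_cancel₀ hp (by rw [pow_add] at h; linear_combination h)⟩

theorem sum {ι : Type*} {s : Finset ι} {f g : ι → ℚ} (h : ∀ i ∈ s, PCong p m (f i) (g i)) :
    PCong p m (∑ i ∈ s, f i) (∑ i ∈ s, g i) := by
  classical
  induction s using Finset.induction_on with
  | empty => simpa using refl 0
  | insert a s ha ih =>
    rw [Finset.sum_insert ha, Finset.sum_insert ha]
    exact (h a (Finset.mem_insert_self a s)).add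
      (ih fun i hi => h i (Finset.mem_insert_of_mem hi))

theorem mem_left (h : PCong p m x y) (hy : y ∈ pIntegers p) : x ∈ pIntegers p := by
  obtain ⟨c, hc, h⟩ := h
  rw [sub_eq_iff_eq_add.1 h]
  exact add_mem (mul_mem (pow_mem (natCast_mem_pIntegers p) _) hc) hy

end PCong
end

/-! ### Finite differences and the closed form of the weighted sums. -/

/-- An (M+1)-fold difference is the M-fold difference of a first difference, by Pascal's rule. -/
theorem sum_range_succ_choose_alternating {R : Type*} [CommRing R] (M : ℕ) (f : ℕ → R) :
    ∑ m ∈ Finset.range (M + 2), (-1) ^ m * ((M + 1).choose m : R) * f m =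
      ∑ m ∈ Finset.range (M + 1), (-1) ^ m * (M.choose m : R) * (f m - f (m + 1)) := by
  have h1 : ∑ m ∈ Finset.range (M + 1), (-1) ^ m * (M.choose m : R) * f m =
      f 0 + ∑ m ∈ Finset.range (M + 1), (-1) ^ (m + 1) * (M.choose (m + 1) : R) * f (m + 1) := by
    rw [Finset.sum_range_succ', Finset.sum_range_succ (n := M)]
    simp [add_comm]
  rw [Finset.sum_range_succ']
  simp only [mul_sub, Finset.sum_sub_distrib]
  rw [h1]
  simp only [Nat.choose_succ_succ, Nat.cast_add, pow_succ, Nat.choose_zero_right, pow_zero,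
    Nat.cast_one, one_mul, mul_add, add_mul, Finset.sum_add_distrib]
  simp only [mul_neg, mul_one, neg_mul, Finset.sum_neg_distrib]
  ring

/-- Each difference of a binomial coefficient in its upper index lowers the lower index by one. -/
theorem sum_alternating_choose_mul_choose_add {R : Type*} [CommRing R] (M a b : ℕ) :
    ∑ m ∈ Finset.range (M + 1), (-1) ^ m * (M.choose m : R) * ((a + m).choose (b + M) : R) =
      (-1) ^ M * (a.choose b : R) := by
  induction M generalizing b with
  | zero => simp
  | succ M ih =>
    rw [sum_range_succ_choose_alternating M fun m => (((a + m).choose (b + (M + 1)) : ℕ) : R)]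
    have : ∀ m, (((a + m).choose (b + (M + 1)) : ℕ) : R) -
        (((a + (m + 1)).choose (b + (M + 1)) : ℕ) : R) = -((a + m).choose (b + M) : R) := by
      intro m
      rw [← add_assoc a, ← add_assoc b, Nat.choose_succ_succ]
      push_cast
      ring
    simp only [this, mul_neg, Finset.sum_neg_distrib, ih, pow_succ]
    ring

theorem sum_alternating_choose_mul_choose_eq_zero {R : Type*} [CommRing R] {M b : ℕ} (a : ℕ)
    (h : b < M) :
    ∑ m ∈ Finset.range (M + 1), (-1) ^ m * (M.choose m : R) * ((a + m).choose b : R) = 0 := by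
  obtain ⟨c, rfl⟩ : ∃ c, M = b + c + 1 := ⟨M - b - 1, by omega⟩
  clear h
  induction b generalizing c with
  | zero => 
    rw [sum_range_succ_choose_alternating _ fun m => (((a + m).choose 0 : ℕ) : R)]
    simp
  | succ b ih =>
    rw [sum_range_succ_choose_alternating _ fun m => (((a + m).choose (b + 1) : ℕ) : R)]
    have : ∀ m, (((a + m).choose (b + 1) : ℕ) : R) -
        (((a + (m + 1)).choose (b + 1) : ℕ) : R) = -((a + m).choose b : R) := by
      intro m
      rw [← add_assoc a, Nat.choose_succ_succ]
      push_cast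
      ring
    simp only [this, mul_neg, Finset.sum_neg_distrib]
    rw [show b + 1 + c = b + c + 1 by ring, ih, neg_zero]

/-- The product `∏_{1 ≤ j ≤ n} (1 - x² / j²)`. -/
noncomputable def sineProd (x : ℚ) (n : ℕ) : ℚ :=
  ∏ j ∈ Finset.range n, (1 - x ^ 2 / ((j : ℚ) + 1) ^ 2)

theorem choose_succ_right_cast (n k : ℕ) :
    (n.choose (k + 1) : ℚ) = n.choose k * ((n : ℚ) - k) / (k + 1) := by
  have hk : (k : ℚ) + 1 ≠ 0 := by positivity
  rw [eq_div_iff hk]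
  rcases le_or_gt k n with h | h
  · have := Nat.choose_succ_right_eq n k
    zify [h] at this
    exact_mod_cast this
  · rw [Nat.choose_eq_zero_of_lt h, Nat.choose_eq_zero_of_lt (by omega)]
    simp

theorem succ_choose_cast (n k : ℕ) :
    ((n + 1).choose k : ℚ) * ((n : ℚ) + 1 - k) = n.choose k * ((n : ℚ) + 1) := by
  rcases le_or_gt k (n + 1) with h | h
  · have := Nat.choose_mul_succ_eq n k
    zify [h] at this
    have h2 : (n.choose k : ℚ) * ((n : ℚ) + 1) = (n + 1).choose k * ((n : ℚ) + 1 - k) := by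
      exact_mod_cast this
    exact h2.symm
  · rw [Nat.choose_eq_zero_of_lt h, Nat.choose_eq_zero_of_lt (by omega)]
    simp

/-- Splitting 1 - x²/j² as (1 - x/j)(1 + x/j) at an integer x gives one binomial coefficient per
factor. -/
theorem sineProd_eq_choose (N n : ℕ) :
    sineProd ((N : ℚ) + 1) n =
      (-1) ^ n * (N.choose n : ℚ) * ((N + 1 + n).choose (N + 1) : ℚ) := by
  induction n with
  | zero => simp [sineProd]
  | succ n ih =>
    rw [sineProd, Finset.prod_range_succ, ← sineProd, ih, choose_succ_right_cast N n]
    have h := succ_choose_cast (N + 1 + n) (N + 1)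
    push_cast at h
    have hn : (n : ℚ) + 1 ≠ 0 := by positivity
    have h2 : ((N + 1 + (n + 1)).choose (N + 1) : ℚ) =
        (N + 1 + n).choose (N + 1) * ((N : ℚ) + 1 + n + 1) / (n + 1) := by
      rw [eq_div_iff hn, ← h, add_assoc (N + 1) n 1]
      ring
    rw [h2, pow_succ]
    generalize ((N + 1 + n).choose (N + 1) : ℚ) = A
    generalize (N.choose n : ℚ) = B
    field_simp
    ring

theorem succ_mul_choose_mul_choose {N k : ℕ} (hk : k ≤ N) :
    (2 * k + 1) * (2 * k).choose k * (N + 1 + k).choose (2 * k + 1) =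
      (N + 1) * (N.choose k * (N + 1 + k).choose (N + 1)) := by
  have h1 := Nat.choose_mul_factorial_mul_factorial (show k ≤ 2 * k by omega)
  have h2 := Nat.choose_mul_factorial_mul_factorial (show 2 * k + 1 ≤ N + 1 + k by omega)
  have h3 := Nat.choose_mul_factorial_mul_factorial hk
  have h4 := Nat.choose_mul_factorial_mul_factorial (show N + 1 ≤ N + 1 + k by omega)
  rw [show 2 * k - k = k by omega] at h1
  rw [show N + 1 + k - (2 * k + 1) = N - k by omega] at h2
  rw [show N + 1 + k - (N + 1) = k by omega] at h4
  rw [Nat.factorial_succ, ← h1] at h2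
  rw [Nat.factorial_succ N, ← h3] at h4
  refine Nat.eq_of_mul_eq_mul_right (show 0 < k.factorial * k.factorial * (N - k).factorial by
    positivity) ?_
  linarith

/-- Trinomial revision on both products pulls the factors depending only on k out of the sum; with n
= k + m, an M-fold difference with M = N - k remains. -/
theorem sum_choose_mul_choose_mul_choose_sq {N k : ℕ} (hk : k ≤ N) :
    ∑ n ∈ Finset.range (N + 1), (-1) ^ n * (N.choose n : ℚ) * ((N + 1 + n).choose (N + 1) : ℚ) *
        (n.choose k : ℚ) ^ 2 =
      (-1) ^ N * (N.choose k : ℚ) * ((N + 1 + k).choose (N + 1) : ℚ) *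
        ((N + 1 + k).choose (2 * k + 1) : ℚ) := by
  obtain ⟨M, rfl⟩ := Nat.exists_eq_add_of_le hk
  rw [add_assoc k M 1, Finset.sum_range_add, Finset.sum_eq_zero, zero_add]
  · have key := sum_alternating_choose_mul_choose_add (R := ℚ) M (k + (M + 1) + k) (2 * k + 1)
    have h0 : (-1 : ℚ) ^ (k + M) * ((k + M).choose k : ℚ) *
        ((k + (M + 1) + k).choose (k + (M + 1)) : ℚ) * ((k + (M + 1) + k).choose (2 * k + 1) : ℚ) =
        (-1) ^ k * ((k + M).choose k : ℚ) * ((k + (M + 1) + k).choose (k + (M + 1)) : ℚ) *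
          ((-1) ^ M * ((k + (M + 1) + k).choose (2 * k + 1) : ℚ)) := by
      rw [pow_add]
      ring
    rw [h0, ← key, Finset.mul_sum]
    refine Finset.sum_congr rfl fun m _ => ?_
    have h1 := Nat.choose_mul (n := k + M) (k := k + m) (s := k) (by omega)
    have h2 := Nat.choose_mul (n := k + (M + 1) + (k + m)) (k := k + (M + 1) + k)
      (s := k + (M + 1)) (by omega)
    rw [show k + M - k = M by omega, show k + m - k = m by omega] at h1
    rw [show k + (M + 1) + (k + m) - (k + (M + 1)) = k + m by omega,
      show k + (M + 1) + k - (k + (M + 1)) = k by omega] at h2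
    rw [show k + (M + 1) + k + m = k + (M + 1) + (k + m) by ring,
      show 2 * k + 1 + M = k + (M + 1) + k by ring, pow_add, sq]
    have h1' : ((k + M).choose (k + m) : ℚ) * (k + m).choose k = (k + M).choose k * M.choose m := by
      exact_mod_cast h1
    have h2' : ((k + (M + 1) + (k + m)).choose (k + (M + 1) + k) : ℚ) *
        (k + (M + 1) + k).choose (k + (M + 1)) =
        (k + (M + 1) + (k + m)).choose (k + (M + 1)) * (k + m).choose k := by
      exact_mod_cast h2
    linear_combination ((-1) ^ k * (-1) ^ m * ((k + (M + 1) + (k + m)).choose (k + (M + 1)) : ℚ) *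
      (k + m).choose k) * h1' - ((-1) ^ k * (-1) ^ m * ((k + M).choose k : ℚ) * M.choose m) * h2'
  · intro n hn
    rw [Nat.choose_eq_zero_of_lt (Finset.mem_range.1 hn)]
    simp

/-- By `succ_mul_choose_mul_choose` the factor C(2k,k) C(N+1+k,2k+1) is again the product up to
sign, times p/(2k+1); this is why a square appears. Oddness removes the sign (-1)^N. -/
theorem sum_sineProd_mul_choose_sq {p k : ℕ} (hp : Odd p) (hk : k < p) :
    (∑ n ∈ Finset.range p, sineProd p n * (n.choose k : ℚ) ^ 2) * (2 * k).choose k =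
      p * sineProd p k ^ 2 / (2 * k + 1) := by
  obtain ⟨N, rfl⟩ : ∃ N, p = N + 1 := ⟨p - 1, by omega⟩
  have hN : (-1 : ℚ) ^ N = 1 := Even.neg_one_pow (by rcases hp with ⟨t, ht⟩; exact ⟨t, by omega⟩)
  have h := succ_mul_choose_mul_choose (show k ≤ N by omega)
  have h' : (2 * (k : ℚ) + 1) * (2 * k).choose k * (N + 1 + k).choose (2 * k + 1) =
      (N + 1) * (N.choose k * (N + 1 + k).choose (N + 1)) := by exact_mod_cast h
  have hk1 : (2 * (k : ℚ) + 1) ≠ 0 := by positivity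
  push_cast
  simp only [sineProd_eq_choose]
  rw [sum_choose_mul_choose_mul_choose_sq (by omega), hN, eq_div_iff hk1]
  have h1 : ((-1 : ℚ) ^ k) ^ 2 = 1 := by rw [← pow_mul, mul_comm, pow_mul]; simp
  rw [mul_pow, mul_pow, h1]
  linear_combination ((N.choose k : ℚ) * (N + 1 + k).choose (N + 1)) * h'

/-- Used with w = 1 for g and w k = 1/(k+1) for h. -/
theorem sum_sineProd_mul_sum {p : ℕ} (hp : Odd p) (w : ℕ → ℚ) :
    ∑ n ∈ Finset.range p, sineProd p n *
        ∑ k ∈ Finset.range (n + 1), (n.choose k : ℚ) ^ 2 * ((2 * k).choose k * w k) =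
      ∑ k ∈ Finset.range p, p * sineProd p k ^ 2 / (2 * k + 1) * w k := by
  have : ∀ n ∈ Finset.range p, sineProd p n *
      ∑ k ∈ Finset.range (n + 1), (n.choose k : ℚ) ^ 2 * ((2 * k).choose k * w k) =
      ∑ k ∈ Finset.range p, sineProd p n * ((n.choose k : ℚ) ^ 2 * ((2 * k).choose k * w k)) := by
    intro n hn
    rw [Finset.mul_sum]
    refine Finset.sum_subset (Finset.range_mono (Finset.mem_range.1 hn)) fun k _ hk => ?_
    rw [Finset.mem_range, not_lt] at hk
    rw [Nat.choose_eq_zero_of_lt (by omega)]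
    simp
  rw [Finset.sum_congr rfl this, Finset.sum_comm]
  refine Finset.sum_congr rfl fun k hk => ?_
  rw [← sum_sineProd_mul_choose_sq hp (Finset.mem_range.1 hk), Finset.sum_mul, Finset.sum_mul]
  exact Finset.sum_congr rfl fun n _ => by ring

/-! ### Linearisation of C(k,j)² and harmonic numbers against the resulting weights. -/

/-- Expand one factor C(k,j) by Vandermonde with k = j + m, then apply trinomial revision to the
product with the other. -/
theorem choose_sq_eq_sum (k j : ℕ) :
    k.choose j ^ 2 =
      ∑ i ∈ Finset.range (j + 1), (j + i).choose j * j.choose i * k.choose (j + i) := by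
  rcases lt_or_ge k j with h | h
  · rw [Nat.choose_eq_zero_of_lt h, Finset.sum_eq_zero]
    · simp
    · intro i _
      rw [Nat.choose_eq_zero_of_lt (show k < j + i by omega), mul_zero]
  · obtain ⟨m, rfl⟩ := Nat.exists_eq_add_of_le h
    have hv : (j + m).choose j = ∑ i ∈ Finset.range (j + 1), j.choose i * m.choose i := by
      conv_lhs => rw [add_comm j m, Nat.add_choose_eq, 
        Finset.Nat.sum_antidiagonal_eq_sum_range_succ fun a b => m.choose a * j.choose b]
      refine Finset.sum_congr rfl fun i hi => ?_
      rw [Nat.choose_symm (by simp at hi; omega), mul_comm]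
    rw [sq]
    conv_lhs => arg 2; rw [hv]
    rw [Finset.mul_sum]
    refine Finset.sum_congr rfl fun i hi => ?_
    rcases le_or_gt i m with him | him
    · have := Nat.choose_mul (n := j + m) (k := j + i) (s := j) (by omega)
      rw [show j + m - j = m by omega, show j + i - j = i by omega] at this
      rw [mul_left_comm, ← this]
      ring
    · rw [Nat.choose_eq_zero_of_lt him, Nat.choose_eq_zero_of_lt (show j + m < j + i by omega)]
      simp

theorem sum_range_two_mul_eq {R : Type*} [AddCommMonoid R] {j : ℕ} {F : ℕ → R}
    (hF : ∀ l < j, F l = 0) :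
    ∑ l ∈ Finset.range (2 * j + 1), F l = ∑ i ∈ Finset.range (j + 1), F (j + i) := by
  rw [show 2 * j + 1 = j + (j + 1) by ring, Finset.sum_range_add, Finset.sum_eq_zero, zero_add]
  exact fun l hl => hF l (Finset.mem_range.1 hl)

/-- A family of weights with total mass one. -/
noncomputable def legendreWeight (j l : ℕ) : ℚ :=
  (-1) ^ l * (2 * j + 1) * (2 * j).choose j * l.choose j * j.choose (l - j) / (l + 1)

/-- The telescoping certificate for `legendreWeight` in its first variable. -/
noncomputable def legendreWeightCert (j l : ℕ) : ℚ :=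
  (-1) ^ l * (2 * j).choose j * l.choose j * j.choose (l - j) * (4 * j - 3 * l) / (2 * j)

theorem two_mul_succ_choose (J : ℕ) :
    ((2 * (J + 1)).choose (J + 1) : ℚ) = (2 * J).choose J * (2 * (2 * J + 1)) / (J + 1) := by
  have hJ : (J : ℚ) + 1 ≠ 0 := by positivity
  rw [eq_div_iff hJ]
  have := Nat.succ_mul_centralBinom_succ J
  simp only [Nat.centralBinom] at this
  have h : ((J : ℚ) + 1) * (2 * (J + 1)).choose (J + 1) = 2 * (2 * J + 1) * (2 * J).choose J := by
    exact_mod_cast this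
  linear_combination h

/-- A Wilf–Zeilberger pair. At l = J only the new certificate term and the old weight survive; for l
> J all binomials are rational multiples of three of them. -/
theorem legendreWeight_succ_sub (J l : ℕ) :
    legendreWeight (J + 1) l - legendreWeight J l =
      legendreWeightCert (J + 1) (l + 1) - legendreWeightCert (J + 1) l := by
  rcases lt_trichotomy l J with h | rfl | h
  · simp [legendreWeight, legendreWeightCert, Nat.choose_eq_zero_of_lt h,
      Nat.choose_eq_zero_of_lt (show l < J + 1 by omega),
      Nat.choose_eq_zero_of_lt (show l + 1 < J + 1 by omega)]
  · have hJ : (l : ℚ) + 1 ≠ 0 := by positivity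
    simp only [legendreWeight, legendreWeightCert, two_mul_succ_choose, Nat.choose_self,
      Nat.choose_eq_zero_of_lt (show l < l + 1 by omega), Nat.sub_self, Nat.choose_zero_right]
    push_cast
    field_simp
    ring
  · obtain ⟨i, rfl⟩ : ∃ i, l = J + 1 + i := ⟨l - (J + 1), by omega⟩
    have hJ : (J : ℚ) + 1 ≠ 0 := by positivity
    have hi : (i : ℚ) + 1 ≠ 0 := by positivity
    have hl : (J : ℚ) + 1 + i + 1 ≠ 0 := by positivity
    have h1 : ((J + 1).choose (i + 1) : ℚ) = (J + 1).choose i * ((J : ℚ) + 1 - i) / (i + 1) := by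
      rw [choose_succ_right_cast]
      push_cast
      rfl
    have h2 : (J.choose (i + 1) : ℚ) =
        (J + 1).choose i * ((J : ℚ) + 1 - i) * (J - i) / ((i + 1) * (J + 1)) := by
      have := succ_choose_cast J (i + 1)
      rw [h1] at this
      rw [eq_div_iff (mul_ne_zero hi hJ)]
      have h3 : (J.choose (i + 1) : ℚ) * (J + 1) * (i + 1) =
          (J + 1).choose i * ((J : ℚ) + 1 - i) / (i + 1) * (J + 1 - (i + 1)) * (i + 1) := by
        rw [← this]
        push_cast
        ring
      field_simp at h3
      linear_combination h3
    have h3 : ((J + 1 + i).choose J : ℚ) = (J + 1 + i).choose (J + 1) * (J + 1) / (i + 1) := by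
      rw [choose_succ_right_cast (J + 1 + i) J]
      push_cast
      field_simp
      ring
    have h4 : ((J + 1 + i + 1).choose (J + 1) : ℚ) =
        (J + 1 + i).choose (J + 1) * ((J : ℚ) + 2 + i) / (i + 1) := by
      have := succ_choose_cast (J + 1 + i) (J + 1)
      rw [eq_div_iff hi]
      push_cast at this
      linear_combination this
    simp only [legendreWeight, legendreWeightCert, two_mul_succ_choose,
      show J + 1 + i - (J + 1) = i by omega, show J + 1 + i - J = i + 1 by omega,
      show J + 1 + i + 1 - (J + 1) = i + 1 by omega, h4, h3, h1, h2, pow_succ]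
    push_cast
    generalize ((J + 1 + i).choose (J + 1) : ℚ) = A
    generalize ((J + 1).choose i : ℚ) = B
    generalize ((2 * J).choose J : ℚ) = C
    field_simp
    ring

theorem sum_alternating_choose_mul_choose_sub (j : ℕ) :
    ∑ l ∈ Finset.range (2 * j + 1), (-1 : ℚ) ^ l * l.choose j * j.choose (l - j) = 1 := by
  rw [sum_range_two_mul_eq]
  · have := sum_alternating_choose_mul_choose_add (R := ℚ) j j 0
    simp only [zero_add, Nat.choose_zero_right, Nat.cast_one, mul_one] at this
    have h2 : ((-1 : ℚ) ^ j) * (-1) ^ j = 1 := by rw [← mul_pow]; simp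
    refine Eq.trans ?_ h2
    nth_rewrite 1 [← this]
    rw [Finset.sum_mul]
    refine Finset.sum_congr rfl fun i _ => ?_
    rw [Nat.add_sub_cancel_left, pow_add]
    ring
  · intro l hl
    simp [Nat.choose_eq_zero_of_lt hl]

/-- Absorbing 1/l into C(l,J+1) leaves C(l-1,J)/(J+1), of degree J in l and therefore killed by J+1
differences. -/
theorem sum_alternating_choose_mul_choose_sub_div (J : ℕ) :
    ∑ l ∈ Finset.range (2 * (J + 1) + 1),
      (-1 : ℚ) ^ l * l.choose (J + 1) * (J + 1).choose (l - (J + 1)) / l = 0 := by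
  rw [sum_range_two_mul_eq]
  · have := sum_alternating_choose_mul_choose_eq_zero (R := ℚ) (M := J + 1) (b := J) J (by omega)
    have h0 : (0 : ℚ) = 0 * ((-1) ^ (J + 1) / (J + 1)) := by ring
    rw [h0, ← this, Finset.sum_mul]
    refine Finset.sum_congr rfl fun i _ => ?_
    have hc : ((J + 1 + i).choose (J + 1) : ℚ) * (J + 1) = (J + i).choose J * (J + 1 + i) := by
      have := Nat.add_one_mul_choose_eq (J + i) J
      rw [show J + i + 1 = J + 1 + i by ring] at this
      have h : (J + 1 + i : ℚ) * (J + i).choose J = (J + 1 + i).choose (J + 1) * (J + 1) := by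
        exact_mod_cast this
      linear_combination -h
    have hJ : (J : ℚ) + 1 ≠ 0 := by positivity
    have hl : (J : ℚ) + 1 + i ≠ 0 := by positivity
    rw [Nat.add_sub_cancel_left, pow_add]
    push_cast
    field_simp
    linear_combination ((J + 1).choose i : ℚ) * hc
  · intro l hl
    simp [Nat.choose_eq_zero_of_lt hl]

theorem sum_sub_mul_harmonic (G : ℕ → ℚ) (L : ℕ) :
    ∑ l ∈ Finset.range L, (G (l + 1) - G l) * harmonic l =
      G L * harmonic L - ∑ l ∈ Finset.range L, G (l + 1) / ((l : ℚ) + 1) := by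
  induction L with
  | zero => simp
  | succ L ih =>
    rw [Finset.sum_range_succ, ih, Finset.sum_range_succ, harmonic_succ]
    push_cast
    field_simp
    ring

/-- The sums `(3/2) ∑_{1 ≤ i ≤ j} C(2i,i) / i`. -/
noncomputable def centralSum (j : ℕ) : ℚ :=
  3 / 2 * ∑ i ∈ Finset.Icc 1 j, ((2 * i).choose i : ℚ) / i

/-- Passing from row J to row J+1 changes the weights by a difference in l, so summation by parts
replaces the harmonic number by 1/l. The resulting certificate sum is the new summand of
`centralSum`. -/
theorem sum_legendreWeight_mul_harmonic (j : ℕ) :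
    ∑ l ∈ Finset.range (2 * j + 1), legendreWeight j l * harmonic l = centralSum j := by
  induction j with
  | zero => simp [centralSum]
  | succ J ih =>
    have hz : ∀ l, 2 * J + 1 ≤ l → legendreWeight J l = 0 := by
      intro l hl
      simp [legendreWeight, Nat.choose_eq_zero_of_lt (show J < l - J by omega)]
    have h1 : ∑ l ∈ Finset.range (2 * (J + 1) + 1), legendreWeight J l * harmonic l =
        centralSum J := by
      rw [show 2 * (J + 1) + 1 = 2 * J + 1 + 1 + 1 by ring, Finset.sum_range_succ,
        Finset.sum_range_succ, ih, hz _ (by omega), hz _ (by omega)]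
      simp
    have h2 : centralSum (J + 1) = centralSum J +
        3 / 2 * (((2 * (J + 1)).choose (J + 1) : ℚ) / ((J : ℚ) + 1)) := by
      rw [centralSum, Finset.sum_Icc_succ_top (by omega), mul_add, ← centralSum]
      push_cast
      rfl
    rw [h2, ← h1, ← sub_eq_iff_eq_add', ← Finset.sum_sub_distrib]
    simp only [← sub_mul, legendreWeight_succ_sub]
    rw [sum_sub_mul_harmonic]
    have hJ : (J : ℚ) + 1 ≠ 0 := by positivity
    have h3 : legendreWeightCert (J + 1) (2 * (J + 1) + 1) = 0 := by
      rw [legendreWeightCert,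
        Nat.choose_eq_zero_of_lt (show J + 1 < 2 * (J + 1) + 1 - (J + 1) by omega)]
      simp
    have h4 : ∑ l ∈ Finset.range (2 * (J + 1) + 1),
        legendreWeightCert (J + 1) (l + 1) / ((l : ℚ) + 1) =
        ∑ l ∈ Finset.range (2 * (J + 1) + 1), legendreWeightCert (J + 1) l / l := by
      have := Finset.sum_range_succ'
        (fun l : ℕ => legendreWeightCert (J + 1) l / (l : ℚ)) (2 * (J + 1) + 1)
      rw [Finset.sum_range_succ, h3] at this
      simpa using this.symm
    -- With j = J+1, this is (4j - 3l)/(2jl) = 2/l - 3/(2j): the first part sums to 0, the second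
    -- contributes total mass 1.
    have h5 : ∀ l : ℕ, legendreWeightCert (J + 1) l / (l : ℚ) =
        2 * (2 * (J + 1)).choose (J + 1) *
          ((-1 : ℚ) ^ l * l.choose (J + 1) * (J + 1).choose (l - (J + 1)) / l) -
        3 / 2 * (((2 * (J + 1)).choose (J + 1) : ℚ) / ((J : ℚ) + 1)) *
          ((-1 : ℚ) ^ l * l.choose (J + 1) * (J + 1).choose (l - (J + 1))) := by
      intro l
      rcases Nat.eq_zero_or_pos l with rfl | hl
      · simp [legendreWeightCert]
      · have hl' : (l : ℚ) ≠ 0 := by positivity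
        rw [legendreWeightCert]
        push_cast
        field_simp
        ring
    rw [h4, Finset.sum_congr rfl fun l _ => h5 l, Finset.sum_sub_distrib, ← Finset.mul_sum,
      ← Finset.mul_sum, sum_alternating_choose_mul_choose_sub,
      sum_alternating_choose_mul_choose_sub_div, h3]
    ring

/-! ### Power sums modulo p and the congruences modulo p³. -/

theorem sum_Icc_reflect {R : Type*} [AddCommMonoid R] (p : ℕ) (f : ℕ → R) :
    ∑ k ∈ Finset.Icc 1 (p - 1), f (p - k) = ∑ k ∈ Finset.Icc 1 (p - 1), f k := by
  refine Finset.sum_nbij' (fun k => p - k) (fun k => p - k) ?_ ?_ ?_ ?_ fun _ _ => rfl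
  all_goals
    intro k hk
    simp only [Finset.mem_Icc] at hk ⊢
    omega

theorem sum_range_eq_add_sum_Icc {R : Type*} [AddCommMonoid R] {p : ℕ} (hp : 0 < p) (f : ℕ → R) :
    ∑ k ∈ Finset.range p, f k = f 0 + ∑ k ∈ Finset.Icc 1 (p - 1), f k := by
  obtain ⟨q, rfl⟩ : ∃ q, p = q + 1 := ⟨p - 1, by omega⟩
  rw [Finset.sum_range_succ', add_comm, Finset.range_eq_Ico,
    Finset.sum_Ico_add' (fun k => f k) 0 q 1]
  congr 1

theorem sum_Icc_eq_sum_half {R : Type*} [AddCommMonoid R] (n : ℕ) (f : ℕ → R) :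
    ∑ k ∈ Finset.Icc 1 (2 * n), f k =
      ∑ k ∈ Finset.Icc 1 n, f k + ∑ k ∈ Finset.Icc 1 n, f (2 * n + 1 - k) := by
  have h : Finset.Icc 1 (2 * n) = Finset.Icc 1 n ∪ Finset.Icc (n + 1) (2 * n) := by
    ext k
    simp only [Finset.mem_union, Finset.mem_Icc]
    omega
  rw [h, Finset.sum_union]
  · congr 1
    refine Finset.sum_nbij' (fun k => 2 * n + 1 - k) (fun k => 2 * n + 1 - k) ?_ ?_ ?_ ?_ ?_
    all_goals
      intro k hk
      simp only [Finset.mem_Icc] at hk ⊢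
    on_goal 5 => congr 1
    all_goals omega
  · rw [Finset.disjoint_left]
    intro k hk hk'
    simp only [Finset.mem_Icc] at hk hk'
    omega

section
variable {p : ℕ} [hpf : Fact p.Prime]

omit hpf in
theorem natCast_ne_zero_of_lt (K : Type*) [Field K] [CharP K p] {k : ℕ} (hk : 0 < k)
    (hkp : k < p) : (k : K) ≠ 0 := by
  rw [Ne, CharP.cast_eq_zero_iff K p]
  exact Nat.not_dvd_of_pos_of_lt hk hkp

theorem sum_range_natCast_zmod {R : Type*} [AddCommMonoid R] (F : ZMod p → R) :
    ∑ k ∈ Finset.range p, F (k : ZMod p) = ∑ x : ZMod p, F x := by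
  refine Finset.sum_bij' (fun k _ => (k : ZMod p)) (fun x _ => x.val) (fun _ _ => Finset.mem_univ _)
    (fun x _ => Finset.mem_range.2 (ZMod.val_lt x)) ?_ ?_ (fun _ _ => rfl)
  · intro k hk
    exact ZMod.val_cast_of_lt (Finset.mem_range.1 hk)
  · intro x _
    exact ZMod.natCast_zmod_val x

/-- Inversion, with 0⁻¹ = 0, permutes `ZMod p`, so this is an ordinary power sum. -/
theorem sum_zmod_inv_pow {l : ℕ} (hl : l < p - 1) : ∑ x : ZMod p, x⁻¹ ^ l = 0 := by
  rw [← FiniteField.sum_pow_lt_card_sub_one (ZMod p) l (by rwa [ZMod.card])]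
  exact Fintype.sum_equiv (Equiv.inv (ZMod p)) _ _ fun x => rfl

theorem sum_Icc_inv_pow (K : Type*) [Field K] [CharP K p] {l : ℕ} (hl0 : 0 < l)
    (hl : l < p - 1) : ∑ k ∈ Finset.Icc 1 (p - 1), (k : K)⁻¹ ^ l = 0 := by
  have h := congrArg (ZMod.castHom (dvd_refl p) K) (sum_zmod_inv_pow hl)
  rw [← sum_range_natCast_zmod (fun x : ZMod p => x⁻¹ ^ l),
    sum_range_eq_add_sum_Icc hpf.out.pos] at h
  simpa [hl0.ne'] using h

/-- The affine map x ↦ 2x + 1 permutes `ZMod p`; the term where it vanishes counts as 0. -/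
theorem sum_range_inv_odd_sq (hp3 : 3 < p) :
    ∑ k ∈ Finset.range p, (2 * (k : ZMod p) + 1)⁻¹ ^ 2 = 0 := by
  have h2 : (2 : ZMod p) ≠ 0 := by
    have := natCast_ne_zero_of_lt (ZMod p) (p := p) (k := 2) (by omega) (by omega)
    exact_mod_cast this
  rw [sum_range_natCast_zmod (fun x : ZMod p => (2 * x + 1)⁻¹ ^ 2),
    ← sum_zmod_inv_pow (p := p) (l := 2) (by omega)]
  exact Fintype.sum_equiv ((Equiv.mulLeft₀ 2 h2).trans (Equiv.addRight 1)) _ _ fun x => rfl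

theorem harmonicTwo_zero : harmonicTwo 0 = 0 := by simp [harmonicTwo]

theorem harmonicTwo_succ (n : ℕ) :
    harmonicTwo (n + 1) = harmonicTwo n + 1 / ((n : ℚ) + 1) ^ 2 := by
  rw [harmonicTwo, Finset.sum_Icc_succ_top (by omega), ← harmonicTwo]
  push_cast
  rfl

theorem harmonicTwo_mem {k : ℕ} (hk : k < p) : harmonicTwo k ∈ pIntegers p := by
  refine sum_mem fun i hi => ?_
  rw [Finset.mem_Icc] at hi
  rw [one_div, ← inv_pow]
  exact pow_mem (inv_mem_pIntegers_of_lt (by omega) (by omega)) 2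

theorem harmonic_mem {k : ℕ} (hk : k < p) : harmonic k ∈ pIntegers p := by
  rw [harmonic_eq_sum_Icc]
  refine sum_mem fun i hi => ?_
  rw [Finset.mem_Icc] at hi
  exact inv_mem_pIntegers_of_lt (by omega) (by omega)

theorem ratCast_harmonicTwo (K : Type*) [Field K] [CharP K p] {k : ℕ} (hk : k < p) :
    (harmonicTwo k : K) = ∑ i ∈ Finset.Icc 1 k, (i : K)⁻¹ ^ 2 := by
  have h : ∀ i ∈ Finset.Icc 1 k, (i : ℚ)⁻¹ ∈ pIntegers p := fun i hi => by
    rw [Finset.mem_Icc] at hi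
    exact inv_mem_pIntegers_of_lt (by omega) (by omega)
  simp only [harmonicTwo, one_div, ← inv_pow]
  rw [ratCast_sum fun i hi => pow_mem (h i hi) 2]
  refine Finset.sum_congr rfl fun i hi => ?_
  rw [ratCast_pow (h i hi)]
  rw [Finset.mem_Icc] at hi
  rw [ratCast_inv_natCast (Nat.not_dvd_of_pos_of_lt (by omega) (by omega))]

theorem ratCast_harmonic (K : Type*) [Field K] [CharP K p] {k : ℕ} (hk : k < p) :
    (harmonic k : K) = ∑ i ∈ Finset.Icc 1 k, (i : K)⁻¹ := by
  rw [harmonic_eq_sum_Icc, ratCast_sum fun i hi => ?_]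
  · refine Finset.sum_congr rfl fun i hi => ?_
    rw [Finset.mem_Icc] at hi
    rw [ratCast_inv_natCast (Nat.not_dvd_of_pos_of_lt (by omega) (by omega))]
  · rw [Finset.mem_Icc] at hi
    exact inv_mem_pIntegers_of_lt (by omega) (by omega)

theorem ratCast_harmonicTwo_pred (K : Type*) [Field K] [CharP K p] (hp3 : 3 < p) :
    (harmonicTwo (p - 1) : K) = 0 := by
  rw [ratCast_harmonicTwo K (by omega), sum_Icc_inv_pow K (by omega) (by omega)]

theorem two_natCast_ne_zero (K : Type*) [Field K] [CharP K p] (hp3 : 3 < p) : (2 : K) ≠ 0 := by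
  exact_mod_cast natCast_ne_zero_of_lt K (p := p) (k := 2) (by omega) (by omega)

/-- The symmetry k ↦ p - k preserves 1/k² modulo p, so the half sum is half of a vanishing sum. -/
theorem ratCast_harmonicTwo_half (K : Type*) [Field K] [CharP K p] (hp3 : 3 < p) {n : ℕ}
    (hn : p = 2 * n + 1) : (harmonicTwo n : K) = 0 := by
  have h := sum_Icc_inv_pow K (p := p) (l := 2) (by omega) (by omega)
  rw [show p - 1 = 2 * n by omega, sum_Icc_eq_sum_half] at h
  have h2 : ∑ k ∈ Finset.Icc 1 n, (((2 * n + 1 - k : ℕ) : K))⁻¹ ^ 2 =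
      ∑ k ∈ Finset.Icc 1 n, (k : K)⁻¹ ^ 2 := by
    refine Finset.sum_congr rfl fun k hk => ?_
    rw [Finset.mem_Icc] at hk
    rw [← hn, Nat.cast_sub (by omega), CharP.cast_eq_zero, zero_sub, inv_neg, neg_sq]
  rw [h2, ← two_mul] at h
  rw [ratCast_harmonicTwo K (by omega)]
  exact (mul_eq_zero.1 h).resolve_left (two_natCast_ne_zero K hp3)

theorem exists_eq_mul_of_ratCast_eq_zero {x : ℚ} (hx : x ∈ pIntegers p)
    (h : (x : ZMod p) = 0) : ∃ c ∈ pIntegers p, x = p * c :=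
  (ratCast_eq_zero_iff hx).1 h

/-- Wolstenholme's theorem for harmonic numbers. -/
theorem harmonic_pred_eq (hp3 : 3 < p) : ∃ c ∈ pIntegers p, harmonic (p - 1) = (p : ℚ) ^ 2 * c := by
  have hinv : ∀ k ∈ Finset.Icc 1 (p - 1), (k : ℚ)⁻¹ ∈ pIntegers p := fun k hk => by
    rw [Finset.mem_Icc] at hk
    exact inv_mem_pIntegers_of_lt (by omega) (by omega)
  have hinv' : ∀ k ∈ Finset.Icc 1 (p - 1), ((p - k : ℕ) : ℚ)⁻¹ ∈ pIntegers p := fun k hk => by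
    rw [Finset.mem_Icc] at hk
    exact inv_mem_pIntegers_of_lt (by omega) (by omega)
  have hS := sum_mem fun k hk => mul_mem (hinv k hk) (hinv' k hk)
  -- Pairing gives 1/k + 1/(p-k) = p/(k(p-k)), which supplies one factor p; the second comes from
  -- 1/(k(p-k)) ≡ -1/k².
  have hS0 : ((∑ k ∈ Finset.Icc 1 (p - 1), (k : ℚ)⁻¹ * ((p - k : ℕ) : ℚ)⁻¹ : ℚ) : ZMod p) = 0 := by
    rw [ratCast_sum fun k hk => mul_mem (hinv k hk) (hinv' k hk)]
    rw [← neg_eq_zero, ← sum_Icc_inv_pow (ZMod p) (p := p) (l := 2) (by omega) (by omega),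
      ← Finset.sum_neg_distrib]
    refine Finset.sum_congr rfl fun k hk => ?_
    rw [ratCast_mul (hinv k hk) (hinv' k hk)]
    rw [Finset.mem_Icc] at hk
    rw [ratCast_inv_natCast (Nat.not_dvd_of_pos_of_lt (by omega) (by omega)),
      ratCast_inv_natCast (Nat.not_dvd_of_pos_of_lt (by omega) (by omega)),
      Nat.cast_sub (by omega), CharP.cast_eq_zero (ZMod p) p, zero_sub, inv_neg]
    ring
  obtain ⟨c, hc, hc'⟩ := exists_eq_mul_of_ratCast_eq_zero hS hS0
  refine ⟨c * ((2 : ℕ) : ℚ)⁻¹, mul_mem hc (inv_mem_pIntegers_of_lt (by omega) (by omega)), ?_⟩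
  have h2 : harmonic (p - 1) + harmonic (p - 1) = p * (p * c) := by
    rw [← hc']
    rw [harmonic_eq_sum_Icc]
    nth_rewrite 2 [← sum_Icc_reflect p fun k => (k : ℚ)⁻¹]
    rw [← Finset.sum_add_distrib, Finset.mul_sum]
    refine Finset.sum_congr rfl fun k hk => ?_
    rw [Finset.mem_Icc] at hk
    have h1 : (k : ℚ) ≠ 0 := by exact_mod_cast (show k ≠ 0 by omega)
    have h3 : ((p - k : ℕ) : ℚ) ≠ 0 := by exact_mod_cast (show p - k ≠ 0 by omega)
    rw [Nat.cast_sub (by omega)] at h3 ⊢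
    field_simp
    ring
  push_cast
  linear_combination h2 / 2

theorem sineProd_eq {n : ℕ} (hn : n < p) :
    ∃ c ∈ pIntegers p, sineProd p n = 1 - (p : ℚ) ^ 2 * harmonicTwo n + (p : ℚ) ^ 4 * c := by
  induction n with
  | zero => exact ⟨0, zero_mem _, by simp [sineProd, harmonicTwo]⟩
  | succ n ih =>
    obtain ⟨c, hc, h⟩ := ih (by omega)
    have hi : ((n + 1 : ℕ) : ℚ)⁻¹ ∈ pIntegers p := inv_mem_pIntegers_of_lt (by omega) hn
    have hp := natCast_mem_pIntegers (p := p) p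
    refine ⟨c + (harmonicTwo n - p ^ 2 * c) * ((n + 1 : ℕ) : ℚ)⁻¹ ^ 2, add_mem hc (mul_mem (sub_mem
      (harmonicTwo_mem (by omega)) (mul_mem (pow_mem hp 2) hc)) (pow_mem hi 2)), ?_⟩
    rw [sineProd, Finset.prod_range_succ, ← sineProd, h, harmonicTwo_succ]
    have hn0 : (n : ℚ) + 1 ≠ 0 := by positivity
    push_cast
    field_simp
    ring

theorem sineProd_sq_eq {n : ℕ} (hn : n < p) :
    ∃ c ∈ pIntegers p, sineProd p n ^ 2 = 1 - (p : ℚ) ^ 2 * (2 * harmonicTwo n) +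
      (p : ℚ) ^ 3 * c := by
  obtain ⟨c, hc, h⟩ := sineProd_eq hn
  have hp := natCast_mem_pIntegers (p := p) p
  have hh := harmonicTwo_mem hn
  refine ⟨p * (harmonicTwo n ^ 2 + 2 * c - 2 * p ^ 2 * harmonicTwo n * c + p ^ 4 * c ^ 2), ?_, ?_⟩
  · have h2 : (2 : ℚ) ∈ pIntegers p := natCast_mem_pIntegers 2
    exact mul_mem hp (add_mem (sub_mem (add_mem (pow_mem hh 2) (mul_mem h2 hc))
      (mul_mem (mul_mem (mul_mem h2 (pow_mem hp 2)) hh) hc))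
      (mul_mem (pow_mem hp 4) (pow_mem hc 2)))
  · rw [h]
    ring

theorem sineProd_sq_pCong_one {n : ℕ} (hn : n < p) (h : (harmonicTwo n : ZMod p) = 0) :
    PCong p 3 (sineProd p n ^ 2) 1 := by
  obtain ⟨c, hc, h'⟩ := sineProd_sq_eq hn
  obtain ⟨d, hd, h⟩ := exists_eq_mul_of_ratCast_eq_zero (harmonicTwo_mem hn) h
  refine ⟨c - 2 * d, sub_mem hc (mul_mem (natCast_mem_pIntegers 2) hd), ?_⟩
  rw [h', h]
  ring

theorem mul_sineProd_sq_pCong {n : ℕ} (hn : n < p) {u : ℚ} (hu : u ∈ pIntegers p) :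
    PCong p 3 (p * sineProd p n ^ 2 * u) (p * u) := by
  obtain ⟨c, hc, h'⟩ := sineProd_sq_eq hn
  refine ⟨(p * c - 2 * harmonicTwo n) * u, mul_mem (sub_mem (mul_mem (natCast_mem_pIntegers p) hc)
    (mul_mem (natCast_mem_pIntegers 2) (harmonicTwo_mem hn))) hu, ?_⟩
  rw [h']
  ring

omit hpf in
theorem not_dvd_odd {n k : ℕ} (hn : p = 2 * n + 1) (hk : k < p) (hkn : k ≠ n) :
    ¬ p ∣ 2 * k + 1 := by
  rintro ⟨c, hc⟩
  have : c < 2 := by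
    by_contra! h
    have := Nat.mul_le_mul_left p h
    omega
  interval_cases c <;> omega

theorem inv_odd_mem {n k : ℕ} (hn : p = 2 * n + 1) (hk : k < p) (hkn : k ≠ n) :
    ((2 * k + 1 : ℕ) : ℚ)⁻¹ ∈ pIntegers p :=
  inv_natCast_mem_pIntegers (not_dvd_odd hn hk hkn)

/-- Wolstenholme's pairing for odd denominators: k ↔ p-1-k exchanges 2k+1 and 2p-(2k+1). The index
n, where 2k+1 = p, is its fixed point and is left out. -/
theorem sum_erase_inv_odd (hp3 : 3 < p) {n : ℕ} (hn : p = 2 * n + 1) :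
    ∃ c ∈ pIntegers p,
      ∑ k ∈ (Finset.range p).erase n, ((2 * k + 1 : ℕ) : ℚ)⁻¹ = (p : ℚ) ^ 2 * c := by
  have hrefl : ∀ f : ℕ → ℚ, ∑ k ∈ (Finset.range p).erase n, f (p - 1 - k) =
      ∑ k ∈ (Finset.range p).erase n, f k := by
    intro f
    refine Finset.sum_nbij' (fun k => p - 1 - k) (fun k => p - 1 - k) ?_ ?_ ?_ ?_ fun _ _ => rfl
    all_goals
      intro k hk
      simp only [Finset.mem_erase, Finset.mem_range] at hk ⊢
      omega
  have hinv : ∀ k ∈ (Finset.range p).erase n, ((2 * k + 1 : ℕ) : ℚ)⁻¹ ∈ pIntegers p :=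
    fun k hk => by
      rw [Finset.mem_erase, Finset.mem_range] at hk
      exact inv_odd_mem hn hk.2 hk.1
  have hinv' : ∀ k ∈ (Finset.range p).erase n,
      ((2 * (p - 1 - k) + 1 : ℕ) : ℚ)⁻¹ ∈ pIntegers p := fun k hk => by
    rw [Finset.mem_erase, Finset.mem_range] at hk
    exact inv_odd_mem hn (by omega) (by omega)
  have hS := sum_mem fun k hk => mul_mem (hinv k hk) (hinv' k hk)
  have hS0 : ((∑ k ∈ (Finset.range p).erase n,
      ((2 * k + 1 : ℕ) : ℚ)⁻¹ * ((2 * (p - 1 - k) + 1 : ℕ) : ℚ)⁻¹ : ℚ) : ZMod p) = 0 := by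
    have hn0 : (2 * (n : ZMod p) + 1)⁻¹ ^ 2 = 0 := by
      have : (2 * (n : ZMod p) + 1) = ((2 * n + 1 : ℕ) : ZMod p) := by push_cast; ring
      rw [this, ← hn]
      simp
    have hmem : n ∈ Finset.range p := Finset.mem_range.2 (by omega)
    rw [ratCast_sum fun k hk => mul_mem (hinv k hk) (hinv' k hk), ← neg_eq_zero,
      ← sum_range_inv_odd_sq hp3,
      ← Finset.sum_erase (f := fun k : ℕ => (2 * (k : ZMod p) + 1)⁻¹ ^ 2) _ hn0,
      ← Finset.sum_neg_distrib]
    refine Finset.sum_congr rfl fun k hk => ?_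
    rw [ratCast_mul (hinv k hk) (hinv' k hk), ratCast_inv_natCast, ratCast_inv_natCast]
    · rw [Finset.mem_erase, Finset.mem_range] at hk
      have h1 : ((2 * (p - 1 - k) + 1 : ℕ) : ZMod p) = -(2 * (k : ZMod p) + 1) := by
        rw [eq_neg_iff_add_eq_zero]
        have : ((2 * (p - 1 - k) + 1 + (2 * k + 1) : ℕ) : ZMod p) = 0 := by
          rw [show 2 * (p - 1 - k) + 1 + (2 * k + 1) = p * 2 by omega]
          simp
        push_cast at this ⊢
        exact this
      rw [h1, inv_neg]
      push_cast
      ring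
    · rw [Finset.mem_erase, Finset.mem_range] at hk
      exact not_dvd_odd hn (by omega) (by omega)
    · rw [Finset.mem_erase, Finset.mem_range] at hk
      exact not_dvd_odd hn hk.2 hk.1
  obtain ⟨c, hc, hc'⟩ := exists_eq_mul_of_ratCast_eq_zero hS hS0
  refine ⟨c, hc, ?_⟩
  have h2 : ∑ k ∈ (Finset.range p).erase n, ((2 * k + 1 : ℕ) : ℚ)⁻¹ +
      ∑ k ∈ (Finset.range p).erase n, ((2 * k + 1 : ℕ) : ℚ)⁻¹ = 2 * p * (p * c) := by
    rw [← hc']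
    nth_rewrite 2 [← hrefl]
    rw [← Finset.sum_add_distrib, Finset.mul_sum]
    refine Finset.sum_congr rfl fun k hk => ?_
    rw [Finset.mem_erase, Finset.mem_range] at hk
    have h1 : ((2 * k + 1 : ℕ) : ℚ) ≠ 0 := by positivity
    have h3 : ((2 * (p - 1 - k) + 1 : ℕ) : ℚ) ≠ 0 := by positivity
    have h4 : ((2 * k + 1 : ℕ) : ℚ) + ((2 * (p - 1 - k) + 1 : ℕ) : ℚ) = 2 * p := by
      exact_mod_cast (show (2 * k + 1) + (2 * (p - 1 - k) + 1) = 2 * p by omega)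
    rw [← h4]
    field_simp
    ring
  linear_combination h2 / 2

/-- At k = n the prime cancels and the term is a square congruent to 1, because H_n^{(2)} vanishes
modulo p. In all other terms the square may be replaced by 1, and `sum_erase_inv_odd` removes them.
-/
theorem sum_sineProd_sq_div_odd (hp3 : 3 < p) :
    PCong p 3 (∑ k ∈ Finset.range p, p * sineProd p k ^ 2 / (2 * k + 1)) 1 := by
  obtain ⟨n, hn⟩ : ∃ n, p = 2 * n + 1 := hpf.out.odd_of_ne_two (by omega)
  have hmem : n ∈ Finset.range p := Finset.mem_range.2 (by omega)
  have hp0 : (p : ℚ) ≠ 0 := Nat.cast_ne_zero.2 hpf.out.ne_zero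
  rw [← Finset.add_sum_erase _ _ hmem]
  have h1 : PCong p 3 (p * sineProd p n ^ 2 / (2 * n + 1)) 1 := by
    have : (2 * (n : ℚ) + 1) = p := by exact_mod_cast hn.symm
    rw [this, mul_div_cancel_left₀ _ hp0]
    exact sineProd_sq_pCong_one (by omega) (ratCast_harmonicTwo_half _ hp3 hn)
  have h2 : PCong p 3 (∑ k ∈ (Finset.range p).erase n, p * sineProd p k ^ 2 / (2 * k + 1)) 0 := by
    have h3 : PCong p 3 (∑ k ∈ (Finset.range p).erase n, p * sineProd p k ^ 2 / (2 * k + 1))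
        (∑ k ∈ (Finset.range p).erase n, p * ((2 * k + 1 : ℕ) : ℚ)⁻¹) := by
      refine PCong.sum fun k hk => ?_
      rw [Finset.mem_erase, Finset.mem_range] at hk
      have := mul_sineProd_sq_pCong hk.2 (inv_odd_mem hn hk.2 hk.1)
      rw [div_eq_mul_inv]
      push_cast at this ⊢
      exact this
    obtain ⟨c, hc, hc'⟩ := sum_erase_inv_odd hp3 hn
    rw [← Finset.mul_sum, hc'] at h3
    exact h3.trans ⟨c, hc, by ring⟩
  simpa using h1.add h2

theorem sum_sineProd_sq_div_succ (hp3 : 3 < p) :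
    PCong p 3 (∑ k ∈ Finset.range p, p * sineProd p k ^ 2 / (k + 1)) 1 := by
  have hp0 : (p : ℚ) ≠ 0 := Nat.cast_ne_zero.2 hpf.out.ne_zero
  obtain ⟨q, hq⟩ : ∃ q, p = q + 1 := ⟨p - 1, by omega⟩
  have hqp : (q : ℚ) + 1 = p := by rw [hq]; push_cast; rfl
  have h0 : Finset.range p = Finset.range (q + 1) := by rw [hq]
  rw [h0, Finset.sum_range_succ, hqp, mul_div_cancel_left₀ _ hp0]
  have h1 : PCong p 3 (sineProd p q ^ 2) 1 := by
    refine sineProd_sq_pCong_one (by omega) ?_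
    have := ratCast_harmonicTwo_pred (ZMod p) hp3
    rwa [show p - 1 = q by omega] at this
  have h2 : PCong p 3 (∑ k ∈ Finset.range q, p * sineProd p k ^ 2 / (k + 1)) 0 := by
    have h3 : PCong p 3 (∑ k ∈ Finset.range q, p * sineProd p k ^ 2 / (k + 1))
        (∑ k ∈ Finset.range q, p * ((k + 1 : ℕ) : ℚ)⁻¹) := by
      refine PCong.sum fun k hk => ?_
      rw [Finset.mem_range] at hk
      have := mul_sineProd_sq_pCong (show k < p by omega)
        (inv_mem_pIntegers_of_lt (show 0 < k + 1 by omega) (show k + 1 < p by omega))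
      rw [div_eq_mul_inv]
      push_cast at this ⊢
      exact this
    obtain ⟨c, hc, hc'⟩ := harmonic_pred_eq hp3
    rw [show p - 1 = q by omega, harmonic] at hc'
    rw [← Finset.mul_sum, hc'] at h3
    exact h3.trans ⟨c, hc, by ring⟩
  simpa using h2.add h1

/-- The term k = 0 equals 1 and cancels the right-hand side; what remains is the sum over k ≥ 1 with
weights 1 - p²H_k^{(2)}. -/
theorem sum_pCong_of_sum_sineProd_mul {a : ℕ → ℕ} (ha : a 0 = 1)
    (h : PCong p 3 (∑ k ∈ Finset.range p, sineProd p k * a k) 1) :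
    PCong p 3 (∑ k ∈ Finset.Icc 1 (p - 1), (a k : ℚ))
      ((p : ℚ) ^ 2 * ∑ k ∈ Finset.Icc 1 (p - 1), (a k : ℚ) * harmonicTwo k) := by
  have h1 : PCong p 3 (∑ k ∈ Finset.range p, sineProd p k * a k)
      (∑ k ∈ Finset.range p, (1 - (p : ℚ) ^ 2 * harmonicTwo k) * a k) := by
    refine PCong.sum fun k hk => PCong.mul_right (natCast_mem_pIntegers _) ?_
    obtain ⟨c, hc, h⟩ := sineProd_eq (Finset.mem_range.1 hk)
    exact ⟨p * c, mul_mem (natCast_mem_pIntegers p) hc, by rw [h]; ring⟩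
  have h2 := h1.symm.trans h
  rw [sum_range_eq_add_sum_Icc hpf.out.pos, ha] at h2
  obtain ⟨c, hc, h2⟩ := h2
  refine ⟨c, hc, ?_⟩
  simp only [sub_mul, one_mul, Finset.sum_sub_distrib] at h2
  rw [← h2, Finset.mul_sum]
  simp only [harmonicTwo, Finset.Icc_eq_empty (show ¬ 1 ≤ 0 by omega), Finset.sum_empty]
  have : ∀ k : ℕ, (p : ℚ) ^ 2 * ((a k : ℚ) * ∑ x ∈ Finset.Icc 1 k, 1 / (x : ℚ) ^ 2) =
    (p : ℚ) ^ 2 * (∑ x ∈ Finset.Icc 1 k, 1 / (x : ℚ) ^ 2) * a k := fun k => by ring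
  simp only [this]
  push_cast
  ring

theorem sum_gSeq_pCong (hp3 : 3 < p) :
    PCong p 3 (∑ k ∈ Finset.Icc 1 (p - 1), (gSeq k : ℚ))
      ((p : ℚ) ^ 2 * ∑ k ∈ Finset.Icc 1 (p - 1), (gSeq k : ℚ) * harmonicTwo k) := by
  refine sum_pCong_of_sum_sineProd_mul (by decide) ?_
  have h := sum_sineProd_mul_sum (hpf.out.odd_of_ne_two (by omega)) fun _ => 1
  simp only [mul_one] at h
  simp only [gSeq]
  push_cast
  rw [h]
  exact sum_sineProd_sq_div_odd hp3

theorem catalan_cast (k : ℕ) : (catalan k : ℚ) = (2 * k).choose k * ((k : ℚ) + 1)⁻¹ := by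
  rw [← div_eq_mul_inv, eq_div_iff (by positivity)]
  have := succ_mul_catalan_eq_centralBinom k
  rw [Nat.centralBinom] at this
  rw [mul_comm]
  exact_mod_cast this

theorem sum_hSeq_pCong (hp3 : 3 < p) :
    PCong p 3 (∑ k ∈ Finset.Icc 1 (p - 1), (hSeq k : ℚ))
      ((p : ℚ) ^ 2 * ∑ k ∈ Finset.Icc 1 (p - 1), (hSeq k : ℚ) * harmonicTwo k) := by
  refine sum_pCong_of_sum_sineProd_mul (by simp [hSeq]) ?_
  have h := sum_sineProd_mul_sum (hpf.out.odd_of_ne_two (by omega)) fun k => ((k : ℚ) + 1)⁻¹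
  simp only [hSeq]
  push_cast
  simp only [catalan_cast]
  rw [h]
  have h1 := (((sum_sineProd_sq_div_odd hp3).mul_left (natCast_mem_pIntegers 2)).sub
    (sum_sineProd_sq_div_succ hp3))
  -- Partial fractions: 1/((2k+1)(k+1)) = 2/(2k+1) - 1/(k+1), so the total is 2·1 - 1 = 1.
  have h2 : ((2 : ℕ) : ℚ) * ∑ k ∈ Finset.range p, p * sineProd p k ^ 2 / (2 * k + 1) -
      ∑ k ∈ Finset.range p, p * sineProd p k ^ 2 / (k + 1) =
      ∑ k ∈ Finset.range p, p * sineProd p k ^ 2 / (2 * k + 1) * ((k : ℚ) + 1)⁻¹ := by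
    rw [Finset.mul_sum, ← Finset.sum_sub_distrib]
    refine Finset.sum_congr rfl fun k _ => ?_
    have h1 : (k : ℚ) + 1 ≠ 0 := by positivity
    have h2 : 2 * (k : ℚ) + 1 ≠ 0 := by positivity
    push_cast
    field_simp
    ring
  rw [h2] at h1
  norm_num at h1
  exact h1

end

/-! ### The sums weighted by H_k^{(2)} modulo p, and identities behind the powers of -3. -/

theorem sum_choose_mul_harmonicTwo (q l : ℕ) :
    ∑ k ∈ Finset.range (q + 1), (k.choose l : ℚ) * harmonicTwo k =
      (q + 1).choose (l + 1) * harmonicTwo q -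
        (∑ k ∈ Finset.range q, (k.choose l : ℚ) / (k + 1)) / (l + 1) := by
  induction q with
  | zero => simp [harmonicTwo_zero]
  | succ q ih =>
    rw [Finset.sum_range_succ, ih, Finset.sum_range_succ, harmonicTwo_succ,
      Nat.choose_succ_succ (q + 1) l]
    have h : ((q + 1).choose (l + 1) : ℚ) = (q + 1) * q.choose l / (l + 1) := by
      rw [eq_div_iff (by positivity)]
      exact_mod_cast (Nat.add_one_mul_choose_eq q l).symm
    push_cast
    rw [h]
    field_simp
    ring

/-- Pascal's rule and C(k+1,l+1)/(k+1) = C(k,l)/(l+1), combined with the hockey-stick identity. -/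
theorem sum_choose_div_succ (q l : ℕ) :
    ∑ k ∈ Finset.range q, (k.choose (l + 1) : ℚ) / (k + 1) =
      q.choose (l + 1) / (l + 1) - ∑ k ∈ Finset.range q, (k.choose l : ℚ) / (k + 1) := by
  induction q with
  | zero => simp
  | succ q ih =>
    rw [Finset.sum_range_succ, ih, Finset.sum_range_succ]
    have h : ((q + 1).choose (l + 1) : ℚ) = (q + 1) * q.choose l / (l + 1) := by
      rw [eq_div_iff (by positivity)]
      exact_mod_cast (Nat.add_one_mul_choose_eq q l).symm
    have h' : (q.choose (l + 1) : ℚ) = (q + 1) * q.choose l / (l + 1) - q.choose l := by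
      rw [← h, Nat.choose_succ_succ]
      push_cast
      ring
    rw [h, h']
    field_simp
    ring

theorem sum_range_two_mul {R : Type*} [AddCommMonoid R] (N : ℕ) (f : ℕ → R) :
    ∑ k ∈ Finset.range (2 * N), f k = ∑ m ∈ Finset.range N, (f (2 * m) + f (2 * m + 1)) := by
  induction N with
  | zero => simp
  | succ N ih =>
    rw [show 2 * (N + 1) = 2 * N + 1 + 1 by ring, Finset.sum_range_succ, Finset.sum_range_succ, ih,
      Finset.sum_range_succ, add_assoc]

theorem one_add_pow_add_one_sub_pow {R : Type*} [CommRing R] (s : R) (n : ℕ) :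
    (1 + s) ^ (2 * n + 1) + (1 - s) ^ (2 * n + 1) =
      2 * ∑ m ∈ Finset.range (n + 1), ((2 * n + 1).choose (2 * m) : R) * (s ^ 2) ^ m := by
  rw [add_comm 1 s, sub_eq_neg_add, add_pow, add_pow, ← Finset.sum_add_distrib,
    show 2 * n + 1 + 1 = 2 * (n + 1) by ring, sum_range_two_mul, Finset.mul_sum]
  refine Finset.sum_congr rfl fun m _ => ?_
  rw [pow_succ, pow_succ, pow_mul (-s), neg_sq, ← pow_mul]
  ring

/-- (1 ± √-3)/2 are primitive sixth roots of unity, so their p-th powers again sum to 1 when p ≡ ±1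
modulo 6. Thus (1+s)^p + (1-s)^p is 2^p both at s = 1 and at s = √-3; the even binomial sums agree.
-/
theorem sum_choose_even_neg_three {p n : ℕ} (hn : p = 2 * n + 1) (h3 : ¬ 3 ∣ p) :
    ∑ m ∈ Finset.range (n + 1), (p.choose (2 * m) : ℤ) * ((-3) ^ m - 1) = 0 := by
  have e1 := one_add_pow_add_one_sub_pow (1 : ℤ) n
  have e2 := one_add_pow_add_one_sub_pow (Zsqrtd.sqrtd : ℤ√(-3)) n
  have hs : (Zsqrtd.sqrtd : ℤ√(-3)) ^ 2 = ((-3 : ℤ) : ℤ√(-3)) := by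
    rw [sq, ← Zsqrtd.dmuld]
  rw [hs] at e2
  set s : ℤ√(-3) := Zsqrtd.sqrtd
  have hs' : s ^ 2 = -3 := by rw [hs]; norm_num
  have h6 : (1 + s) ^ 6 = 64 := by
    linear_combination (s ^ 4 + 6 * s ^ 3 + 12 * s ^ 2 + 2 * s - 21) * hs'
  have h6' : (1 - s) ^ 6 = 64 := by
    linear_combination (s ^ 4 - 6 * s ^ 3 + 12 * s ^ 2 - 2 * s - 21) * hs'
  have key : (1 + s) ^ (2 * n + 1) + (1 - s) ^ (2 * n + 1) = 2 ^ (2 * n + 1) := by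
    obtain ⟨t, ht | ht⟩ : ∃ t, 2 * n + 1 = 6 * t + 1 ∨ 2 * n + 1 = 6 * t + 5 :=
      ⟨(2 * n + 1) / 6, by omega⟩
    · rw [ht, pow_succ, pow_succ, pow_mul, pow_mul, h6, h6', pow_succ, pow_mul]
      norm_num
      ring
    · rw [ht, pow_add, pow_add, pow_mul, pow_mul, h6, h6', pow_add, pow_mul]
      norm_num
      rw [← mul_add]
      congr 1
  rw [key] at e2
  have e3 : (2 : ℤ) ^ (2 * n + 1) =
      2 * ∑ m ∈ Finset.range (n + 1), ((2 * n + 1).choose (2 * m) : ℤ) * (-3) ^ m := by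
    have : (((2 : ℤ) ^ (2 * n + 1) : ℤ) : ℤ√(-3)) =
      ((2 * ∑ m ∈ Finset.range (n + 1), ((2 * n + 1).choose (2 * m) : ℤ) * (-3) ^ m : ℤ) :
        ℤ√(-3)) := by
      push_cast at e2 ⊢
      exact e2
    exact Int.cast_injective this
  rw [hn]
  simp only [mul_sub, Finset.sum_sub_distrib, mul_one]
  norm_num at e1
  have h4 : (2 : ℤ) ≠ 0 := by norm_num
  refine mul_left_cancel₀ h4 ?_
  linear_combination e1 - e3

theorem sum_choose_mul_pow_div (n : ℕ) (z : ℚ) :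
    ∑ i ∈ Finset.Icc 1 n, (n.choose i : ℚ) * z ^ i / i =
      ∑ m ∈ Finset.Icc 1 n, ((1 + z) ^ m - 1) / m := by
  induction n with
  | zero => simp
  | succ n ih =>
    rw [Finset.sum_Icc_succ_top (by omega), Finset.sum_Icc_succ_top (by omega), ← ih]
    have h1 : ∀ i ∈ Finset.Icc 1 n, ((n + 1).choose i : ℚ) * z ^ i / i =
        n.choose i * z ^ i / i + (n + 1).choose i * z ^ i / ((n + 1 : ℕ) : ℚ) := by
      intro i hi
      obtain ⟨k, rfl⟩ : ∃ k, i = k + 1 := ⟨i - 1, by rw [Finset.mem_Icc] at hi; omega⟩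
      have h : ((n + 1).choose (k + 1) : ℚ) * (k + 1) = (n + 1) * n.choose k := by
        exact_mod_cast (Nat.add_one_mul_choose_eq n k).symm
      have h' : ((n + 1).choose (k + 1) : ℚ) = n.choose k + n.choose (k + 1) := by
        rw [Nat.choose_succ_succ]
        push_cast
        rfl
      push_cast
      field_simp
      linear_combination z * z ^ k * (((n : ℚ) + 1) * h' - h)
    rw [Finset.sum_congr rfl h1, Finset.sum_add_distrib, add_assoc]
    congr 1
    have h2 : (1 + z) ^ (n + 1) = 1 + ∑ i ∈ Finset.Icc 1 (n + 1), ((n + 1).choose i : ℚ) * z ^ i := by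
      rw [add_comm 1 z, add_pow, sum_range_eq_add_sum_Icc (by omega)]
      simp [mul_comm]
    rw [h2, Finset.sum_Icc_succ_top (by omega), ← Finset.sum_div, Nat.choose_self]
    ring

/-- With 2n + 1 = p the product is 1 modulo p, and its first-order term supplies the refinement
modulo p². -/
theorem choose_mul_neg_four_pow (n i : ℕ) :
    (n.choose i : ℚ) * (-4) ^ i =
      (2 * i).choose i * ∏ j ∈ Finset.range i, (1 - (2 * n + 1 : ℚ) * ((2 * j + 1 : ℕ) : ℚ)⁻¹) := by
  induction i with
  | zero => simp
  | succ i ih =>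
    rw [Finset.prod_range_succ, two_mul_succ_choose, choose_succ_right_cast, pow_succ]
    have h : (n.choose i : ℚ) * ((n : ℚ) - i) / (i + 1) * ((-4) ^ i * -4) =
      (n.choose i : ℚ) * (-4) ^ i * (((n : ℚ) - i) * (-4) / (i + 1)) := by ring
    rw [h, ih]
    push_cast
    field_simp
    ring

theorem choose_pred_eq_prod {q k : ℕ} :
    (q.choose k : ℚ) =
      (-1) ^ k * ∏ j ∈ Finset.range k, (1 - (q + 1 : ℚ) * ((j + 1 : ℕ) : ℚ)⁻¹) := by
  induction k with
  | zero => simp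
  | succ k ih =>
    rw [Finset.prod_range_succ, choose_succ_right_cast, ih, pow_succ]
    push_cast
    field_simp
    ring

theorem sum_centralSum_mul_sub (o : ℕ → ℚ) (n : ℕ) :
    ∑ j ∈ Finset.range (n + 1), centralSum j * (o (j + 1) - o j) =
      centralSum n * o (n + 1) -
        3 / 2 * ∑ i ∈ Finset.Icc 1 n, ((2 * i).choose i : ℚ) / i * o i := by
  induction n with
  | zero => simp [centralSum]
  | succ n ih =>
    rw [Finset.sum_range_succ, ih, Finset.sum_Icc_succ_top (by omega)]
    have : centralSum (n + 1) = centralSum n +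
        3 / 2 * (((2 * (n + 1)).choose (n + 1) : ℚ) / ((n + 1 : ℕ) : ℚ)) := by
      rw [centralSum, Finset.sum_Icc_succ_top (by omega), mul_add, ← centralSum]
    rw [this]
    ring

section
variable {p : ℕ} [hpf : Fact p.Prime]

theorem prod_one_sub_mul_eq {u : ℕ → ℚ} {k : ℕ} (hu : ∀ j < k, u j ∈ pIntegers p) :
    ∃ c ∈ pIntegers p, ∏ j ∈ Finset.range k, (1 - (p : ℚ) * u j) =
      1 - p * ∑ j ∈ Finset.range k, u j + (p : ℚ) ^ 2 * c := by
  induction k with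
  | zero => exact ⟨0, zero_mem _, by simp⟩
  | succ k ih =>
    obtain ⟨c, hc, h⟩ := ih fun j hj => hu j (by omega)
    have hs : ∑ j ∈ Finset.range k, u j ∈ pIntegers p :=
      sum_mem fun j hj => hu j (by rw [Finset.mem_range] at hj; omega)
    have huk := hu k (by omega)
    refine ⟨c + (∑ j ∈ Finset.range k, u j) * u k - p * c * u k,
      sub_mem (add_mem hc (mul_mem hs huk))
        (mul_mem (mul_mem (natCast_mem_pIntegers p) hc) huk), ?_⟩
    rw [Finset.prod_range_succ, h, Finset.sum_range_succ]
    ring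

theorem choose_pred_pCong {l : ℕ} (hl : l < p) : PCong p 1 ((p - 1).choose l : ℚ) ((-1) ^ l) := by
  obtain ⟨c, hc, h⟩ := prod_one_sub_mul_eq (p := p) (u := fun j => ((j + 1 : ℕ) : ℚ)⁻¹) (k := l)
    fun j hj => inv_mem_pIntegers_of_lt (by omega) (by omega)
  have hp1 : (((p - 1 : ℕ) : ℚ) + 1) = p := by
    exact_mod_cast Nat.sub_add_cancel hpf.out.one_le
  have h1 : (-1 : ℚ) ∈ pIntegers p := neg_mem (one_mem _)
  refine ⟨(-1) ^ l * (p * c - ∑ j ∈ Finset.range l, ((j + 1 : ℕ) : ℚ)⁻¹), mul_mem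
    (pow_mem h1 l) (sub_mem (mul_mem (natCast_mem_pIntegers p) hc) (sum_mem fun j hj => ?_)), ?_⟩
  · rw [Finset.mem_range] at hj
    exact inv_mem_pIntegers_of_lt (by omega) (by omega)
  · rw [choose_pred_eq_prod, hp1, h]
    ring

/-- The multiple of H_{p-1} makes the base case an equality; Wolstenholme disposes of it later. -/
theorem sum_choose_div_succ_pCong {l : ℕ} (hl : l < p) :
    PCong p 1 (∑ k ∈ Finset.range (p - 1), (k.choose l : ℚ) / (k + 1))
      ((-1) ^ l * harmonic l + harmonic (p - 1) * (-1) ^ l) := by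
  induction l with
  | zero =>
    have : ∑ k ∈ Finset.range (p - 1), ((k.choose 0 : ℕ) : ℚ) / (k + 1) = harmonic (p - 1) := by
      rw [harmonic]
      refine Finset.sum_congr rfl fun k _ => ?_
      push_cast
      simp
    rw [this]
    simpa using PCong.refl _
  | succ l ih =>
    rw [sum_choose_div_succ, harmonic_succ]
    have h := ((choose_pred_pCong hl).mul_right
      (inv_mem_pIntegers_of_lt (show 0 < l + 1 by omega) hl)).sub (ih (by omega))
    convert h using 1
    · push_cast
      ring
    · push_cast
      ring

/-- Only l = p - 1 has p in the denominator, and Wolstenholme compensates it. -/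
theorem harmonic_div_succ_mem (hp3 : 3 < p) {l : ℕ} (hl : l < p) :
    harmonic l / (l + 1) ∈ pIntegers p := by
  rcases Nat.lt_or_ge (l + 1) p with h | h
  · rw [div_eq_mul_inv]
    have := inv_mem_pIntegers_of_lt (p := p) (show 0 < l + 1 by omega) h
    push_cast at this
    exact mul_mem (harmonic_mem hl) this
  · obtain ⟨c, hc, hc'⟩ := harmonic_pred_eq hp3
    have hp0 : (p : ℚ) ≠ 0 := Nat.cast_ne_zero.2 hpf.out.ne_zero
    have hl' : (l : ℚ) + 1 = p := by exact_mod_cast (show l + 1 = p by omega)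
    rw [show p - 1 = l by omega] at hc'
    rw [hl', hc', sq, mul_assoc, mul_div_cancel_left₀ _ hp0]
    exact mul_mem (natCast_mem_pIntegers p) hc

theorem sum_choose_mul_harmonicTwo_pCong (hp3 : 3 < p) {l : ℕ} (hl : l < p) :
    PCong p 1 (∑ k ∈ Finset.range p, (k.choose l : ℚ) * harmonicTwo k)
      (-((-1) ^ l * (harmonic l / (l + 1)))) := by
  have hq : p - 1 + 1 = p := by omega
  have key := sum_choose_mul_harmonicTwo (p - 1) l
  rw [hq] at key
  have h2 := exists_eq_mul_of_ratCast_eq_zero (harmonicTwo_mem (show p - 1 < p by omega))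
    (ratCast_harmonicTwo_pred (ZMod p) hp3)
  obtain ⟨d, hd, hd'⟩ := h2
  obtain ⟨c, hc, hc'⟩ := harmonic_pred_eq hp3
  have hH2 : PCong p 1 ((p.choose (l + 1) : ℚ) * harmonicTwo (p - 1)) 0 :=
    ⟨p.choose (l + 1) * d, mul_mem (natCast_mem_pIntegers _) hd, by rw [hd']; ring⟩
  rw [key]
  rcases Nat.lt_or_ge (l + 1) p with h | h
  · have hi := inv_mem_pIntegers_of_lt (p := p) (show 0 < l + 1 by omega) h
    have h3 := hH2.sub ((sum_choose_div_succ_pCong hl).mul_right hi)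
    have h4 : PCong p 1 (0 - ((-1) ^ l * harmonic l + harmonic (p - 1) * (-1) ^ l) *
        ((l + 1 : ℕ) : ℚ)⁻¹) (-((-1) ^ l * (harmonic l / (l + 1)))) := by
      have h1 : (-1 : ℚ) ∈ pIntegers p := neg_mem (one_mem _)
      refine ⟨-(p * c * (-1) ^ l * ((l + 1 : ℕ) : ℚ)⁻¹), neg_mem (mul_mem (mul_mem (mul_mem
        (natCast_mem_pIntegers p) hc) (pow_mem h1 l)) hi), ?_⟩
      rw [hc']
      push_cast
      ring
    have h5 := h3.trans h4
    convert h5 using 2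
    push_cast
    rw [div_eq_mul_inv]
  · have hz : ∑ k ∈ Finset.range (p - 1), (k.choose l : ℚ) / (k + 1) = 0 := by
      refine Finset.sum_eq_zero fun k hk => ?_
      rw [Finset.mem_range] at hk
      rw [Nat.choose_eq_zero_of_lt (by omega)]
      simp
    have hp0 : (p : ℚ) ≠ 0 := Nat.cast_ne_zero.2 hpf.out.ne_zero
    have hl' : (l : ℚ) + 1 = p := by exact_mod_cast (show l + 1 = p by omega)
    have h1 : (-1 : ℚ) ∈ pIntegers p := neg_mem (one_mem _)
    rw [hz, zero_div, sub_zero]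
    refine hH2.trans ⟨(-1) ^ l * c, mul_mem (pow_mem h1 l) hc, ?_⟩
    rw [show p - 1 = l by omega] at hc'
    rw [hl', hc']
    field_simp
    ring

/-- The sum `∑_{k < p} C(k,j)² H_k^{(2)}`. -/
noncomputable def chooseSqSum (p j : ℕ) : ℚ :=
  ∑ k ∈ Finset.range p, (k.choose j : ℚ) ^ 2 * harmonicTwo k

theorem chooseSqSum_mem (j : ℕ) : chooseSqSum p j ∈ pIntegers p :=
  sum_mem fun _ hk => mul_mem (pow_mem (natCast_mem_pIntegers _) 2)
    (harmonicTwo_mem (Finset.mem_range.1 hk))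

/-- After linearising C(k,j)² and summing over k, the coefficients of the harmonic numbers are
`legendreWeight` divided by 2j+1. Integrality is part of the claim since 2j+1 may equal p. -/
theorem choose_mul_chooseSqSum_pCong (hp3 : 3 < p) {j : ℕ} (hj : 2 * j < p) :
    centralSum j / (2 * j + 1) ∈ pIntegers p ∧
      PCong p 1 ((2 * j).choose j * chooseSqSum p j) (-(centralSum j / (2 * j + 1))) := by
  have h1 : (-1 : ℚ) ∈ pIntegers p := neg_mem (one_mem _)
  have h0 : chooseSqSum p j = ∑ i ∈ Finset.range (j + 1), ((j + i).choose j * j.choose i : ℕ) *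
      ∑ k ∈ Finset.range p, (k.choose (j + i) : ℚ) * harmonicTwo k := by
    simp only [Finset.mul_sum]
    rw [Finset.sum_comm, chooseSqSum]
    refine Finset.sum_congr rfl fun k _ => ?_
    rw [← Nat.cast_pow, choose_sq_eq_sum, Nat.cast_sum, Finset.sum_mul]
    refine Finset.sum_congr rfl fun i _ => ?_
    push_cast
    ring
  have h2 : centralSum j / (2 * j + 1) = (2 * j).choose j * ∑ i ∈ Finset.range (j + 1),
      ((j + i).choose j * j.choose i : ℕ) *
        ((-1) ^ (j + i) * (harmonic (j + i) / ((j + i : ℕ) + 1))) := by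
    rw [← sum_legendreWeight_mul_harmonic, sum_range_two_mul_eq, Finset.sum_div, Finset.mul_sum]
    · refine Finset.sum_congr rfl fun i _ => ?_
      rw [legendreWeight, Nat.add_sub_cancel_left]
      push_cast
      field_simp
    · intro l hl
      simp [legendreWeight, Nat.choose_eq_zero_of_lt hl]
  constructor
  · rw [h2]
    refine mul_mem (natCast_mem_pIntegers _) (sum_mem fun i hi => mul_mem
      (natCast_mem_pIntegers _) (mul_mem (pow_mem h1 _) (harmonic_div_succ_mem hp3 ?_)))
    rw [Finset.mem_range] at hi
    omega
  · rw [h2, ← mul_neg, ← Finset.sum_neg_distrib, h0]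
    refine PCong.mul_left (natCast_mem_pIntegers _) (PCong.sum fun i hi => ?_)
    rw [← mul_neg]
    rw [Finset.mem_range] at hi
    exact PCong.mul_left (natCast_mem_pIntegers _)
      (sum_choose_mul_harmonicTwo_pCong hp3 (by omega))

theorem sum_mul_harmonicTwo_eq (w : ℕ → ℚ) (a : ℕ → ℚ)
    (ha : ∀ n, a n = ∑ k ∈ Finset.range (n + 1), (n.choose k : ℚ) ^ 2 * w k) :
    ∑ n ∈ Finset.Icc 1 (p - 1), a n * harmonicTwo n =
      ∑ j ∈ Finset.range p, w j * chooseSqSum p j := by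
  have h := sum_range_eq_add_sum_Icc hpf.out.pos fun n => a n * harmonicTwo n
  rw [harmonicTwo_zero, mul_zero, zero_add] at h
  rw [← h]
  simp only [chooseSqSum, Finset.mul_sum]
  rw [Finset.sum_comm]
  refine Finset.sum_congr rfl fun n hn => ?_
  rw [ha, Finset.sum_mul]
  have := Finset.sum_subset (Finset.range_mono (Finset.mem_range.1 hn))
    (f := fun k => w k * ((n.choose k : ℚ) ^ 2 * harmonicTwo n)) fun k _ hk => by
      rw [Finset.mem_range, not_lt] at hk
      rw [Nat.choose_eq_zero_of_lt (by omega)]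
      simp
  rw [← this]
  exact Finset.sum_congr rfl fun k _ => by ring

theorem sum_mul_chooseSqSum_pCong {n : ℕ} (hn : p = 2 * n + 1) {w f : ℕ → ℚ}
    (h1 : ∀ j ≤ n, PCong p 1 (w j * chooseSqSum p j) (f j))
    (h2 : ∀ j < p, n < j → PCong p 1 (w j * chooseSqSum p j) 0) :
    PCong p 1 (∑ j ∈ Finset.range p, w j * chooseSqSum p j) (∑ j ∈ Finset.range (n + 1), f j) := by
  have h : PCong p 1 (∑ j ∈ Finset.range p, w j * chooseSqSum p j)
      (∑ j ∈ Finset.range p, if j ≤ n then f j else 0) := by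
    refine PCong.sum fun j hj => ?_
    split_ifs with hjn
    · exact h1 j hjn
    · exact h2 j (Finset.mem_range.1 hj) (by omega)
  have h3 : ∑ j ∈ Finset.range p, (if j ≤ n then f j else 0) = ∑ j ∈ Finset.range (n + 1), f j := by
    rw [← Finset.sum_filter]
    congr 1
    ext j
    simp only [Finset.mem_filter, Finset.mem_range]
    omega
  rwa [h3] at h

theorem dvd_choose_two_mul {n j : ℕ} (hn : p = 2 * n + 1) (hj : j < p) (hjn : n < j) :
    p ∣ (2 * j).choose j := by
  rw [two_mul]
  exact hpf.out.dvd_choose_add hj hj (by omega)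

theorem mul_pCong_zero {a : ℕ} (ha : p ∣ a) {x : ℚ} (hx : x ∈ pIntegers p) :
    PCong p 1 (a * x) 0 := by
  obtain ⟨c, rfl⟩ := ha
  exact ⟨c * x, mul_mem (natCast_mem_pIntegers c) hx, by push_cast; ring⟩

theorem sum_gSeq_mul_harmonicTwo_pCong (hp3 : 3 < p) {n : ℕ} (hn : p = 2 * n + 1) :
    PCong p 1 (∑ k ∈ Finset.Icc 1 (p - 1), (gSeq k : ℚ) * harmonicTwo k)
      (∑ j ∈ Finset.range (n + 1), -(centralSum j / (2 * j + 1))) := by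
  rw [sum_mul_harmonicTwo_eq (fun j => ((2 * j).choose j : ℚ)) (fun k => (gSeq k : ℚ)) fun k => by
    simp only [gSeq]
    push_cast
    rfl]
  refine sum_mul_chooseSqSum_pCong hn (fun j hj => ?_) fun j hj hjn => ?_
  · exact (choose_mul_chooseSqSum_pCong hp3 (by omega)).2
  · exact mul_pCong_zero (dvd_choose_two_mul hn hj hjn) (chooseSqSum_mem j)

theorem sum_hSeq_mul_harmonicTwo_pCong (hp3 : 3 < p) {n : ℕ} (hn : p = 2 * n + 1) :
    PCong p 1 (∑ k ∈ Finset.Icc 1 (p - 1), (hSeq k : ℚ) * harmonicTwo k)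
      (∑ j ∈ Finset.range (n + 1), -(centralSum j / (2 * j + 1)) * ((j : ℚ) + 1)⁻¹) := by
  rw [sum_mul_harmonicTwo_eq (fun j => (catalan j : ℚ)) (fun k => (hSeq k : ℚ)) fun k => by
    simp only [hSeq]
    push_cast
    rfl]
  refine sum_mul_chooseSqSum_pCong hn (fun j hj => ?_) fun j hj hjn => ?_
  · rw [catalan_cast, mul_right_comm]
    have := inv_mem_pIntegers_of_lt (p := p) (show 0 < j + 1 by omega) (by omega)
    push_cast at this
    exact ((choose_mul_chooseSqSum_pCong hp3 (by omega)).2).mul_right this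
  · rcases Nat.lt_or_ge (j + 1) p with h | h
    · refine mul_pCong_zero ?_ (chooseSqSum_mem j)
      have h1 := dvd_choose_two_mul hn hj hjn
      have h2 := succ_mul_catalan_eq_centralBinom j
      rw [Nat.centralBinom] at h2
      rw [← h2] at h1
      exact (hpf.out.dvd_mul.1 h1).resolve_left (Nat.not_dvd_of_pos_of_lt (by omega) h)
    -- For j = p - 1 the factor j + 1 = p blocks the divisibility argument for the Catalan number;
    -- instead the inner sum reduces to H_{p-1}^{(2)}, which vanishes modulo p.
    · refine PCong.trans ?_ (PCong.refl 0)
      have h3 : chooseSqSum p j = harmonicTwo (p - 1) := by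
        rw [chooseSqSum, Finset.sum_eq_single (p - 1)]
        · rw [show p - 1 = j by omega]
          simp
        · intro k hk hkp
          rw [Finset.mem_range] at hk
          rw [Nat.choose_eq_zero_of_lt (by omega)]
          simp
        · intro hk
          exact absurd (Finset.mem_range.2 (by omega)) hk
      obtain ⟨d, hd, hd'⟩ := exists_eq_mul_of_ratCast_eq_zero
        (harmonicTwo_mem (show p - 1 < p by omega)) (ratCast_harmonicTwo_pred (ZMod p) hp3)
      rw [h3, hd']
      exact ⟨catalan j * d, mul_mem (natCast_mem_pIntegers _) hd, by ring⟩

end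

/-! ### Reduction to two harmonic sums over half the range. -/

section
variable {p : ℕ} [hpf : Fact p.Prime]

theorem inv_two_mem (hp3 : 3 < p) : (2 : ℚ)⁻¹ ∈ pIntegers p := by
  exact_mod_cast inv_mem_pIntegers_of_lt (p := p) (show 0 < 2 by omega) (by omega)

theorem three_half_mem (hp3 : 3 < p) : (3 / 2 : ℚ) ∈ pIntegers p := by
  rw [div_eq_mul_inv]
  exact mul_mem (natCast_mem_pIntegers 3) (inv_two_mem hp3)

theorem choose_div_mem {i : ℕ} (hi : 0 < i) (hip : i < p) :
    ((2 * i).choose i : ℚ) / i ∈ pIntegers p := by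
  rw [div_eq_mul_inv]
  exact mul_mem (natCast_mem_pIntegers _) (inv_mem_pIntegers_of_lt hi hip)

theorem centralSum_half_eq (hp3 : 3 < p) {n : ℕ} (hn : p = 2 * n + 1) :
    ∃ d ∈ pIntegers p, centralSum n = p * d := by
  have hp0 : (p : ℚ) ≠ 0 := Nat.cast_ne_zero.2 hpf.out.ne_zero
  have h := (choose_mul_chooseSqSum_pCong hp3 (show 2 * n < p by omega)).1
  have h2 : 2 * (n : ℚ) + 1 = p := by exact_mod_cast hn.symm
  rw [h2] at h
  exact ⟨_, h, (mul_div_cancel₀ _ hp0).symm⟩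

/-- Abel summation against o_i = ∑_{j<i} 1/(2j+1), whose last step is 1/p, produces C(2i,i)(1 - p
o_i), that is (-4)^i C(n,i) modulo p². The boundary term p S_n o_n drops out because p divides S_n.
-/
theorem mul_sum_centralSum_div_pCong (hp3 : 3 < p) {n : ℕ} (hn : p = 2 * n + 1) :
    PCong p 2 (p * ∑ j ∈ Finset.range (n + 1), centralSum j / (2 * j + 1))
      (3 / 2 * ∑ m ∈ Finset.Icc 1 n, ((-3 : ℚ) ^ m - 1) / m) := by
  have hp0 : (p : ℚ) ≠ 0 := Nat.cast_ne_zero.2 hpf.out.ne_zero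
  have hn' : 2 * (n : ℚ) + 1 = p := by exact_mod_cast hn.symm
  set o : ℕ → ℚ := fun i => ∑ j ∈ Finset.range i, ((2 * j + 1 : ℕ) : ℚ)⁻¹ with ho
  have hinv : ∀ j < n, ((2 * j + 1 : ℕ) : ℚ)⁻¹ ∈ pIntegers p := fun j hj =>
    inv_mem_pIntegers_of_lt (by omega) (by omega)
  have hon : o n ∈ pIntegers p := sum_mem fun j hj => hinv j (Finset.mem_range.1 hj)
  have hS : ∑ j ∈ Finset.range (n + 1), centralSum j / (2 * j + 1) =
      centralSum n * (o n + (p : ℚ)⁻¹) -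
        3 / 2 * ∑ i ∈ Finset.Icc 1 n, ((2 * i).choose i : ℚ) / i * o i := by
    have h := sum_centralSum_mul_sub o n
    have h1 : ∀ j, o (j + 1) = o j + ((2 * j + 1 : ℕ) : ℚ)⁻¹ := fun j => by
      rw [ho]
      exact Finset.sum_range_succ _ _
    have h2 : o (n + 1) = o n + (p : ℚ)⁻¹ := by
      rw [h1, ← hn]
    rw [← h2, ← h]
    refine Finset.sum_congr rfl fun j _ => ?_
    rw [h1, add_sub_cancel_left, div_eq_mul_inv]
    push_cast
    rfl
  have hF := sum_choose_mul_pow_div n (-4)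
  rw [show (1 + -4 : ℚ) = -3 by norm_num] at hF
  obtain ⟨d, hd, hd'⟩ := centralSum_half_eq hp3 hn
  have h1 : PCong p 2 (3 / 2 * ∑ i ∈ Finset.Icc 1 n, ((2 * i).choose i : ℚ) / i * (1 - p * o i))
      (3 / 2 * ∑ i ∈ Finset.Icc 1 n, (n.choose i : ℚ) * (-4) ^ i / i) := by
    refine PCong.mul_left (three_half_mem hp3) (PCong.sum fun i hi => ?_)
    rw [Finset.mem_Icc] at hi
    obtain ⟨c, hc, h⟩ := prod_one_sub_mul_eq (p := p) (u := fun j => ((2 * j + 1 : ℕ) : ℚ)⁻¹)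
      (k := i) fun j hj => hinv j (by omega)
    rw [choose_mul_neg_four_pow, hn', h, mul_div_right_comm]
    refine PCong.mul_left (choose_div_mem (by omega) (by omega)) ⟨-c, neg_mem hc, ?_⟩
    rw [ho]
    ring
  rw [← hF]
  refine PCong.trans ?_ h1
  refine ⟨d * o n, mul_mem hd hon, ?_⟩
  rw [hS]
  have h2 : 3 / 2 * ∑ i ∈ Finset.Icc 1 n, ((2 * i).choose i : ℚ) / i * (1 - p * o i) =
      centralSum n - p * (3 / 2 * ∑ i ∈ Finset.Icc 1 n, ((2 * i).choose i : ℚ) / i * o i) := by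
    rw [centralSum, ← sub_eq_zero]
    simp only [mul_sub, mul_one, Finset.sum_sub_distrib]
    have : ∀ i : ℕ, ((2 * i).choose i : ℚ) / i * (p * o i) =
        p * (((2 * i).choose i : ℚ) / i * o i) := fun i => by ring
    simp only [this, ← Finset.mul_sum]
    ring
  rw [h2]
  linear_combination (o n * p) * hd' + centralSum n * mul_inv_cancel₀ hp0

/-- The sum `∑_{1 ≤ m ≤ n} ((-3)^m - 1) H_{2m-1} / m`. -/
noncomputable def negThreeSum (n : ℕ) : ℚ :=
  ∑ m ∈ Finset.Icc 1 n, ((-3) ^ m - 1) * harmonic (2 * m - 1) * (m : ℚ)⁻¹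

theorem neg_three_pow_mem (m : ℕ) : ((-3 : ℚ) ^ m - 1) ∈ pIntegers p :=
  sub_mem (pow_mem (neg_mem (natCast_mem_pIntegers 3)) m) (one_mem _)

theorem negThreeSum_mem {n : ℕ} (hn : p = 2 * n + 1) : negThreeSum n ∈ pIntegers p := by
  refine sum_mem fun m hm => ?_
  rw [Finset.mem_Icc] at hm
  exact mul_mem (mul_mem (neg_three_pow_mem m) (harmonic_mem (by omega)))
    (inv_mem_pIntegers_of_lt (by omega) (by omega))

/-- Insert C(p,2m) ≡ -(p/2m)(1 - p H_{2m-1}) modulo p³ into the vanishing sum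
`sum_choose_even_neg_three`, then cancel one factor p. -/
theorem sum_neg_three_pow_div_pCong (hp3 : 3 < p) {n : ℕ} (hn : p = 2 * n + 1) :
    PCong p 2 (∑ m ∈ Finset.Icc 1 n, ((-3 : ℚ) ^ m - 1) / m) (p * negThreeSum n) := by
  have h3 : ¬ 3 ∣ p := fun h => by
    have := (Nat.prime_dvd_prime_iff_eq Nat.prime_three hpf.out).1 h
    omega
  have hp1 : (((p - 1 : ℕ) : ℚ) + 1) = p := by
    exact_mod_cast Nat.sub_add_cancel hpf.out.one_le
  have h := sum_choose_even_neg_three hn h3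
  rw [sum_range_eq_add_sum_Icc (by omega)] at h
  have h' : ∑ m ∈ Finset.Icc 1 n, (p.choose (2 * m) : ℚ) * ((-3) ^ m - 1) = 0 := by
    simp only [Nat.add_sub_cancel, pow_zero, sub_self, mul_zero, zero_add] at h
    exact_mod_cast h
  have key : PCong p 3 (∑ m ∈ Finset.Icc 1 n, (p.choose (2 * m) : ℚ) * ((-3) ^ m - 1))
      (∑ m ∈ Finset.Icc 1 n, (p : ℚ) ^ 1 * (-2⁻¹ * (((-3 : ℚ) ^ m - 1) / m -
        p * (((-3) ^ m - 1) * harmonic (2 * m - 1) * (m : ℚ)⁻¹)))) := by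
    refine PCong.sum fun m hm => ?_
    rw [Finset.mem_Icc] at hm
    obtain ⟨c, hc, hprod⟩ := prod_one_sub_mul_eq (p := p) (u := fun j => ((j + 1 : ℕ) : ℚ)⁻¹)
      (k := 2 * m - 1) fun j hj => inv_mem_pIntegers_of_lt (by omega) (by omega)
    have hchoose : (p.choose (2 * m) : ℚ) * (2 * m) = p * (p - 1).choose (2 * m - 1) := by
      have := Nat.add_one_mul_choose_eq (p - 1) (2 * m - 1)
      rw [show p - 1 + 1 = p by omega, show 2 * m - 1 + 1 = 2 * m by omega] at this
      exact_mod_cast this.symm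
    have hm0 : (m : ℚ) ≠ 0 := by exact_mod_cast (show m ≠ 0 by omega)
    have hodd : (-1 : ℚ) ^ (2 * m - 1) = -1 := Odd.neg_one_pow ⟨m - 1, by omega⟩
    rw [choose_pred_eq_prod (q := p - 1), hp1, hprod, hodd, ← harmonic] at hchoose
    rw [← eq_div_iff (by positivity)] at hchoose
    rw [hchoose]
    refine ⟨-2⁻¹ * (((-3 : ℚ) ^ m - 1) * (m : ℚ)⁻¹) * c, mul_mem (mul_mem (neg_mem (inv_two_mem hp3))
      (mul_mem (neg_three_pow_mem m) (inv_mem_pIntegers_of_lt (by omega) (by omega)))) hc, ?_⟩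
    field_simp
    ring
  rw [h', ← Finset.mul_sum] at key
  rw [← mul_zero ((p : ℚ) ^ 1)] at key
  have k1 := PCong.of_pow_mul (k := 1) (m := 2) key
  have k2 := k1.mul_left (z := -2) (neg_mem (natCast_mem_pIntegers 2))
  rw [← Finset.mul_sum, Finset.sum_sub_distrib, ← Finset.mul_sum, ← negThreeSum] at k2
  obtain ⟨c, hc, k3⟩ := k2
  exact ⟨-c, neg_mem hc, by linear_combination -k3⟩

theorem sum_centralSum_div_pCong (hp3 : 3 < p) {n : ℕ} (hn : p = 2 * n + 1) :
    PCong p 1 (∑ j ∈ Finset.range (n + 1), centralSum j / (2 * j + 1))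
      (3 / 2 * negThreeSum n) := by
  refine PCong.of_pow_mul (k := 1) ?_
  have h := (mul_sum_centralSum_div_pCong hp3 hn).trans
    ((sum_neg_three_pow_div_pCong hp3 hn).mul_left (three_half_mem hp3))
  rw [pow_one]
  rwa [mul_left_comm (p : ℚ) (3 / 2)]

/-- The sum `∑_{1 ≤ i ≤ n} C(2i,i) H_i / i`. -/
noncomputable def centralHarmonicSum (n : ℕ) : ℚ :=
  ∑ i ∈ Finset.Icc 1 n, ((2 * i).choose i : ℚ) * harmonic i * (i : ℚ)⁻¹

theorem centralHarmonicSum_mem {n : ℕ} (hn : p = 2 * n + 1) :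
    centralHarmonicSum n ∈ pIntegers p := by
  refine sum_mem fun i hi => ?_
  rw [Finset.mem_Icc] at hi
  exact mul_mem (mul_mem (natCast_mem_pIntegers _) (harmonic_mem (by omega)))
    (inv_mem_pIntegers_of_lt (by omega) (by omega))

theorem sum_centralSum_div_succ_pCong (hp3 : 3 < p) {n : ℕ} (hn : p = 2 * n + 1) :
    PCong p 1 (∑ j ∈ Finset.range (n + 1), centralSum j / (j + 1))
      (-(3 / 2 * centralHarmonicSum n)) := by
  obtain ⟨d, hd, hd'⟩ := centralSum_half_eq hp3 hn
  have h := sum_centralSum_mul_sub harmonic n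
  have h1 : ∀ j : ℕ, centralSum j * (harmonic (j + 1) - harmonic j) = centralSum j / (j + 1) :=
    fun j => by
      rw [harmonic_succ, add_sub_cancel_left, div_eq_mul_inv]
      push_cast
      rfl
  rw [Finset.sum_congr rfl fun j _ => h1 j] at h
  rw [h, hd']
  refine ⟨d * harmonic (n + 1), mul_mem hd (harmonic_mem (by omega)), ?_⟩
  have h2 : ∀ i : ℕ, ((2 * i).choose i : ℚ) / i * harmonic i =
      ((2 * i).choose i : ℚ) * harmonic i * (i : ℚ)⁻¹ := fun i => by
    rw [div_eq_mul_inv]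
    ring
  rw [Finset.sum_congr rfl fun i _ => h2 i, ← centralHarmonicSum]
  ring

theorem sum_gSeq_mul_harmonicTwo_pCong_negThreeSum (hp3 : 3 < p) {n : ℕ} (hn : p = 2 * n + 1) :
    PCong p 1 (∑ k ∈ Finset.Icc 1 (p - 1), (gSeq k : ℚ) * harmonicTwo k)
      (-(3 / 2 * negThreeSum n)) := by
  refine (sum_gSeq_mul_harmonicTwo_pCong hp3 hn).trans ?_
  rw [Finset.sum_neg_distrib]
  simpa using (PCong.refl (0 : ℚ)).sub (sum_centralSum_div_pCong hp3 hn)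

theorem sum_hSeq_mul_harmonicTwo_pCong_negThreeSum (hp3 : 3 < p) {n : ℕ} (hn : p = 2 * n + 1) :
    PCong p 1 (∑ k ∈ Finset.Icc 1 (p - 1), (hSeq k : ℚ) * harmonicTwo k)
      (-(3 * negThreeSum n) - 3 / 2 * centralHarmonicSum n) := by
  refine (sum_hSeq_mul_harmonicTwo_pCong hp3 hn).trans ?_
  -- Partial fractions again; the second part is where `centralHarmonicSum` enters.
  have h1 : ∀ j : ℕ, -(centralSum j / (2 * j + 1)) * ((j : ℚ) + 1)⁻¹ =
      -2 * (centralSum j / (2 * j + 1)) + centralSum j / (j + 1) := by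
    intro j
    have h1 : 2 * (j : ℚ) + 1 ≠ 0 := by positivity
    field_simp
    ring
  rw [Finset.sum_congr rfl fun j _ => h1 j, Finset.sum_add_distrib, ← Finset.mul_sum]
  have h2 := ((sum_centralSum_div_pCong hp3 hn).mul_left
    (neg_mem (natCast_mem_pIntegers (p := p) 2))).add (sum_centralSum_div_succ_pCong hp3 hn)
  convert h2 using 1
  · push_cast
    ring
  · push_cast
    ring

theorem ratCast_negThreeSum (K : Type*) [Field K] [CharP K p] {n : ℕ} (hn : p = 2 * n + 1) :
    (negThreeSum n : K) = ∑ m ∈ Finset.Icc 1 n, ((-3) ^ m - 1) *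
      (∑ i ∈ Finset.Icc 1 (2 * m - 1), (i : K)⁻¹) * (m : K)⁻¹ := by
  rw [negThreeSum, ratCast_sum fun m hm => ?_]
  · refine Finset.sum_congr rfl fun m hm => ?_
    rw [Finset.mem_Icc] at hm
    have h1 := inv_mem_pIntegers_of_lt (p := p) (show 0 < m by omega) (by omega)
    have h2 := harmonic_mem (p := p) (show 2 * m - 1 < p by omega)
    rw [ratCast_mul (mul_mem (neg_three_pow_mem m) h2) h1, ratCast_mul (neg_three_pow_mem m) h2,
      ratCast_inv_natCast (Nat.not_dvd_of_pos_of_lt (by omega) (by omega)),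
      ratCast_harmonic K (by omega)]
    congr 2
    have : ((-3 : ℚ) ^ m - 1) = (((-3) ^ m - 1 : ℤ) : ℚ) := by push_cast; rfl
    rw [this, Rat.cast_intCast]
    push_cast
    rfl
  · rw [Finset.mem_Icc] at hm
    exact mul_mem (mul_mem (neg_three_pow_mem m) (harmonic_mem (by omega)))
      (inv_mem_pIntegers_of_lt (by omega) (by omega))

theorem ratCast_centralHarmonicSum (K : Type*) [Field K] [CharP K p] {n : ℕ}
    (hn : p = 2 * n + 1) :
    (centralHarmonicSum n : K) = ∑ i ∈ Finset.Icc 1 n, ((2 * i).choose i : K) *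
      (∑ l ∈ Finset.Icc 1 i, (l : K)⁻¹) * (i : K)⁻¹ := by
  rw [centralHarmonicSum, ratCast_sum fun i hi => ?_]
  · refine Finset.sum_congr rfl fun i hi => ?_
    rw [Finset.mem_Icc] at hi
    have h1 := inv_mem_pIntegers_of_lt (p := p) (show 0 < i by omega) (by omega)
    have h2 := harmonic_mem (p := p) (show i < p by omega)
    rw [ratCast_mul (mul_mem (natCast_mem_pIntegers _) h2) h1,
      ratCast_mul (natCast_mem_pIntegers _) h2,
      ratCast_inv_natCast (Nat.not_dvd_of_pos_of_lt (by omega) (by omega)),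
      ratCast_harmonic K (by omega), Rat.cast_natCast]
  · rw [Finset.mem_Icc] at hi
    exact mul_mem (mul_mem (natCast_mem_pIntegers _) (harmonic_mem (by omega)))
      (inv_mem_pIntegers_of_lt (by omega) (by omega))

end

/-! ### Finite polylogarithms and their functional equations. -/

open Polynomial

section
variable {p : ℕ} [hpf : Fact p.Prime]

theorem sum_Icc_two_mul {R : Type*} [AddCommMonoid R] (n : ℕ) (g : ℕ → R) :
    ∑ m ∈ Finset.Icc 1 (2 * n), g m = ∑ k ∈ Finset.Icc 1 n, (g (2 * k - 1) + g (2 * k)) := by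
  induction n with
  | zero => simp
  | succ n ih =>
    rw [show 2 * (n + 1) = 2 * n + 1 + 1 by ring, Finset.sum_Icc_succ_top (by omega),
      Finset.sum_Icc_succ_top (by omega), ih, Finset.sum_Icc_succ_top (by omega), add_assoc]
    congr 1

/-- The integral form of `((x + y) ^ p - x ^ p - y ^ p) / p`. -/
def frobeniusDefect (p : ℕ) {R : Type*} [CommRing R] (x y : R) : R :=
  ∑ k ∈ Finset.Icc 1 (p - 1), ((p.choose k / p : ℕ) : R) * x ^ k * y ^ (p - k)

theorem mul_frobeniusDefect {R : Type*} [CommRing R] (x y : R) :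
    (p : R) * frobeniusDefect p x y = (x + y) ^ p - x ^ p - y ^ p := by
  have hp := hpf.out.pos
  rw [add_pow, Finset.sum_range_succ, sum_range_eq_add_sum_Icc hp, frobeniusDefect, Finset.mul_sum]
  have : ∀ k ∈ Finset.Icc 1 (p - 1), (p : R) * (((p.choose k / p : ℕ) : R) * x ^ k * y ^ (p - k)) =
      x ^ k * y ^ (p - k) * p.choose k := by
    intro k hk
    rw [Finset.mem_Icc] at hk
    have hd : p ∣ p.choose k := hpf.out.dvd_choose_self (by omega) (by omega)
    have h : (p : R) * ((p.choose k / p : ℕ) : R) = p.choose k := by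
      rw [← Nat.cast_mul, Nat.mul_div_cancel' hd]
    rw [← h]
    ring
  rw [Finset.sum_congr rfl this]
  simp

omit hpf in
theorem frobeniusDefect_map {R S : Type*} [CommRing R] [CommRing S] (φ : R →+* S) (x y : R) :
    φ (frobeniusDefect p x y) = frobeniusDefect p (φ x) (φ y) := by
  simp [frobeniusDefect]

theorem choose_div_self_cast (K : Type*) [Field K] [CharP K p] {k : ℕ} (hk : 0 < k)
    (hkp : k < p) : ((p.choose k / p : ℕ) : K) = -(-1) ^ k * (k : K)⁻¹ := by
  have hd : p ∣ p.choose k := hpf.out.dvd_choose_self (by omega) (by omega)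
  obtain ⟨c, hc⟩ := hd
  have h1 := Nat.add_one_mul_choose_eq (p - 1) (k - 1)
  rw [show p - 1 + 1 = p by omega, show k - 1 + 1 = k by omega, hc, mul_assoc] at h1
  have h2 : (p - 1).choose (k - 1) = c * k := Nat.eq_of_mul_eq_mul_left hpf.out.pos h1
  have h3 := (pCong_one_iff K (natCast_mem_pIntegers _)
    (pow_mem (neg_mem (one_mem _)) _)).1 (choose_pred_pCong (p := p) (show k - 1 < p by omega))
  have h4 : (((-1 : ℚ) ^ (k - 1) : ℚ) : K) = (-1) ^ (k - 1) := by
    rw [ratCast_pow (p := p) (neg_mem (one_mem _))]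
    simp
  rw [h4, Rat.cast_natCast, h2] at h3
  have hk0 := natCast_ne_zero_of_lt K hk hkp
  rw [hc, Nat.mul_div_cancel_left _ hpf.out.pos, eq_mul_inv_iff_mul_eq₀ hk0]
  push_cast at h3
  rw [h3]
  obtain ⟨m, rfl⟩ : ∃ m, k = m + 1 := ⟨k - 1, by omega⟩
  rw [pow_succ]
  simp

end

section
variable (K : Type*) [Field K] (p : ℕ)

/-- The homogenized finite polylogarithm `∑_{0 < k < p} x^k y^{p-k} / k^r`. -/
def finPolylog (r : ℕ) {R : Type*} [CommRing R] [Algebra K R] (x y : R) : R :=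
  ∑ k ∈ Finset.Icc 1 (p - 1), algebraMap K R ((k : K)⁻¹ ^ r) * x ^ k * y ^ (p - k)

end

section
variable {p : ℕ} [hpf : Fact p.Prime] {K : Type*} [Field K] [CharP K p]
  {R S : Type*} [CommRing R] [Algebra K R] [CommRing S] [Algebra K S]

omit [CharP K p] hpf in
theorem finPolylog_map (φ : R →ₐ[K] S) (r : ℕ) (x y : R) :
    φ (finPolylog K p r x y) = finPolylog K p r (φ x) (φ y) := by
  simp [finPolylog]

omit hpf in
-- Reversal k ↦ p - k with 1/(p-k) = -1/k; this plays the role of the inversion formula.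
theorem finPolylog_swap (r : ℕ) (x y : R) :
    finPolylog K p r y x = (-1) ^ r * finPolylog K p r x y := by
  rw [finPolylog, ← sum_Icc_reflect, finPolylog, Finset.mul_sum]
  refine Finset.sum_congr rfl fun k hk => ?_
  rw [Finset.mem_Icc] at hk
  rw [Nat.cast_sub (by omega), CharP.cast_eq_zero K p, zero_sub, inv_neg, neg_pow,
    show p - (p - k) = k by omega]
  simp only [map_mul, map_pow, map_neg, map_one]
  ring

omit [CharP K p] hpf in
theorem finPolylog_smul (r : ℕ) (c x y : R) :
    finPolylog K p r (c * x) (c * y) = c ^ p * finPolylog K p r x y := by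
  rw [finPolylog, finPolylog, Finset.mul_sum]
  refine Finset.sum_congr rfl fun k hk => ?_
  rw [Finset.mem_Icc] at hk
  have : c ^ p = c ^ k * c ^ (p - k) := by
    rw [← pow_add]
    congr 1
    omega
  rw [mul_pow, mul_pow, this]
  ring

omit [CharP K p] hpf in
theorem finPolylog_zero_left (r : ℕ) (y : R) : finPolylog K p r 0 y = 0 := by
  refine Finset.sum_eq_zero fun k hk => ?_
  rw [Finset.mem_Icc] at hk
  rw [zero_pow (by omega), mul_zero, zero_mul]

omit [CharP K p] hpf in
theorem finPolylog_zero_right (r : ℕ) (x : R) : finPolylog K p r x 0 = 0 := by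
  refine Finset.sum_eq_zero fun k hk => ?_
  rw [Finset.mem_Icc] at hk
  rw [zero_pow (by omega), mul_zero]

theorem finPolylog_one_one {r : ℕ} (hr : 0 < r) (hrp : r < p - 1) :
    finPolylog K p r (1 : R) 1 = 0 := by
  have h := congrArg (algebraMap K R) (sum_Icc_inv_pow K hr hrp)
  rw [map_sum, map_zero] at h
  simpa [finPolylog] using h

/-- Relations for L₁ thus become identities between p-th powers, which are proved in ℤ[X], where p
cancels, and then reduced modulo p. -/
theorem frobeniusDefect_eq (x y : R) : frobeniusDefect p x y = -finPolylog K p 1 (-x) y := by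
  rw [frobeniusDefect, finPolylog, ← Finset.sum_neg_distrib]
  refine Finset.sum_congr rfl fun k hk => ?_
  rw [Finset.mem_Icc] at hk
  have h := congrArg (algebraMap K R) (choose_div_self_cast K (p := p) (k := k) (by omega)
    (by omega))
  rw [map_natCast] at h
  rw [h, neg_pow x]
  simp only [map_mul, map_pow, map_neg, map_one, pow_one]
  ring

theorem finPolylog_one_sub_polynomial (hp2 : Odd p) :
    finPolylog K p 1 (1 - X : K[X]) 1 = finPolylog K p 1 X 1 := by
  have hp0 : (p : ℤ[X]) ≠ 0 := Nat.cast_ne_zero.2 hpf.out.ne_zero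
  have h : frobeniusDefect p (X - 1 : ℤ[X]) 1 = frobeniusDefect p (-X) 1 := by
    refine mul_left_cancel₀ hp0 ?_
    rw [mul_frobeniusDefect, mul_frobeniusDefect, ← neg_sub 1 (X : ℤ[X]), hp2.neg_pow, hp2.neg_pow]
    ring
  have h2 := congrArg (mapRingHom (Int.castRingHom K)) h
  rw [frobeniusDefect_map, frobeniusDefect_map, frobeniusDefect_eq (K := K),
    frobeniusDefect_eq (K := K)] at h2
  simpa using h2

theorem finPolylog_two_mul_polynomial (hp2 : Odd p) :
    finPolylog K p 1 (2 * X : K[X]) 1 = finPolylog K p 1 X (1 - X) + finPolylog K p 1 X 1 +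
      finPolylog K p 1 (-1) 1 * X ^ p := by
  have hp0 : (p : ℤ[X]) ≠ 0 := Nat.cast_ne_zero.2 hpf.out.ne_zero
  have h : frobeniusDefect p (-(2 * X) : ℤ[X]) 1 = frobeniusDefect p (-X) 1 +
      frobeniusDefect p (-X) (1 - X) + X ^ p * frobeniusDefect p 1 1 := by
    refine mul_left_cancel₀ hp0 ?_
    rw [mul_add, mul_add, mul_left_comm, mul_frobeniusDefect, mul_frobeniusDefect,
      mul_frobeniusDefect, mul_frobeniusDefect]
    have h2 : (X : ℤ[X]) ^ p * ((1 + 1) ^ p) = (2 * X) ^ p := by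
      rw [mul_pow]
      ring
    rw [mul_sub, mul_sub, h2, hp2.neg_pow, hp2.neg_pow]
    ring
  have h2 := congrArg (mapRingHom (Int.castRingHom K)) h
  simp only [map_add, map_mul, map_pow] at h2
  rw [frobeniusDefect_map, frobeniusDefect_map, frobeniusDefect_map, frobeniusDefect_map,
    frobeniusDefect_eq (K := K), frobeniusDefect_eq (K := K), frobeniusDefect_eq (K := K),
    frobeniusDefect_eq (K := K)] at h2
  simp only [coe_mapRingHom, Polynomial.map_neg, Polynomial.map_mul, Polynomial.map_X, neg_neg,
    Polynomial.map_one, Polynomial.map_sub, Polynomial.map_ofNat] at h2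
  linear_combination -h2

theorem finPolylog_one_sub (hp2 : Odd p) (x : R) :
    finPolylog K p 1 (1 - x) 1 = finPolylog K p 1 x 1 := by
  have h := congrArg (aeval (R := K) x) (finPolylog_one_sub_polynomial (K := K) hp2)
  rw [finPolylog_map, finPolylog_map] at h
  simpa using h

theorem finPolylog_two_mul (hp2 : Odd p) (x : R) :
    finPolylog K p 1 (2 * x) 1 = finPolylog K p 1 x (1 - x) + finPolylog K p 1 x 1 +
      finPolylog K p 1 (-1) 1 * x ^ p := by
  have h := congrArg (aeval (R := K) x) (finPolylog_two_mul_polynomial (K := K) hp2)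
  simp only [map_add, map_mul, map_pow] at h
  rw [finPolylog_map, finPolylog_map, finPolylog_map, finPolylog_map] at h
  simpa [map_ofNat] using h

theorem derivative_finPolylog_two (f : K[X]) :
    f * derivative (finPolylog K p 2 f 1) = derivative f * finPolylog K p 1 f 1 := by
  rw [finPolylog, derivative_sum, finPolylog, Finset.mul_sum, Finset.mul_sum]
  refine Finset.sum_congr rfl fun k hk => ?_
  rw [Finset.mem_Icc] at hk
  have hk0 := natCast_ne_zero_of_lt K (p := p) (k := k) (by omega) (by omega)
  obtain ⟨m, rfl⟩ : ∃ m, k = m + 1 := ⟨k - 1, by omega⟩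
  simp only [one_pow, mul_one, algebraMap_eq, derivative_C_mul, derivative_pow,
    Nat.add_sub_cancel, pow_one]
  have h : (C (((m + 1 : ℕ) : K)⁻¹ ^ 2) * C ((m + 1 : ℕ) : K)) = C (((m + 1 : ℕ) : K)⁻¹) := by
    rw [← C_mul]
    congr 1
    field_simp
  rw [← h, pow_succ]
  ring

/-- Since p - k ≡ -k, both derivative terms of X^k(1-X)^{p-k} carry the factor k, and 1/X + 1/(1-X)
= 1/(X(1-X)). -/
theorem derivative_finPolylog_two_one_sub :
    X * (1 - X) * derivative (finPolylog K p 2 X (1 - X)) = finPolylog K p 1 (X : K[X]) (1 - X) := by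
  rw [finPolylog, derivative_sum, finPolylog, Finset.mul_sum]
  refine Finset.sum_congr rfl fun k hk => ?_
  rw [Finset.mem_Icc] at hk
  have hk0 := natCast_ne_zero_of_lt K (p := p) (k := k) (by omega) (by omega)
  obtain ⟨j, hj⟩ : ∃ j, p - k = j + 1 := ⟨p - k - 1, by omega⟩
  have hj' : (C ((j + 1 : ℕ) : K)) = - C (k : K) := by
    rw [← hj, Nat.cast_sub (by omega), CharP.cast_eq_zero K p]
    simp
  have h : (C ((k : K)⁻¹ ^ 2) * C (k : K)) = C ((k : K)⁻¹) := by
    rw [← C_mul]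
    congr 1
    field_simp
  obtain ⟨m, rfl⟩ : ∃ m, k = m + 1 := ⟨k - 1, by omega⟩
  rw [hj]
  simp only [algebraMap_eq, derivative_mul, derivative_C, derivative_pow, hj',
    Nat.add_sub_cancel, pow_one, derivative_sub, derivative_one, derivative_X, zero_mul]
  rw [← h, pow_succ, pow_succ]
  ring

omit [CharP K p] hpf in
theorem one_sub_mul_sum_pow (x : R) (q : ℕ) :
    (1 - x) * ∑ k ∈ Finset.Icc 1 q, x ^ k = x - x ^ (q + 1) := by
  induction q with
  | zero => simp
  | succ q ih =>
    rw [Finset.sum_Icc_succ_top (by omega), mul_add, ih]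
    ring

theorem derivative_finPolylog_one :
    X * (1 - X) * derivative (finPolylog K p 1 (X : K[X]) 1) = X - X ^ p := by
  have h : X * derivative (finPolylog K p 1 (X : K[X]) 1) = ∑ k ∈ Finset.Icc 1 (p - 1), X ^ k := by
    rw [finPolylog, derivative_sum, Finset.mul_sum]
    refine Finset.sum_congr rfl fun k hk => ?_
    rw [Finset.mem_Icc] at hk
    have hk0 := natCast_ne_zero_of_lt K (p := p) (k := k) (by omega) (by omega)
    have h : (C ((k : K)⁻¹) * C (k : K)) = 1 := by
      rw [← C_mul, inv_mul_cancel₀ hk0, C_1]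
    obtain ⟨m, rfl⟩ : ∃ m, k = m + 1 := ⟨k - 1, by omega⟩
    simp only [one_pow, mul_one, algebraMap_eq, derivative_C_mul, derivative_pow,
      Nat.add_sub_cancel, pow_one, derivative_X]
    rw [pow_succ]
    linear_combination (X * X ^ m) * h
  rw [mul_comm X, mul_assoc, h, one_sub_mul_sum_pow, Nat.sub_add_cancel hpf.out.one_le]

theorem eq_C_mul_X_pow_of_derivative_eq_zero {f : K[X]} (hf : derivative f = 0)
    (hdeg : f.natDegree ≤ p) (h0 : f.eval 0 = 0) : f = C (f.coeff p) * X ^ p := by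
  ext m
  rw [coeff_C_mul_X_pow]
  split_ifs with hm
  · rw [hm]
  · rcases Nat.lt_or_ge p m with h | h
    · exact coeff_eq_zero_of_natDegree_lt (by omega)
    · rcases Nat.eq_zero_or_pos m with rfl | hm0
      · rw [coeff_zero_eq_eval_zero, h0]
      · have h2 := congrArg (fun g => coeff g (m - 1)) hf
        simp only [coeff_derivative, coeff_zero] at h2
        rw [show m - 1 + 1 = m by omega] at h2
        have h3 : (((m - 1 : ℕ) : K) + 1) = (m : K) := by
          exact_mod_cast congrArg (Nat.cast (R := K)) (show m - 1 + 1 = m by omega)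
        rw [h3] at h2
        exact (mul_eq_zero.1 h2).resolve_right (natCast_ne_zero_of_lt K hm0 (by omega))

/-- In degree at most p a vanishing derivative leaves only a constant and a multiple of X^p: the
value at 0 kills the constant, and the value at 1 or a degree bound kills X^p. -/
theorem eq_zero_of_derivative_eq_zero {f : K[X]} (hf : X * (1 - X) * derivative f = 0)
    (hdeg : f.natDegree ≤ p) (h0 : f.eval 0 = 0) (h1 : f.eval 1 = 0 ∨ f.natDegree < p) :
    f = 0 := by
  have hX : (1 - X : K[X]) ≠ 0 := fun h => by
    have := congrArg (eval 0) h
    simp at this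
  have hf' : derivative f = 0 := (mul_eq_zero.1 hf).resolve_left (mul_ne_zero X_ne_zero hX)
  have h := eq_C_mul_X_pow_of_derivative_eq_zero hf' hdeg h0
  have hc : f.coeff p = 0 := by
    rcases h1 with h1 | h1
    · rw [h] at h1
      simpa using h1
    · exact coeff_eq_zero_of_natDegree_lt h1
  rw [h, hc, C_0, zero_mul]

omit [CharP K p] hpf in
theorem natDegree_finPolylog_le (r : ℕ) {f g : K[X]} (hf : f.natDegree ≤ 1)
    (hg : g.natDegree ≤ 1) : (finPolylog K p r f g).natDegree ≤ p := by
  refine natDegree_sum_le_of_forall_le _ _ fun k hk => ?_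
  rw [Finset.mem_Icc] at hk
  rw [algebraMap_eq, mul_assoc]
  refine (natDegree_C_mul_le _ _).trans (natDegree_mul_le.trans ?_)
  have h1 := natDegree_pow_le_of_le k hf
  have h2 := natDegree_pow_le_of_le (p - k) hg
  omega

omit [CharP K p] in
theorem natDegree_finPolylog_lt (r : ℕ) {f : K[X]} (hf : f.natDegree ≤ 1) :
    (finPolylog K p r f 1).natDegree < p := by
  have hp := hpf.out.pos
  refine lt_of_le_of_lt (natDegree_sum_le_of_forall_le _ _ fun k hk => ?_)
    (show p - 1 < p by omega)
  rw [Finset.mem_Icc] at hk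
  rw [algebraMap_eq, one_pow, mul_one]
  refine (natDegree_C_mul_le _ _).trans ?_
  have h1 := natDegree_pow_le_of_le k hf
  omega

omit [CharP K p] hpf in
theorem eval_finPolylog (r : ℕ) (f g : K[X]) (x : K) :
    (finPolylog K p r f g).eval x = finPolylog K p r (f.eval x) (g.eval x) := by
  have := finPolylog_map (p := p) (aeval (R := K) x) r f g
  simpa [coe_aeval_eq_eval] using this

theorem natDegree_one_sub_X_le : (1 - X : K[X]).natDegree ≤ 1 := by
  compute_degree

/-- Symmetrising under X ↔ 1-X makes the derivative computable from the duplication rule for L₁; the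
X^p terms it creates are absorbed by the multiple of L₁(X). The constant is fixed at 0, and 1 serves
as the second check. -/
theorem finPolylog_two_two_mul (hp3 : 3 < p) :
    finPolylog K p 2 (2 * X : K[X]) 1 + finPolylog K p 2 (2 * (1 - X)) 1 =
      C (finPolylog K p 2 2 1) + finPolylog K p 2 X 1 + finPolylog K p 2 (1 - X) 1 +
        finPolylog K p 2 X (1 - X) - C (finPolylog K p 1 (-1) 1) * finPolylog K p 1 X 1 := by
  have hp2 : Odd p := hpf.out.odd_of_ne_two (by omega)
  have h2 : (2 : K[X]) ≠ 0 := by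
    have := two_natCast_ne_zero K hp3
    intro h
    apply this
    have := congrArg (eval 0) h
    simpa using this
  rw [← sub_eq_zero]
  have hd1 : (2 * X : K[X]).natDegree ≤ 1 := by compute_degree
  have hd2 : (2 * (1 - X) : K[X]).natDegree ≤ 1 := by compute_degree
  have hd3 : (1 - X : K[X]).natDegree ≤ 1 := by compute_degree
  have hdX : (X : K[X]).natDegree ≤ 1 := natDegree_X_le
  refine eq_zero_of_derivative_eq_zero (p := p) ?_ ?_ ?_ (Or.inl ?_)
  · have e1 := derivative_finPolylog_two (p := p) (2 * X : K[X])
    have e2 := derivative_finPolylog_two (p := p) (2 * (1 - X) : K[X])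
    have e3 := derivative_finPolylog_two (p := p) (X : K[X])
    have e4 := derivative_finPolylog_two (p := p) (1 - X : K[X])
    have e5 := derivative_finPolylog_two_one_sub (p := p) (K := K)
    have e6 := derivative_finPolylog_one (p := p) (K := K)
    have e7 := finPolylog_two_mul (p := p) (K := K) hp2 (X : K[X])
    have e8 := finPolylog_two_mul (p := p) (K := K) hp2 (1 - X : K[X])
    have e9 := finPolylog_one_sub (p := p) (K := K) hp2 (X : K[X])
    have e10 := finPolylog_swap (p := p) (K := K) 1 (X : K[X]) (1 - X)
    have e11 : finPolylog K p 1 (-1 : K[X]) 1 = C (finPolylog K p 1 (-1) 1) := by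
      have := finPolylog_map (p := p) (Algebra.ofId K K[X]) 1 (-1) 1
      simpa [Algebra.ofId_apply] using this.symm
    have e12 : (1 - X : K[X]) ^ p = 1 - X ^ p := by
      rw [sub_pow_expChar (p := p), one_pow]
    rw [sub_sub_cancel] at e8
    rw [e9, e10, e11, e12, pow_one] at e8
    rw [e11] at e7
    rw [e7] at e1
    rw [e8] at e2
    rw [e9] at e4
    simp only [derivative_mul, derivative_X, derivative_sub, derivative_one, derivative_ofNat,
      zero_mul, zero_add, mul_one, zero_sub, mul_neg, one_mul, neg_mul] at e1 e2 e3 e4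
    have e1' : X * derivative (finPolylog K p 2 (2 * X : K[X]) 1) = finPolylog K p 1 X (1 - X) +
        finPolylog K p 1 X 1 + C (finPolylog K p 1 (-1) 1) * X ^ p := by
      refine mul_left_cancel₀ h2 ?_
      linear_combination e1
    have e2' : (1 - X) * derivative (finPolylog K p 2 (2 * (1 - X) : K[X]) 1) =
        -(-1 * finPolylog K p 1 X (1 - X) + finPolylog K p 1 X 1 +
          C (finPolylog K p 1 (-1) 1) * (1 - X ^ p)) := by
      refine mul_left_cancel₀ h2 ?_
      linear_combination e2
    simp only [derivative_sub, derivative_add, derivative_C, derivative_mul, zero_mul, zero_add]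
    linear_combination (1 - X) * e1' + X * e2' - (1 - X) * e3 - X * e4 - e5 +
      C (finPolylog K p 1 (-1) 1) * e6
  · have hs : ∀ {f g : K[X]}, f.natDegree ≤ p → g.natDegree ≤ p → (f - g).natDegree ≤ p :=
      fun hf hg => (natDegree_sub_le_of_le hf hg).trans (max_self p).le
    have ha : ∀ {f g : K[X]}, f.natDegree ≤ p → g.natDegree ≤ p → (f + g).natDegree ≤ p :=
      fun hf hg => natDegree_add_le_of_degree_le hf hg
    have h1 : (1 : K[X]).natDegree ≤ 1 := by simp
    exact hs (ha (natDegree_finPolylog_le _ hd1 h1) (natDegree_finPolylog_le _ hd2 h1))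
      (hs (ha (ha (ha (by simp) (natDegree_finPolylog_le _ hdX h1))
        (natDegree_finPolylog_le _ hd3 h1)) (natDegree_finPolylog_le _ hdX hd3))
        ((natDegree_C_mul_le _ _).trans (natDegree_finPolylog_le _ hdX h1)))
  · simp only [eval_sub, eval_add, eval_finPolylog, eval_mul, eval_C, eval_X, eval_one, eval_ofNat,
      mul_zero, sub_zero, mul_one, finPolylog_zero_left]
    rw [finPolylog_one_one (by omega) (by omega)]
    ring
  · simp only [eval_sub, eval_add, eval_finPolylog, eval_mul, eval_C, eval_X, eval_one, eval_ofNat,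
      mul_zero, sub_self, mul_one, finPolylog_zero_left, finPolylog_zero_right]
    rw [finPolylog_one_one (by omega) (by omega), finPolylog_one_one (by omega) (by omega)]
    ring

end

/-! ### Generating functions of harmonic numbers as finite dilogarithms. -/

/-- The harmonic number `∑_{1 ≤ i ≤ k} 1 / i` in a field. -/
def fieldHarmonic (K : Type*) [Field K] (k : ℕ) : K := ∑ i ∈ Finset.Icc 1 k, (i : K)⁻¹

theorem fieldHarmonic_zero (K : Type*) [Field K] : fieldHarmonic K 0 = 0 := by
  simp [fieldHarmonic]

theorem fieldHarmonic_succ (K : Type*) [Field K] (k : ℕ) :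
    fieldHarmonic K (k + 1) = fieldHarmonic K k + ((k + 1 : ℕ) : K)⁻¹ := by
  rw [fieldHarmonic, Finset.sum_Icc_succ_top (by omega), ← fieldHarmonic]

theorem sum_fieldHarmonic_mul_pow {K R : Type*} [Field K] [CommRing R] [Algebra K R] (x : R)
    (q : ℕ) :
    (1 - x) * ∑ k ∈ Finset.Icc 1 q, algebraMap K R (fieldHarmonic K (k - 1)) * x ^ k +
        algebraMap K R (fieldHarmonic K q) * x ^ (q + 1) =
      x * ∑ k ∈ Finset.Icc 1 q, algebraMap K R (k : K)⁻¹ * x ^ k := by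
  induction q with
  | zero => simp [fieldHarmonic_zero]
  | succ q ih =>
    rw [Finset.sum_Icc_succ_top (by omega), Finset.sum_Icc_succ_top (by omega), mul_add, mul_add,
      ← ih, fieldHarmonic_succ, Nat.add_sub_cancel, map_add]
    ring

theorem sum_choose_mul_fieldHarmonic_mul_pow {K R : Type*} [Field K] [CommRing R] [Algebra K R]
    (x : R) (n : ℕ) (hn : ∀ i, 0 < i → i ≤ n → (i : K) ≠ 0) :
    ∑ i ∈ Finset.range (n + 1), algebraMap K R ((n.choose i : K) * fieldHarmonic K i) * x ^ i =
      algebraMap K R (fieldHarmonic K n) * (1 + x) ^ n -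
        ∑ k ∈ Finset.Icc 1 n, algebraMap K R (k : K)⁻¹ * (1 + x) ^ (n - k) := by
  induction n with
  | zero => simp
  | succ n ih =>
    have ih := ih fun i hi hin => hn i hi (by omega)
    have hn0 := hn (n + 1) (by omega) le_rfl
    have h1 : ∑ k ∈ Finset.Icc 1 (n + 1), algebraMap K R (k : K)⁻¹ * (1 + x) ^ (n + 1 - k) =
        (1 + x) * ∑ k ∈ Finset.Icc 1 n, algebraMap K R (k : K)⁻¹ * (1 + x) ^ (n - k) +
          algebraMap K R ((n + 1 : ℕ) : K)⁻¹ := by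
      rw [Finset.sum_Icc_succ_top (by omega), Nat.sub_self, pow_zero, mul_one, Finset.mul_sum]
      congr 1
      refine Finset.sum_congr rfl fun k hk => ?_
      rw [Finset.mem_Icc] at hk
      rw [show n + 1 - k = n - k + 1 by omega, pow_succ]
      ring
    have h2 : algebraMap K R ((n + 1 : ℕ) : K)⁻¹ * (1 + x) ^ (n + 1) =
        algebraMap K R ((n + 1 : ℕ) : K)⁻¹ + ∑ i ∈ Finset.range (n + 1),
          algebraMap K R ((n.choose i : K) * ((i + 1 : ℕ) : K)⁻¹) * x ^ (i + 1) := by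
      rw [add_comm 1 x, add_pow, Finset.sum_range_succ', mul_add, Finset.mul_sum, add_comm]
      congr 1
      · simp
      · refine Finset.sum_congr rfl fun i hi => ?_
        rw [Finset.mem_range] at hi
        have hi0 := hn (i + 1) (by omega) (by omega)
        have h : ((n + 1).choose (i + 1) : K) * ((i + 1 : ℕ) : K) = ((n + 1 : ℕ) : K) * n.choose i := by
          exact_mod_cast congrArg (Nat.cast (R := K)) (Nat.add_one_mul_choose_eq n i).symm
        have h' : (n.choose i : K) * ((i + 1 : ℕ) : K)⁻¹ =
            ((n + 1 : ℕ) : K)⁻¹ * (n + 1).choose (i + 1) := by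
          rw [← div_eq_mul_inv, div_eq_iff hi0, mul_assoc, h, inv_mul_cancel_left₀ hn0]
        rw [h', one_pow, mul_one, map_mul, map_natCast]
        ring
    have h3 : ∑ i ∈ Finset.range (n + 1 + 1),
        algebraMap K R (((n + 1).choose i : K) * fieldHarmonic K i) * x ^ i =
        (1 + x) * ∑ i ∈ Finset.range (n + 1),
          algebraMap K R ((n.choose i : K) * fieldHarmonic K i) * x ^ i +
        ∑ i ∈ Finset.range (n + 1),
          algebraMap K R ((n.choose i : K) * ((i + 1 : ℕ) : K)⁻¹) * x ^ (i + 1) := by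
      have h4 : ∑ i ∈ Finset.range (n + 1),
          algebraMap K R ((n.choose i : K) * fieldHarmonic K i) * x ^ i =
          ∑ i ∈ Finset.range (n + 1),
          algebraMap K R ((n.choose (i + 1) : K) * fieldHarmonic K (i + 1)) * x ^ (i + 1) := by
        rw [Finset.sum_range_succ', Finset.sum_range_succ (n := n)]
        simp [fieldHarmonic_zero]
      rw [Finset.sum_range_succ', add_mul, one_mul]
      nth_rewrite 1 [h4]
      rw [fieldHarmonic_zero, mul_zero, map_zero, zero_mul, add_zero, Finset.mul_sum,
        ← Finset.sum_add_distrib, ← Finset.sum_add_distrib]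
      refine Finset.sum_congr rfl fun i _ => ?_
      rw [Nat.choose_succ_succ, fieldHarmonic_succ]
      push_cast
      ring
    rw [h3, ih, h1, fieldHarmonic_succ, map_add]
    linear_combination -h2

section
variable {p : ℕ} [hpf : Fact p.Prime] {K : Type*} [Field K] [CharP K p]

theorem fieldHarmonic_pred (hp3 : 3 < p) : fieldHarmonic K (p - 1) = 0 := by
  have := sum_Icc_inv_pow K (p := p) (l := 1) (by omega) (by omega)
  simpa [fieldHarmonic] using this

/-- Applying X d/dX removes 1/k; `sum_fieldHarmonic_mul_pow`, whose boundary term vanishes since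
H_{p-1} = 0, and L₁(1-X) = L₁(X) make the derivatives cancel. -/
theorem sum_fieldHarmonic_div_mul_pow_polynomial (hp3 : 3 < p) :
    ∑ k ∈ Finset.Icc 1 (p - 1), C (fieldHarmonic K (k - 1) * (k : K)⁻¹) * X ^ k =
      -finPolylog K p 2 (1 - X : K[X]) 1 := by
  have hp2 : Odd p := hpf.out.odd_of_ne_two (by omega)
  rw [eq_neg_iff_add_eq_zero]
  have hd3 : (1 - X : K[X]).natDegree ≤ 1 := natDegree_one_sub_X_le
  have hdeg : (∑ k ∈ Finset.Icc 1 (p - 1), C (fieldHarmonic K (k - 1) * (k : K)⁻¹) * X ^ k +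
      finPolylog K p 2 (1 - X : K[X]) 1).natDegree < p := by
    have h1 : (∑ k ∈ Finset.Icc 1 (p - 1),
        C (fieldHarmonic K (k - 1) * (k : K)⁻¹) * X ^ k).natDegree ≤ p - 1 :=
      natDegree_sum_le_of_forall_le _ _ fun k hk =>
        (natDegree_C_mul_X_pow_le _ _).trans (Finset.mem_Icc.1 hk).2
    have h2 := natDegree_finPolylog_lt (K := K) (p := p) 2 hd3
    exact lt_of_le_of_lt (natDegree_add_le_of_degree_le h1 (show _ ≤ p - 1 by omega)) (by omega)
  refine eq_zero_of_derivative_eq_zero (p := p) ?_ hdeg.le ?_ (Or.inr hdeg)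
  · have e1 := derivative_finPolylog_two (p := p) (1 - X : K[X])
    rw [finPolylog_one_sub hp2] at e1
    have e2 : X * derivative (∑ k ∈ Finset.Icc 1 (p - 1),
        C (fieldHarmonic K (k - 1) * (k : K)⁻¹) * X ^ k) =
        ∑ k ∈ Finset.Icc 1 (p - 1), C (fieldHarmonic K (k - 1)) * X ^ k := by
      rw [derivative_sum, Finset.mul_sum]
      refine Finset.sum_congr rfl fun k hk => ?_
      rw [Finset.mem_Icc] at hk
      have hk0 := natCast_ne_zero_of_lt K (p := p) (k := k) (by omega) (by omega)
      have h : C (fieldHarmonic K (k - 1) * (k : K)⁻¹) * C (k : K) =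
          C (fieldHarmonic K (k - 1)) := by
        rw [← C_mul, inv_mul_cancel_right₀ hk0]
      rw [← h]
      obtain ⟨m, rfl⟩ : ∃ m, k = m + 1 := ⟨k - 1, by omega⟩
      rw [derivative_C_mul_X_pow, Nat.add_sub_cancel, pow_succ, C_mul]
      ring
    have e3 := sum_fieldHarmonic_mul_pow (K := K) (X : K[X]) (p - 1)
    rw [fieldHarmonic_pred hp3, map_zero, zero_mul, add_zero, algebraMap_eq, ← e2] at e3
    have e4 : finPolylog K p 1 (X : K[X]) 1 =
        ∑ k ∈ Finset.Icc 1 (p - 1), C (k : K)⁻¹ * X ^ k := by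
      simp [finPolylog]
    rw [← e4] at e3
    simp only [derivative_add, derivative_sub, derivative_one, derivative_X, zero_sub,
      neg_mul, one_mul] at e1 ⊢
    linear_combination e3 + X * e1
  · rw [eval_add, eval_finPolylog]
    simp only [eval_sub, eval_one, eval_X, sub_zero]
    rw [finPolylog_one_one (by omega) (by omega), add_zero, eval_finsetSum]
    refine Finset.sum_eq_zero fun k hk => ?_
    rw [Finset.mem_Icc] at hk
    simp [show k ≠ 0 by omega]

theorem sum_fieldHarmonic_div_mul_pow (hp3 : 3 < p) (x : K) :
    ∑ k ∈ Finset.Icc 1 (p - 1), fieldHarmonic K (k - 1) * (k : K)⁻¹ * x ^ k =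
      -finPolylog K p 2 (1 - x) 1 := by
  have h := congrArg (eval x) (sum_fieldHarmonic_div_mul_pow_polynomial (K := K) hp3)
  simpa [eval_finsetSum, eval_finPolylog] using h

theorem finPolylog_one_sub_neg {R : Type*} [CommRing R] [Algebra K R] (hp3 : 3 < p) {n : ℕ}
    (hn : p = 2 * n + 1) (x : R) :
    finPolylog K p 1 x 1 - finPolylog K p 1 (-x) 1 =
      -∑ k ∈ Finset.Icc 1 n, algebraMap K R (k : K)⁻¹ * x ^ (p - 2 * k) := by
  have h2 := two_natCast_ne_zero K hp3
  rw [finPolylog, finPolylog, ← Finset.sum_sub_distrib, ← sum_Icc_reflect,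
    show p - 1 = 2 * n by omega, sum_Icc_two_mul, ← Finset.sum_neg_distrib]
  refine Finset.sum_congr rfl fun k hk => ?_
  rw [Finset.mem_Icc] at hk
  have e1 : Even (p - (2 * k - 1)) := ⟨n + 1 - k, by omega⟩
  have e2 : Odd (p - 2 * k) := ⟨n - k, by omega⟩
  rw [e1.neg_pow, e2.neg_pow, sub_self, zero_add, Nat.cast_sub (by omega),
    CharP.cast_eq_zero K p, zero_sub, inv_neg]
  have h : algebraMap K R (k : K)⁻¹ = 2 * algebraMap K R ((2 * k : ℕ) : K)⁻¹ := by
    rw [← map_ofNat (algebraMap K R) 2, ← map_mul]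
    congr 1
    push_cast
    rw [mul_inv, mul_inv_cancel_left₀ h2]
  rw [h]
  simp only [pow_one, map_neg, one_pow]
  ring

theorem finPolylog_neg_one (hp3 : 3 < p) {n : ℕ} (hn : p = 2 * n + 1) :
    finPolylog K p 1 (-1 : K) 1 = fieldHarmonic K n := by
  have h := finPolylog_one_sub_neg (K := K) hp3 hn (1 : K)
  rw [finPolylog_one_one (by omega) (by omega)] at h
  simp only [one_pow, mul_one, zero_sub, neg_inj] at h
  exact h

theorem choose_two_mul_cast (K : Type*) [Field K] [CharP K p] {n i : ℕ} (hn : p = 2 * n + 1)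
    (hi : i ≤ n) : ((2 * i).choose i : K) = n.choose i * (-4) ^ i := by
  obtain ⟨c, hc, h⟩ := prod_one_sub_mul_eq (p := p) (u := fun j => ((2 * j + 1 : ℕ) : ℚ)⁻¹)
    (k := i) fun j hj => inv_mem_pIntegers_of_lt (by omega) (by omega)
  have hn' : 2 * (n : ℚ) + 1 = p := by exact_mod_cast hn.symm
  have h1 := choose_mul_neg_four_pow n i
  rw [hn', h] at h1
  have h2 : (((n.choose i : ℤ) * (-4) ^ i : ℤ) : ℚ) ∈ pIntegers p := intCast_mem _ _
  have h3 : PCong p 1 (((2 * i).choose i : ℕ) : ℚ) (((n.choose i : ℤ) * (-4) ^ i : ℤ) : ℚ) := by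
    refine ⟨((2 * i).choose i : ℕ) * (∑ j ∈ Finset.range i, ((2 * j + 1 : ℕ) : ℚ)⁻¹ - p * c),
      mul_mem (natCast_mem_pIntegers _) (sub_mem (sum_mem fun j hj => ?_)
        (mul_mem (natCast_mem_pIntegers p) hc)), ?_⟩
    · rw [Finset.mem_range] at hj
      exact inv_mem_pIntegers_of_lt (by omega) (by omega)
    · rw [Int.cast_mul, Int.cast_pow, Int.cast_natCast, Int.cast_neg, Int.cast_ofNat, h1]
      ring
  have h4 := (pCong_one_iff K (natCast_mem_pIntegers _) h2).1 h3
  rw [Rat.cast_natCast, Rat.cast_intCast] at h4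
  rw [h4]
  push_cast
  rfl

/-- Replacing C(2i,i) by (-4)^i C(n,i) makes the variable 1 - 4X(1-X) = (1-2X)². Multiplication by 1
- 2X yields exactly the odd powers (1-2X)^{p-2k}, an odd part of L₁ that the duplication rule
evaluates. -/
theorem one_sub_two_mul_sum_centralBinom_harmonic (hp3 : 3 < p) {n : ℕ} (hn : p = 2 * n + 1) :
    (1 - 2 * X) * ∑ i ∈ Finset.Icc 1 n,
        C (((2 * i).choose i : K) * fieldHarmonic K i) * (X * (1 - X)) ^ i =
      2 * finPolylog K p 1 (X : K[X]) (1 - X) := by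
  have hp2 : Odd p := hpf.out.odd_of_ne_two (by omega)
  have h1 := sum_choose_mul_fieldHarmonic_mul_pow (K := K) (-4 * (X * (1 - X)) : K[X]) n
    fun i hi hin => natCast_ne_zero_of_lt K (p := p) hi (by omega)
  have hsq : (1 + -4 * (X * (1 - X)) : K[X]) = (1 - 2 * X) ^ 2 := by ring
  rw [sum_range_eq_add_sum_Icc (by omega), fieldHarmonic_zero, mul_zero, map_zero, zero_mul,
    zero_add, Nat.add_sub_cancel, hsq] at h1
  have h2 : ∑ i ∈ Finset.Icc 1 n,
      C (((2 * i).choose i : K) * fieldHarmonic K i) * (X * (1 - X)) ^ i =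
      ∑ i ∈ Finset.Icc 1 n,
        algebraMap K K[X] ((n.choose i : K) * fieldHarmonic K i) * (-4 * (X * (1 - X))) ^ i := by
    refine Finset.sum_congr rfl fun i hi => ?_
    rw [Finset.mem_Icc] at hi
    rw [choose_two_mul_cast K hn hi.2, mul_pow (-4 : K[X]), algebraMap_eq]
    simp only [C_mul, C_pow, C_neg, C_ofNat]
    ring
  rw [h2, h1]
  have h3 := finPolylog_one_sub_neg (K := K) hp3 hn (1 - 2 * X : K[X])
  have h4 : (1 - 2 * X) * ∑ k ∈ Finset.Icc 1 n,
      algebraMap K K[X] (k : K)⁻¹ * ((1 - 2 * X) ^ 2) ^ (n - k) =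
      ∑ k ∈ Finset.Icc 1 n, algebraMap K K[X] (k : K)⁻¹ * (1 - 2 * X) ^ (p - 2 * k) := by
    rw [Finset.mul_sum]
    refine Finset.sum_congr rfl fun k hk => ?_
    rw [Finset.mem_Icc] at hk
    rw [← pow_mul, show p - 2 * k = 2 * (n - k) + 1 by omega, pow_succ]
    ring
  have h5 : (1 - 2 * X : K[X]) ^ p = (1 - X) ^ p - X ^ p := by
    rw [← sub_pow_expChar (p := p)]
    ring
  have e7 := finPolylog_two_mul (p := p) (K := K) hp2 (X : K[X])
  have e8 := finPolylog_two_mul (p := p) (K := K) hp2 (1 - X : K[X])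
  have e9 := finPolylog_one_sub (p := p) (K := K) hp2 (X : K[X])
  have e10 := finPolylog_swap (p := p) (K := K) 1 (X : K[X]) (1 - X)
  have e11 : finPolylog K p 1 (-1 : K[X]) 1 = algebraMap K K[X] (fieldHarmonic K n) := by
    have := finPolylog_map (p := p) (Algebra.ofId K K[X]) 1 (-1) 1
    rw [finPolylog_neg_one hp3 hn] at this
    simpa [Algebra.ofId_apply] using this.symm
  have e12 := finPolylog_one_sub (p := p) (K := K) hp2 (2 * X : K[X])
  have e13 := finPolylog_one_sub (p := p) (K := K) hp2 (2 * (1 - X) : K[X])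
  rw [show (1 - 2 * (1 - X) : K[X]) = -(1 - 2 * X) by ring] at e13
  rw [sub_sub_cancel] at e8
  rw [e9, e10, e11, pow_one] at e8
  rw [e11] at e7
  rw [mul_sub, h4]
  have h6 : (1 - 2 * X : K[X]) * (algebraMap K K[X] (fieldHarmonic K n) * ((1 - 2 * X) ^ 2) ^ n) =
      algebraMap K K[X] (fieldHarmonic K n) * (1 - 2 * X) ^ p := by
    rw [← pow_mul, hn, pow_succ _ (2 * n)]
    ring
  rw [h6, h5]
  linear_combination -h3 + e12 - e13 + e7 - e8

theorem sum_centralBinom_harmonic_polynomial (hp3 : 3 < p) {n : ℕ} (hn : p = 2 * n + 1) :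
    ∑ i ∈ Finset.Icc 1 n,
        C (((2 * i).choose i : K) * fieldHarmonic K i * (i : K)⁻¹) * (X * (1 - X)) ^ i =
      2 * finPolylog K p 2 (X : K[X]) (1 - X) := by
  rw [← sub_eq_zero]
  have hd3 : (1 - X : K[X]).natDegree ≤ 1 := natDegree_one_sub_X_le
  have hdX : (X : K[X]).natDegree ≤ 1 := natDegree_X_le
  have hdt : (X * (1 - X) : K[X]).natDegree ≤ 2 := natDegree_mul_le_of_le hdX hd3
  refine eq_zero_of_derivative_eq_zero (p := p) ?_ ?_ ?_ (Or.inl ?_)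
  · have e1 : X * (1 - X) * derivative (∑ i ∈ Finset.Icc 1 n,
        C (((2 * i).choose i : K) * fieldHarmonic K i * (i : K)⁻¹) * (X * (1 - X)) ^ i) =
        (1 - 2 * X) * ∑ i ∈ Finset.Icc 1 n,
          C (((2 * i).choose i : K) * fieldHarmonic K i) * (X * (1 - X)) ^ i := by
      rw [derivative_sum, Finset.mul_sum, Finset.mul_sum]
      refine Finset.sum_congr rfl fun i hi => ?_
      rw [Finset.mem_Icc] at hi
      have hi0 := natCast_ne_zero_of_lt K (p := p) (k := i) (by omega) (by omega)
      have h : C (((2 * i).choose i : K) * fieldHarmonic K i * (i : K)⁻¹) * C (i : K) =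
          C (((2 * i).choose i : K) * fieldHarmonic K i) := by
        rw [← C_mul, inv_mul_cancel_right₀ hi0]
      rw [← h]
      obtain ⟨m, rfl⟩ : ∃ m, i = m + 1 := ⟨i - 1, by omega⟩
      rw [derivative_C_mul, derivative_pow, Nat.add_sub_cancel, pow_succ (X * (1 - X))]
      simp only [derivative_mul, derivative_X, derivative_sub, derivative_one]
      ring
    have e2 := derivative_finPolylog_two_one_sub (p := p) (K := K)
    rw [derivative_sub, derivative_mul, derivative_ofNat, zero_mul, zero_add, mul_sub, e1,
      one_sub_two_mul_sum_centralBinom_harmonic hp3 hn]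
    linear_combination -2 * e2
  · refine (natDegree_sub_le_of_le (natDegree_sum_le_of_forall_le _ _ fun i hi => ?_)
      (natDegree_mul_le_of_le (m := 0) (n := p) (by simp) (natDegree_finPolylog_le _ hdX hd3))).trans
      (show max p (0 + p) ≤ p by simp)
    rw [Finset.mem_Icc] at hi
    refine (natDegree_C_mul_le _ _).trans ((natDegree_pow_le_of_le i hdt).trans ?_)
    omega
  · simp only [eval_sub, eval_mul, eval_finsetSum, eval_finPolylog, eval_C, eval_pow, eval_X,
      zero_mul, finPolylog_zero_left, mul_zero, sub_zero]
    refine Finset.sum_eq_zero fun i hi => ?_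
    rw [Finset.mem_Icc] at hi
    rw [zero_pow (by omega), mul_zero]
  · simp only [eval_sub, eval_mul, eval_finsetSum, eval_finPolylog, eval_C, eval_pow, eval_X,
      eval_one, sub_self, finPolylog_zero_right, mul_zero, sub_zero]
    refine Finset.sum_eq_zero fun i hi => ?_
    rw [Finset.mem_Icc] at hi
    rw [zero_pow (by omega), mul_zero]

end

/-! ### Evaluation at a primitive sixth root of unity. -/

section
variable {p : ℕ} [hpf : Fact p.Prime] {K : Type*} [Field K] [CharP K p]

theorem sum_centralBinom_harmonic_at_root (hp3 : 3 < p) {n : ℕ} (hn : p = 2 * n + 1) {ζ : K}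
    (hζ : ζ * (1 - ζ) = 1) :
    ∑ i ∈ Finset.Icc 1 n, ((2 * i).choose i : K) * fieldHarmonic K i * (i : K)⁻¹ =
      2 * finPolylog K p 2 ζ (1 - ζ) := by
  have h := congrArg (eval ζ) (sum_centralBinom_harmonic_polynomial (K := K) hp3 hn)
  simpa [eval_finsetSum, eval_finPolylog, hζ] using h

theorem pow_mul_one_sub_pow_at_root {ζ : K} (hζ : ζ * (1 - ζ) = 1) : ζ ^ p * (1 - ζ ^ p) = 1 := by
  have h := congrArg (· ^ p) hζ
  simp only [mul_pow, one_pow, sub_pow_expChar] at h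
  exact h

/-- As 1 - ζ = 1/ζ, the symmetry x ↦ 1-x and inversion conflict unless 2 = ζ^p; but then ζ^p(1-ζ^p)
= 1 would force 3 = 0. -/
theorem finPolylog_one_at_root (hp3 : 3 < p) {ζ : K} (hζ : ζ * (1 - ζ) = 1) :
    finPolylog K p 1 ζ 1 = 0 := by
  have hp2 : Odd p := hpf.out.odd_of_ne_two (by omega)
  have h1 := finPolylog_one_sub (K := K) hp2 ζ
  have h2 := finPolylog_smul (K := K) (p := p) 1 (1 - ζ) 1 ζ
  rw [mul_one, mul_comm (1 - ζ), hζ, h1, finPolylog_swap 1 ζ 1, sub_pow_expChar, one_pow] at h2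
  have hz := pow_mul_one_sub_pow_at_root (p := p) hζ
  have h3 : finPolylog K p 1 ζ 1 * (2 - ζ ^ p) = 0 := by linear_combination h2
  refine (mul_eq_zero.1 h3).resolve_right fun h => ?_
  have h4 : ((3 : ℕ) : K) = 0 := by
    push_cast
    linear_combination (1 + ζ ^ p) * h - hz
  exact natCast_ne_zero_of_lt K (by omega) hp3 h4

/-- Even parts of the harmonic generating function at x = 1 - 2ζ, where x² = -3, and at x = 1
produce L₂(2ζ), L₂(2(1-ζ)) and L₂(2); `finPolylog_two_two_mul` eliminates all arguments containing
2. -/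
theorem sum_neg_three_pow_harmonic_at_root (hp3 : 3 < p) {n : ℕ} (hn : p = 2 * n + 1) {ζ : K}
    (hζ : ζ * (1 - ζ) = 1) :
    ∑ m ∈ Finset.Icc 1 n, ((-3) ^ m - 1) * fieldHarmonic K (2 * m - 1) * (m : K)⁻¹ =
      -(finPolylog K p 2 ζ 1 + finPolylog K p 2 (1 - ζ) 1 + finPolylog K p 2 ζ (1 - ζ)) := by
  have h2 := two_natCast_ne_zero K hp3
  have heven : ∀ x : K, ∑ m ∈ Finset.Icc 1 n, (x ^ 2) ^ m * fieldHarmonic K (2 * m - 1) *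
      (m : K)⁻¹ = -(finPolylog K p 2 (1 - x) 1 + finPolylog K p 2 (1 + x) 1) := by
    intro x
    have e1 := sum_fieldHarmonic_div_mul_pow (K := K) hp3 x
    have e2 := sum_fieldHarmonic_div_mul_pow (K := K) hp3 (-x)
    rw [sub_neg_eq_add] at e2
    rw [neg_add, ← e1, ← e2, ← Finset.sum_add_distrib, show p - 1 = 2 * n by omega,
      sum_Icc_two_mul]
    refine Finset.sum_congr rfl fun m hm => ?_
    rw [Finset.mem_Icc] at hm
    have ho : Odd (2 * m - 1) := ⟨m - 1, by omega⟩
    have h3 : (m : K)⁻¹ = 2 * ((2 * m : ℕ) : K)⁻¹ := by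
      push_cast
      rw [mul_inv, mul_inv_cancel_left₀ h2]
    rw [ho.neg_pow, (even_two_mul m).neg_pow, h3, pow_mul]
    ring
  have e1 := heven (1 - 2 * ζ)
  have e2 := heven 1
  have hs : (1 - 2 * ζ) ^ 2 = -3 := by linear_combination -4 * hζ
  rw [hs, show 1 - (1 - 2 * ζ) = 2 * ζ by ring, show 1 + (1 - 2 * ζ) = 2 * (1 - ζ) by ring] at e1
  rw [sub_self, finPolylog_zero_left, zero_add, one_add_one_eq_two, one_pow] at e2
  have h3 := congrArg (eval ζ) (finPolylog_two_two_mul (K := K) hp3)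
  simp only [eval_sub, eval_add, eval_mul, eval_finPolylog, eval_C, eval_X, eval_one,
    eval_ofNat] at h3
  rw [finPolylog_one_at_root hp3 hζ] at h3
  have h4 : ∑ m ∈ Finset.Icc 1 n, ((-3) ^ m - 1) * fieldHarmonic K (2 * m - 1) * (m : K)⁻¹ =
      ∑ m ∈ Finset.Icc 1 n, (-3) ^ m * fieldHarmonic K (2 * m - 1) * (m : K)⁻¹ -
      ∑ m ∈ Finset.Icc 1 n, 1 ^ m * fieldHarmonic K (2 * m - 1) * (m : K)⁻¹ := by
    rw [← Finset.sum_sub_distrib]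
    refine Finset.sum_congr rfl fun m _ => ?_
    rw [one_pow]
    ring
  rw [h4, e1, e2]
  linear_combination -h3

/-- Adding the values at ±x keeps the even k. The first summand accounts for the lower half of the
range of the right-hand side, the second for the upper half after k ↦ p - k. -/
theorem finPolylog_two_duplication (hp3 : 3 < p) (x y : K) :
    2 * (y ^ p * (finPolylog K p 2 x y + finPolylog K p 2 (-x) y) +
        x ^ p * (finPolylog K p 2 y x + finPolylog K p 2 (-y) x)) =
      finPolylog K p 2 (x ^ 2) (y ^ 2) := by
  obtain ⟨n, hn⟩ : ∃ n, p = 2 * n + 1 := hpf.out.odd_of_ne_two (by omega)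
  have h2 := two_natCast_ne_zero K hp3
  have key : ∀ x y : K, 2 * (finPolylog K p 2 x y + finPolylog K p 2 (-x) y) =
      ∑ k ∈ Finset.Icc 1 n, (k : K)⁻¹ ^ 2 * x ^ (2 * k) * y ^ (p - 2 * k) := by
    intro x y
    rw [finPolylog, finPolylog, ← Finset.sum_add_distrib, show p - 1 = 2 * n by omega,
      sum_Icc_two_mul, Finset.mul_sum]
    refine Finset.sum_congr rfl fun k hk => ?_
    rw [Finset.mem_Icc] at hk
    have ho : Odd (2 * k - 1) := ⟨k - 1, by omega⟩
    have h3 : (k : K)⁻¹ = 2 * ((2 * k : ℕ) : K)⁻¹ := by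
      push_cast
      rw [mul_inv, mul_inv_cancel_left₀ h2]
    rw [ho.neg_pow, (even_two_mul k).neg_pow, h3]
    simp only [Algebra.algebraMap_self, RingHom.id_apply]
    ring
  have h3 := key x y
  have h4 := key y x
  have h5 : finPolylog K p 2 (x ^ 2) (y ^ 2) =
      y ^ p * ∑ k ∈ Finset.Icc 1 n, (k : K)⁻¹ ^ 2 * x ^ (2 * k) * y ^ (p - 2 * k) +
      x ^ p * ∑ k ∈ Finset.Icc 1 n, (k : K)⁻¹ ^ 2 * y ^ (2 * k) * x ^ (p - 2 * k) := by
    rw [finPolylog, show p - 1 = 2 * n by omega, sum_Icc_eq_sum_half, Finset.mul_sum,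
      Finset.mul_sum]
    congr 1
    · refine Finset.sum_congr rfl fun k hk => ?_
      rw [Finset.mem_Icc] at hk
      have : (y ^ 2) ^ (p - k) = y ^ p * y ^ (p - 2 * k) := by
        rw [← pow_mul, ← pow_add]
        congr 1
        omega
      rw [this, pow_mul]
      simp only [Algebra.algebraMap_self, RingHom.id_apply]
      ring
    · refine Finset.sum_congr rfl fun k hk => ?_
      rw [Finset.mem_Icc] at hk
      have : (x ^ 2) ^ (p - k) = x ^ p * x ^ (p - 2 * k) := by
        rw [← pow_mul, ← pow_add]
        congr 1
        omega
      rw [← hn, this, show p - (p - k) = k by omega, pow_mul, Nat.cast_sub (by omega),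
        CharP.cast_eq_zero K p, zero_sub, inv_neg]
      simp only [Algebra.algebraMap_self, RingHom.id_apply]
      ring
  rw [h5, ← h3, ← h4]
  ring

/-- The values of `finPolylog 2` that are tied together at a primitive sixth root of unity. -/
theorem finPolylog_two_sixth_root (hp3 : 3 < p) {ζ : K} (hζ : ζ * (1 - ζ) = 1) :
    finPolylog K p 2 (ζ ^ 2) 1 = ζ ^ p * finPolylog K p 2 ζ (1 - ζ) ∧
    finPolylog K p 2 (-ζ) 1 = (1 - ζ ^ p) * finPolylog K p 2 ζ (1 - ζ) ∧
    2 * (finPolylog K p 2 ζ 1 + finPolylog K p 2 (1 - ζ) 1) =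
      3 * finPolylog K p 2 ζ (1 - ζ) := by
  have hp2 : Odd p := hpf.out.odd_of_ne_two (by omega)
  have hz := pow_mul_one_sub_pow_at_root (p := p) hζ
  set z := ζ ^ p with hzdef
  have hzb : (1 - ζ) ^ p = 1 - z := by rw [sub_pow_expChar, one_pow]
  set F := finPolylog K p 2 ζ (1 - ζ) with hF
  have h1 : finPolylog K p 2 (ζ ^ 2) 1 = z * F := by
    rw [hF, ← finPolylog_smul, hζ, sq]
  have hinv : ∀ x : K, finPolylog K p 2 1 x = finPolylog K p 2 x 1 := fun x => by
    rw [finPolylog_swap]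
    ring
  have h2 : finPolylog K p 2 (-ζ) 1 = (1 - z) * F := by
    have e1 := finPolylog_smul (K := K) (p := p) 2 (-ζ) (ζ ^ 2) 1
    rw [show -ζ * ζ ^ 2 = 1 by linear_combination (1 + ζ) * hζ, mul_one, hinv, h1, hp2.neg_pow,
      ← hzdef] at e1
    rw [e1]
    linear_combination F * hz
  refine ⟨h1, h2, ?_⟩
  have h3 := finPolylog_two_duplication (K := K) hp3 ζ 1
  have h4 : finPolylog K p 2 (-1) ζ = -finPolylog K p 2 (-ζ) 1 := by
    have e1 := finPolylog_smul (K := K) (p := p) 2 (-1) (-ζ) 1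
    rw [neg_mul_neg, one_mul, mul_one, hp2.neg_pow, one_pow] at e1
    rw [finPolylog_swap, e1]
    ring
  have h5 : finPolylog K p 2 (1 - ζ) 1 = (1 - z) * finPolylog K p 2 ζ 1 := by
    have e1 := finPolylog_smul (K := K) (p := p) 2 (1 - ζ) 1 ζ
    rw [mul_one, mul_comm (1 - ζ), hζ, hzb, hinv] at e1
    exact e1
  -- Duplication at (ζ,1) reaches only ζ², ±ζ and their inverses, so it becomes a linear relation
  -- between L₂(ζ,1) and F.
  rw [h4, hinv, one_pow, one_pow, ← hzdef, h1, h2] at h3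
  rw [h5]
  linear_combination (1 - z) * h3 - (2 * finPolylog K p 2 ζ 1 + (2 * z - 5) * F) * hz

end

/-! ### Sums over a third of the range and Bernoulli polynomials. -/

theorem one_add_pow_add_pow_sq {R : Type*} [CommRing R] {w : R} (hw : w ^ 2 + w + 1 = 0) (k : ℕ) :
    1 + w ^ k + (w ^ 2) ^ k = if 3 ∣ k then 3 else 0 := by
  have h3 : w ^ 3 = 1 := by linear_combination (w - 1) * hw
  have key : ∀ q r : ℕ, w ^ (3 * q + r) = w ^ r := fun q r => by
    rw [pow_add, pow_mul, h3, one_pow, one_mul]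
  rw [← pow_mul, mul_comm 2 k, pow_mul]
  have hk : w ^ k = w ^ (k % 3) := by
    conv_lhs => rw [← Nat.div_add_mod k 3, key]
  rw [hk]
  simp only [Nat.dvd_iff_mod_eq_zero]
  have : k % 3 < 3 := Nat.mod_lt _ (by norm_num)
  interval_cases k % 3
  · norm_num
  · simp only [one_ne_zero, if_false]
    linear_combination hw
  · simp only [OfNat.ofNat_ne_zero, if_false]
    linear_combination (w ^ 2 - w + 1) * hw

theorem sum_Icc_filter_dvd {R : Type*} [AddCommMonoid R] {d : ℕ} (hd : 0 < d) (n : ℕ)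
    (f : ℕ → R) :
    ∑ k ∈ Finset.Icc 1 n with d ∣ k, f k = ∑ l ∈ Finset.Icc 1 (n / d), f (d * l) := by
  symm
  refine Finset.sum_nbij' (fun l => d * l) (fun k => k / d) ?_ ?_ ?_ ?_ ?_
  · intro l hl
    rw [Finset.mem_Icc, Nat.le_div_iff_mul_le hd, mul_comm] at hl
    rw [Finset.mem_filter, Finset.mem_Icc]
    exact ⟨⟨Nat.mul_pos hd hl.1, hl.2⟩, dvd_mul_right d l⟩
  · intro k hk
    rw [Finset.mem_filter, Finset.mem_Icc] at hk
    rw [Finset.mem_Icc]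
    exact ⟨Nat.div_pos (Nat.le_of_dvd hk.1.1 hk.2) hd, Nat.div_le_div_right hk.1.2⟩
  · exact fun l _ => Nat.mul_div_cancel_left l hd
  · intro k hk
    exact Nat.mul_div_cancel' (Finset.mem_filter.1 hk).2
  · exact fun _ _ => rfl

section
variable {p : ℕ} [hpf : Fact p.Prime]

theorem mod_three_eq_one_or_two (hp3 : 3 < p) : p % 3 = 1 ∨ p % 3 = 2 := by
  have h : ¬ 3 ∣ p := fun h => by
    have := (Nat.prime_dvd_prime_iff_eq Nat.prime_three hpf.out).1 h
    omega
  omega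

/-- The values of L₂ at the cube roots of unity 1, ζ², -ζ are 0, ζ^pF and (1-ζ^p)F, with sum F; the
same sum is the root-of-unity filter selecting multiples of 3. -/
theorem three_mul_finPolylog_sixth_root {K : Type*} [Field K] [CharP K p] (hp3 : 3 < p) {ζ : K}
    (hζ : ζ * (1 - ζ) = 1) :
    3 * finPolylog K p 2 ζ (1 - ζ) = ∑ l ∈ Finset.Icc 1 (p / 3), (l : K)⁻¹ ^ 2 := by
  have h3 : (3 : K) ≠ 0 := by
    have := natCast_ne_zero_of_lt K (p := p) (k := 3) (by omega) hp3
    exact_mod_cast this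
  obtain ⟨e1, e2, -⟩ := finPolylog_two_sixth_root hp3 hζ
  have e3 := finPolylog_one_one (K := K) (p := p) (r := 2) (R := K) (by omega) (by omega)
  have hw : (ζ ^ 2) ^ 2 + ζ ^ 2 + 1 = 0 := by linear_combination -(ζ ^ 2 + ζ + 1) * hζ
  have hw2 : -ζ = (ζ ^ 2) ^ 2 := by linear_combination (ζ ^ 2 + ζ) * hζ
  have e4 : finPolylog K p 2 ζ (1 - ζ) =
      ∑ k ∈ Finset.Icc 1 (p - 1), (k : K)⁻¹ ^ 2 * if 3 ∣ k then (3 : K) else 0 := by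
    have : finPolylog K p 2 ζ (1 - ζ) = finPolylog K p 2 1 1 + finPolylog K p 2 (ζ ^ 2) 1 +
        finPolylog K p 2 (-ζ) 1 := by
      rw [e1, e2, e3]
      ring
    rw [this, hw2]
    simp only [finPolylog, ← Finset.sum_add_distrib]
    refine Finset.sum_congr rfl fun k _ => ?_
    rw [← one_add_pow_add_pow_sq hw]
    simp only [Algebra.algebraMap_self, RingHom.id_apply, one_pow]
    ring
  simp only [mul_ite, mul_zero] at e4
  rw [← Finset.sum_filter, sum_Icc_filter_dvd (by norm_num)] at e4
  have hdiv : (p - 1) / 3 = p / 3 := by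
    have := mod_three_eq_one_or_two (p := p) hp3
    omega
  rw [e4, hdiv, Finset.mul_sum]
  refine Finset.sum_congr rfl fun l _ => ?_
  push_cast
  rw [mul_inv]
  field_simp

theorem bernoulli'_mem_pIntegers {n : ℕ} (hn : n + 1 < p) : bernoulli' n ∈ pIntegers p := by
  induction n using Nat.strong_induction_on with
  | _ n ih =>
    rw [bernoulli'_def]
    refine sub_mem (one_mem _) (sum_mem fun k hk => ?_)
    rw [Finset.mem_range] at hk
    have h : ((n : ℚ) - k + 1) = ((n - k + 1 : ℕ) : ℚ) := by
      rw [Nat.cast_add, Nat.cast_sub hk.le, Nat.cast_one]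
    rw [h, div_eq_mul_inv]
    exact mul_mem (mul_mem (natCast_mem_pIntegers _)
      (inv_mem_pIntegers_of_lt (by omega) (by omega))) (ih k hk (by omega))

theorem coeff_bernoulli_mem_pIntegers {n : ℕ} (hn : n + 1 < p) (i : ℕ) :
    (Polynomial.bernoulli n).coeff i ∈ pIntegers p := by
  rw [coeff_bernoulli]
  split_ifs
  · refine mul_mem ?_ (natCast_mem_pIntegers _)
    rw [_root_.bernoulli]
    exact mul_mem (pow_mem (neg_mem (one_mem _)) _) (bernoulli'_mem_pIntegers (by omega))
  · exact zero_mem _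

theorem eval_mem_pIntegers {f : ℚ[X]} (hf : ∀ i, f.coeff i ∈ pIntegers p) {x : ℚ}
    (hx : x ∈ pIntegers p) : f.eval x ∈ pIntegers p := by
  rw [eval_eq_sum_range]
  exact sum_mem fun i _ => mul_mem (hf i) (pow_mem hx i)

theorem ratCast_eval_congr {K : Type*} [Field K] [CharP K p] {f : ℚ[X]}
    (hf : ∀ i, f.coeff i ∈ pIntegers p) {x y : ℚ} (hx : x ∈ pIntegers p) (hy : y ∈ pIntegers p)
    (hxy : (x : K) = y) : ((f.eval x : ℚ) : K) = (f.eval y : ℚ) := by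
  rw [eval_eq_sum_range, eval_eq_sum_range, ratCast_sum fun i _ => mul_mem (hf i) (pow_mem hx i),
    ratCast_sum fun i _ => mul_mem (hf i) (pow_mem hy i)]
  refine Finset.sum_congr rfl fun i _ => ?_
  rw [ratCast_mul (hf i) (pow_mem hx i), ratCast_mul (hf i) (pow_mem hy i), ratCast_pow hx,
    ratCast_pow hy, hxy]

theorem one_third_mem (hp3 : 3 < p) : (1 / 3 : ℚ) ∈ pIntegers p := by
  have := inv_mem_pIntegers_of_lt (p := p) (k := 3) (by norm_num) hp3
  rw [one_div]
  exact_mod_cast this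

theorem ratCast_one_third (K : Type*) [Field K] [CharP K p] (hp3 : 3 < p) :
    ((1 / 3 : ℚ) : K) = 3⁻¹ := by
  have := ratCast_inv_natCast (K := K) (p := p) (k := 3)
    (Nat.not_dvd_of_pos_of_lt (by norm_num) hp3)
  rw [one_div]
  exact_mod_cast this

theorem eval_bernoulli_one_third_mem (hp3 : 3 < p) :
    (Polynomial.bernoulli (p - 2)).eval (1 / 3 : ℚ) ∈ pIntegers p :=
  eval_mem_pIntegers (coeff_bernoulli_mem_pIntegers (by omega)) (one_third_mem hp3)

theorem legendreBernoulli_mem (hp3 : 3 < p) : legendreBernoulli p ∈ pIntegers p :=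
  mul_mem (intCast_mem _ _) (eval_bernoulli_one_third_mem hp3)

/-- By Fermat 1/l² = l^{p-3}, to which Faulhaber's formula applies. The Bernoulli number B_{p-2}
vanishes, its index being odd and at least 3, and the factor p - 2 reduces to -2. -/
theorem two_mul_sum_Icc_inv_sq {K : Type*} [Field K] [CharP K p] (hp3 : 3 < p) {N : ℕ}
    (hN : N < p) :
    2 * ∑ l ∈ Finset.Icc 1 N, (l : K)⁻¹ ^ 2 =
      -(((Polynomial.bernoulli (p - 2)).eval ((N + 1 : ℕ) : ℚ) : ℚ) : K) := by
  have hodd : Odd (p - 2) := Nat.Odd.sub_even (by omega) (hpf.out.odd_of_ne_two (by omega))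
    even_two
  have h := sum_range_pow_eq_bernoulli_sub (N + 1) (p - 3)
  rw [show (p - 3).succ = p - 2 by omega, bernoulli_eq_zero_of_odd hodd (by omega), sub_zero,
    sum_range_eq_add_sum_Icc (by omega), Nat.cast_zero, zero_pow (by omega), zero_add,
    Nat.add_sub_cancel] at h
  rw [← h]
  have e : ((p - 3 : ℕ) : ℚ) + 1 = ((p : ℤ) - 2 : ℤ) := by
    rw [Nat.cast_sub hp3.le]
    push_cast
    ring
  have e2 : ∑ l ∈ Finset.Icc 1 N, (l : ℚ) ^ (p - 3) =
      ((∑ l ∈ Finset.Icc 1 N, l ^ (p - 3) : ℕ) : ℚ) := by push_cast; rfl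
  rw [e, e2, ratCast_mul (intCast_mem _ _) (natCast_mem_pIntegers _), Rat.cast_intCast,
    Rat.cast_natCast]
  push_cast
  rw [CharP.cast_eq_zero K p, zero_sub, neg_mul, neg_neg]
  congr 1
  refine Finset.sum_congr rfl fun l hl => ?_
  rw [Finset.mem_Icc] at hl
  have hl0 := natCast_ne_zero_of_lt K (p := p) (k := l) (by omega) (by omega)
  have hF : (l : K) ^ p = l := map_natCast (frobenius K p) l
  have hpow : (l : K) ^ (p - 3) * l ^ 3 = l ^ p := by
    rw [← pow_add]
    congr 1
    omega
  rw [hF] at hpow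
  refine mul_right_cancel₀ (pow_ne_zero 3 hl0) ?_
  rw [hpow]
  field_simp

/-- ⌊p/3⌋ + 1 reduces to 2/3 or 1/3 according to p modulo 3. Reflection of the odd-index polynomial
carries 2/3 to 1/3 with a sign, which is how the Legendre symbol arises. -/
theorem two_mul_sum_third_inv_sq (K : Type*) [Field K] [CharP K p] (hp3 : 3 < p) :
    2 * ∑ l ∈ Finset.Icc 1 (p / 3), (l : K)⁻¹ ^ 2 = (legendreBernoulli p : K) := by
  have h3 : (3 : K) ≠ 0 := by
    have := natCast_ne_zero_of_lt K (p := p) (k := 3) (by omega) hp3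
    exact_mod_cast this
  have hodd : Odd (p - 2) := Nat.Odd.sub_even (by omega) (hpf.out.odd_of_ne_two (by omega))
    even_two
  have hB := eval_bernoulli_one_third_mem hp3
  have hcoeff := coeff_bernoulli_mem_pIntegers (p := p) (n := p - 2) (by omega)
  rw [two_mul_sum_Icc_inv_sq hp3 (Nat.div_lt_self hpf.out.pos (by norm_num)), legendreBernoulli,
    ratCast_mul (intCast_mem _ _) hB, Rat.cast_intCast, legendreSym.mod]
  have h0 : (p : K) = 0 := CharP.cast_eq_zero K p
  rcases mod_three_eq_one_or_two hp3 with h | h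
  · have hleg : legendreSym 3 ((p : ℤ) % 3) = 1 := by
      rw [show (p : ℤ) % 3 = 1 by omega]
      decide
    have hx : (((p / 3 + 1 : ℕ) : ℚ) : K) = ((1 - 1 / 3 : ℚ) : K) := by
      rw [ratCast_sub (one_mem _) (one_third_mem hp3), ratCast_one_third K hp3, Rat.cast_one,
        Rat.cast_natCast]
      have : ((p + 2 : ℕ) : K) = ((3 * (p / 3 + 1) : ℕ) : K) := by
        congr 1
        omega
      push_cast at this ⊢
      rw [h0] at this
      field_simp
      linear_combination -this
    rw [ratCast_eval_congr hcoeff (natCast_mem_pIntegers _)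
      (sub_mem (one_mem _) (one_third_mem hp3)) hx, bernoulli_eval_one_sub, hodd.neg_one_pow,
      neg_one_mul, Rat.cast_neg, neg_neg]
    push_cast
    rw [hleg, Int.cast_one, one_mul]
  · have hleg : legendreSym 3 ((p : ℤ) % 3) = -1 := by
      rw [show (p : ℤ) % 3 = 2 by omega]
      decide
    have hx : (((p / 3 + 1 : ℕ) : ℚ) : K) = ((1 / 3 : ℚ) : K) := by
      rw [ratCast_one_third K hp3, Rat.cast_natCast]
      have : ((p + 1 : ℕ) : K) = ((3 * (p / 3 + 1) : ℕ) : K) := by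
        congr 1
        omega
      push_cast at this ⊢
      rw [h0] at this
      field_simp
      linear_combination -this
    rw [ratCast_eval_congr hcoeff (natCast_mem_pIntegers _) (one_third_mem hp3) hx]
    push_cast
    rw [hleg, Int.cast_neg, Int.cast_one, neg_one_mul]

end

/-! ### Assembling the constants. -/

section
variable {p : ℕ} [hpf : Fact p.Prime]

theorem five_eighths_mem (hp3 : 3 < p) : (5 / 8 : ℚ) ∈ pIntegers p := by
  have : (5 / 8 : ℚ) = 5 * 2⁻¹ ^ 3 := by norm_num
  rw [this]
  exact mul_mem (ofNat_mem (pIntegers p) 5) (pow_mem (inv_two_mem hp3) 3)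

theorem three_quarters_mem (hp3 : 3 < p) : (3 / 4 : ℚ) ∈ pIntegers p := by
  have : (3 / 4 : ℚ) = 3 * 2⁻¹ ^ 2 := by norm_num
  rw [this]
  exact mul_mem (ofNat_mem (pIntegers p) 3) (pow_mem (inv_two_mem hp3) 2)

theorem exists_mul_one_sub_eq_one (K : Type*) [Field K] [IsAlgClosed K] :
    ∃ ζ : K, ζ * (1 - ζ) = 1 := by
  obtain ⟨ζ, hζ⟩ := IsAlgClosed.exists_root (C 1 * X ^ 2 + C (-1) * X + C 1 : K[X]) (by
    rw [degree_quadratic one_ne_zero]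
    decide)
  refine ⟨ζ, ?_⟩
  simp only [IsRoot.def, eval_add, eval_mul, eval_pow, eval_X, eval_C] at hζ
  linear_combination -hζ

/-- In terms of F = L₂(ζ,1-ζ) the three quantities are -(5/2)F, 2F and 6F. -/
theorem ratCast_negThreeSum_add (K : Type*) [Field K] [CharP K p] [IsAlgClosed K] (hp3 : 3 < p)
    {n : ℕ} (hn : p = 2 * n + 1) :
    12 * (negThreeSum n : K) = -(5 * (legendreBernoulli p : K)) ∧
    3 * (centralHarmonicSum n : K) = (legendreBernoulli p : K) := by
  obtain ⟨ζ, hζ⟩ := exists_mul_one_sub_eq_one K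
  have e1 : (negThreeSum n : K) = -(finPolylog K p 2 ζ 1 + finPolylog K p 2 (1 - ζ) 1 +
      finPolylog K p 2 ζ (1 - ζ)) :=
    (ratCast_negThreeSum K hn).trans (sum_neg_three_pow_harmonic_at_root hp3 hn hζ)
  have e2 : (centralHarmonicSum n : K) = 2 * finPolylog K p 2 ζ (1 - ζ) :=
    (ratCast_centralHarmonicSum K hn).trans (sum_centralBinom_harmonic_at_root hp3 hn hζ)
  have e3 := (finPolylog_two_sixth_root (K := K) hp3 hζ).2.2
  have e4 := three_mul_finPolylog_sixth_root (K := K) hp3 hζ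
  have e5 := two_mul_sum_third_inv_sq K hp3
  rw [← e4] at e5
  constructor
  · rw [e1, ← e5]
    linear_combination (-6) * e3
  · rw [e2, ← e5]
    ring

theorem negThreeSum_pCong (hp3 : 3 < p) {n : ℕ} (hn : p = 2 * n + 1) :
    PCong p 1 (12 * negThreeSum n) (-(5 * legendreBernoulli p)) := by
  have hN := negThreeSum_mem hn
  have hB := legendreBernoulli_mem hp3
  rw [pCong_one_iff (AlgebraicClosure (ZMod p)) (mul_mem (ofNat_mem (pIntegers p) 12) hN)
    (neg_mem (mul_mem (ofNat_mem (pIntegers p) 5) hB)), Rat.cast_neg,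
    ratCast_mul (ofNat_mem (pIntegers p) 12) hN, ratCast_mul (ofNat_mem (pIntegers p) 5) hB]
  simpa using (ratCast_negThreeSum_add (AlgebraicClosure (ZMod p)) hp3 hn).1

theorem centralHarmonicSum_pCong (hp3 : 3 < p) {n : ℕ} (hn : p = 2 * n + 1) :
    PCong p 1 (3 * centralHarmonicSum n) (legendreBernoulli p) := by
  have hY := centralHarmonicSum_mem hn
  rw [pCong_one_iff (AlgebraicClosure (ZMod p)) (mul_mem (ofNat_mem (pIntegers p) 3) hY)
    (legendreBernoulli_mem hp3), ratCast_mul (ofNat_mem (pIntegers p) 3) hY]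
  simpa using (ratCast_negThreeSum_add (AlgebraicClosure (ZMod p)) hp3 hn).2

theorem sum_gSeq_mul_harmonicTwo_pCong_legendreBernoulli (hp3 : 3 < p) :
    PCong p 1 (∑ k ∈ Finset.Icc 1 (p - 1), (gSeq k : ℚ) * harmonicTwo k)
      (5 / 8 * legendreBernoulli p) := by
  obtain ⟨n, hn⟩ : ∃ n, p = 2 * n + 1 := hpf.out.odd_of_ne_two (by omega)
  have h8 : (-(1 / 8) : ℚ) ∈ pIntegers p := by
    rw [show (-(1 / 8) : ℚ) = -(2⁻¹ ^ 3) by norm_num]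
    exact neg_mem (pow_mem (inv_two_mem hp3) 3)
  refine (sum_gSeq_mul_harmonicTwo_pCong_negThreeSum hp3 hn).trans ?_
  -- The multiplier -1/8 turns 12N into -(3/2)N.
  convert (negThreeSum_pCong hp3 hn).mul_left h8 using 1 <;> ring

theorem sum_hSeq_mul_harmonicTwo_pCong_legendreBernoulli (hp3 : 3 < p) :
    PCong p 1 (∑ k ∈ Finset.Icc 1 (p - 1), (hSeq k : ℚ) * harmonicTwo k)
      (3 / 4 * legendreBernoulli p) := by
  obtain ⟨n, hn⟩ : ∃ n, p = 2 * n + 1 := hpf.out.odd_of_ne_two (by omega)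
  have h4 : (-(1 / 4) : ℚ) ∈ pIntegers p := by
    rw [show (-(1 / 4) : ℚ) = -(2⁻¹ ^ 2) by norm_num]
    exact neg_mem (pow_mem (inv_two_mem hp3) 2)
  refine (sum_hSeq_mul_harmonicTwo_pCong_negThreeSum hp3 hn).trans ?_
  convert ((negThreeSum_pCong hp3 hn).mul_left h4).sub
    ((centralHarmonicSum_pCong hp3 hn).mul_left (inv_two_mem hp3)) using 1 <;> ring

/-- Passage from congruences in `pIntegers p` to those of the theorem. -/
theorem ratModEq_of_pCong {S T r : ℚ} (hr : r ∈ pIntegers p) (h1 : PCong p 3 S (p ^ 2 * T))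
    (h2 : PCong p 1 T r) :
    (RatModEq p 1 ((1 / (p : ℚ) ^ 2) * S) T ∧ RatModEq p 1 T r) ∧
      RatModEq p 3 S ((p : ℚ) ^ 2 * r) := by
  have hp0 : (p : ℚ) ≠ 0 := Nat.cast_ne_zero.2 hpf.out.ne_zero
  have hT := h2.mem_left hr
  have h3 : PCong p 1 ((1 / (p : ℚ) ^ 2) * S) T := by
    refine PCong.of_pow_mul (k := 2) ?_
    rwa [← mul_assoc, mul_one_div_cancel (pow_ne_zero 2 hp0), one_mul]
  have hpr : (p : ℚ) ^ 2 * r ∈ pIntegers p := mul_mem (pow_mem (natCast_mem_pIntegers p) 2) hr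
  have h4 : PCong p 3 S ((p : ℚ) ^ 2 * r) := h1.trans (h2.pow_mul (k := 2))
  simp only [ratModEq_iff]
  exact ⟨⟨⟨h3.mem_left hT, hT, h3⟩, hT, hr, h2⟩, h4.mem_left hpr, hpr, h4⟩

end

theorem theorem1p2 (p : ℕ) (hp : p.Prime) (hp3 : 3 < p) :
    (RatModEq p 1 ((1 / (p : ℚ) ^ 2) * ∑ k ∈ Finset.Icc 1 (p - 1), (gSeq k : ℚ))
        (∑ k ∈ Finset.Icc 1 (p - 1), (gSeq k : ℚ) * harmonicTwo k) ∧
      RatModEq p 1 (∑ k ∈ Finset.Icc 1 (p - 1), (gSeq k : ℚ) * harmonicTwo k)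
        (5 / 8 * legendreBernoulli p)) ∧
    (RatModEq p 1 ((1 / (p : ℚ) ^ 2) * ∑ k ∈ Finset.Icc 1 (p - 1), (hSeq k : ℚ))
        (∑ k ∈ Finset.Icc 1 (p - 1), (hSeq k : ℚ) * harmonicTwo k) ∧
      RatModEq p 1 (∑ k ∈ Finset.Icc 1 (p - 1), (hSeq k : ℚ) * harmonicTwo k)
        (3 / 4 * legendreBernoulli p)) ∧
    RatModEq p 3 (∑ k ∈ Finset.Icc 1 (p - 1), (gSeq k : ℚ))
      ((p : ℚ) ^ 2 * (5 / 8 * legendreBernoulli p)) ∧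
    RatModEq p 3 (∑ k ∈ Finset.Icc 1 (p - 1), (hSeq k : ℚ))
      ((p : ℚ) ^ 2 * (3 / 4 * legendreBernoulli p)) := by
  have : Fact p.Prime := ⟨hp⟩
  have hB := legendreBernoulli_mem (p := p) hp3
  obtain ⟨hg, hg3⟩ := ratModEq_of_pCong (mul_mem (five_eighths_mem hp3) hB) (sum_gSeq_pCong hp3)
    (sum_gSeq_mul_harmonicTwo_pCong_legendreBernoulli hp3)
  obtain ⟨hh, hh3⟩ := ratModEq_of_pCong (mul_mem (three_quarters_mem hp3) hB)
    (sum_hSeq_pCong hp3) (sum_hSeq_mul_harmonicTwo_pCong_legendreBernoulli hp3)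
  exact ⟨hg, hh, hg3, hh3⟩
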